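/- Let $p$ be a prime. For a group $G$ let $\gamma_1(G)=G$, $\gamma_{n+1}(G)=[\gamma_n(G),G]$ be its lower central series and let $D_n(G)=\{g\in G\mid 1-g\in\omega^n\}$, $n\ge 1$, be its dimension subgroups over $\mathbb F_p$, where $\omega$ is the augmentation ideal of the group algebra $\mathbb F_p[G]$. Let $\operatorname{gr}^{\mathscr M}_\bullet(G)=\bigoplus_{n\ge1}\gamma_n(G)/\gamma_{n+1}(G)$ be the Magnus $\mathbb Z$-Lie algebra and $\operatorname{gr}^{\mathcal Z}_\bullet(G)=\bigoplus_{n\ge1}D_n(G)/D_{n+1}(G)$ the Zassenhaus restricted $\mathbb F_p$-Lie algebra; both brackets are induced by group commutators, and the $p$-map of the latter is induced by $x\mapsto x^p$, sending $D_n(G)/D_{n+1}(G)$ to $D_{pn}(G)/D_{pn+1}(G)$. Let $\mathscr L\mapsto\mathscr L^{[p]}$ be the left adjoint of the forgetful functor from restricted $\mathbb F_p$-Lie algebras to $\mathbb F_p$-Lie algebras, and let $$\hat\theta_G:(\operatorname{gr}^{\mathscr M}_\bullet(G)\otimes\mathbb F_p)^{[p]}\longrightarrow\operatorname{gr}^{\mathcal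 Z}_\bullet(G)$$ be the homomorphism of restricted Lie algebras that corresponds under this adjunction to the Lie algebra homomorphism $\theta_G:\operatorname{gr}^{\mathscr M}_\bullet(G)\otimes\mathbb F_p\to\operatorname{gr}^{\mathcal Z}_\bullet(G)$, $x\gamma_{n+1}(G)\otimes 1\mapsto xD_{n+1}(G)$ for $x\in\gamma_n(G)$. If $G$ is a uniformly powerful pro-$p$ group, that is, a (topologically) finitely generated, torsion-free pro-$p$ group such that $[G,G]$ is contained in the closure of the subgroup generated by all $p$-th powers if $p$ is odd, respectively all fourth powers if $p=2$, then $\operatorname{gr}^{\mathcal Z}_\bullet(G)$ is an abelian Lie algebra, and $\ker(\hat\theta_G)$ is the restricted Lie ideal (i.e. the smallest Lie ideal closed under the $p$-map) of $(\operatorname{gr}^{\mathscr M}_\bullet(G)\otimes\mathbb F_p)^{[p]}$ generated by the image of $\operatorname{gr}^{\mathscr M}_{\ge2}(G)\otimes\mathbb F_p$, where $\operatorname{gr}^{\mathscr M}_{\ge2}(G)=\bigoplus_{n\ge2}\gamma_n(G)/\gamma_{n+1}(G)$. -/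

import Mathlib

open scoped DirectSum TensorProduct

universe u v w

/-- A descending strongly central series `H 1 ≥ H 2 ≥ …` of subgroups of `G`, that is
`⁅H i, H j⁆ ≤ H (i + j)`. -/
structure CentralSeries (G : Type u) [Group G] where
  /-- the `n`-th term, `n ≥ 1` -/
  term : ℕ+ → Subgroup G
  antitone : Antitone term
  commutator_le : ∀ i j, ⁅term i, term j⁆ ≤ term (i + j)

namespace CentralSeries

attribute [local instance] commutatorElement

variable {G : Type u} [Group G] (H : CentralSeries G)

theorem comm_mem {i j : ℕ+} {x y : G} (hx : x ∈ H.term i) (hy : y ∈ H.term j) :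
    ⁅x, y⁆ ∈ H.term (i + j) :=
  H.commutator_le i j (Subgroup.commutator_mem_commutator hx hy)

theorem mem_of_le {i j : ℕ+} (h : i ≤ j) {x : G} (hx : x ∈ H.term j) : x ∈ H.term i :=
  H.antitone h hx

theorem conj_mul_inv_mem {i n : ℕ+} {x y : G} (hx : x ∈ H.term i) (hy : y ∈ H.term n) :
    x * y * x⁻¹ * y⁻¹ ∈ H.term (n + 1) := by
  have h := H.comm_mem hx hy
  rw [commutatorElement_def] at h
  refine H.mem_of_le ?_ h
  rw [add_comm i n]
  exact add_le_add_right one_le n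

theorem conj_mem {i n : ℕ+} {x y : G} (hx : x ∈ H.term i) (hy : y ∈ H.term n) :
    x * y * x⁻¹ ∈ H.term n := by
  have h := H.mem_of_le (PNat.lt_add_right n 1).le (H.conj_mul_inv_mem hx hy)
  simpa using mul_mem h hy

instance normal_succ (n : ℕ+) : ((H.term (n + 1)).subgroupOf (H.term n)).Normal where
  conj_mem := by
    rintro ⟨y, hy'⟩ hy ⟨x, hx⟩
    rw [Subgroup.mem_subgroupOf] at hy ⊢
    exact H.conj_mem hx hy

/-- The `n`-th homogeneous component `H n / H (n + 1)`, written additively. -/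
def Layer (n : ℕ+) : Type u :=
  Additive (↥(H.term n) ⧸ (H.term (n + 1)).subgroupOf (H.term n))

instance (n : ℕ+) : AddGroup (H.Layer n) :=
  inferInstanceAs (AddGroup (Additive (↥(H.term n) ⧸ (H.term (n + 1)).subgroupOf (H.term n))))

/-- The class `g H (n + 1)` of an element `g` of `H n`. -/
def layerMk (n : ℕ+) (g : G) (hg : g ∈ H.term n) : H.Layer n :=
  Additive.ofMul (QuotientGroup.mk (⟨g, hg⟩ : H.term n))

theorem layerMk_mul (n : ℕ+) {g h : G} (hg : g ∈ H.term n) (hh : h ∈ H.term n) :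
    H.layerMk n (g * h) (mul_mem hg hh) = H.layerMk n g hg + H.layerMk n h hh := rfl

theorem layerMk_one (n : ℕ+) : H.layerMk n 1 (one_mem _) = 0 := rfl

theorem layerMk_surj (n : ℕ+) (x : H.Layer n) : ∃ g hg, H.layerMk n g hg = x := by
  obtain ⟨⟨g, hg⟩, h⟩ := QuotientGroup.mk_surjective (Additive.toMul x)
  exact ⟨g, hg, h⟩

theorem layerMk_eq {n : ℕ+} {g h : G} {hg : g ∈ H.term n} {hh : h ∈ H.term n} :
    H.layerMk n g hg = H.layerMk n h hh ↔ g⁻¹ * h ∈ H.term (n + 1) := by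
  refine Additive.ofMul.injective.eq_iff.trans (QuotientGroup.eq.trans ?_)
  rw [Subgroup.mem_subgroupOf]
  rfl

theorem layerMk_eq_zero {n : ℕ+} {g : G} {hg : g ∈ H.term n} :
    H.layerMk n g hg = 0 ↔ g ∈ H.term (n + 1) := by
  rw [← layerMk_one, layerMk_eq]
  simp

theorem layerMk_congr {n : ℕ+} {g h : G} (e : g = h) (hg : g ∈ H.term n) (hh : h ∈ H.term n) :
    H.layerMk n g hg = H.layerMk n h hh := by
  subst e; rfl

theorem layerMk_conj {i n : ℕ+} {x g : G} (hx : x ∈ H.term i) (hg : g ∈ H.term n) :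
    H.layerMk n (x * g * x⁻¹) (H.conj_mem hx hg) = H.layerMk n g hg := by
  rw [eq_comm, layerMk_eq]
  have h := H.conj_mem (inv_mem hg) (H.conj_mul_inv_mem hx hg)
  simpa [mul_assoc] using h

instance (n : ℕ+) : AddCommGroup (H.Layer n) where
  add_comm x y := by
    obtain ⟨g, hg, rfl⟩ := H.layerMk_surj n x
    obtain ⟨h, hh, rfl⟩ := H.layerMk_surj n y
    rw [← layerMk_mul, ← layerMk_mul, layerMk_eq]
    have := H.conj_mul_inv_mem (inv_mem hh) (inv_mem hg)
    simpa [mul_assoc] using this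

/-- A map on `H n` that is multiplicative and trivial on `H (n + 1)` descends to the layer. -/
def liftHom {n : ℕ+} {A : Type*} [AddGroup A] (f : H.term n → A)
    (hf : ∀ x y, f (x * y) = f x + f y) (hk : ∀ x : H.term n, (x : G) ∈ H.term (n + 1) → f x = 0) :
    H.Layer n →+ A :=
  MonoidHom.toAdditiveLeft (QuotientGroup.lift ((H.term (n + 1)).subgroupOf (H.term n))
    (MonoidHom.mk' (fun x => Multiplicative.ofAdd (f x)) (fun x y => congrArg _ (hf x y)))
    (fun x hx => congrArg Multiplicative.ofAdd (hk x (Subgroup.mem_subgroupOf.1 hx))))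

theorem liftHom_mk {n : ℕ+} {A : Type*} [AddGroup A] (f : H.term n → A)
    (hf : ∀ x y, f (x * y) = f x + f y) (hk : ∀ x : H.term n, (x : G) ∈ H.term (n + 1) → f x = 0)
    (g : G) (hg : g ∈ H.term n) : H.liftHom f hf hk (H.layerMk n g hg) = f ⟨g, hg⟩ := rfl

/-- The graded abelian group `⨁_{n ≥ 1} H n / H (n + 1)`. -/
def Gr : Type u := ⨁ n : ℕ+, H.Layer n

instance : AddCommGroup H.Gr := inferInstanceAs (AddCommGroup (⨁ n : ℕ+, H.Layer n))

/-- The inclusion of the `n`-th homogeneous component. -/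
def incl (n : ℕ+) : H.Layer n →+ H.Gr := DirectSum.of H.Layer n

/-- The projection to the `n`-th homogeneous component. -/
def proj (n : ℕ+) : H.Gr →+ H.Layer n := DFinsupp.evalAddMonoidHom n

/-- The homogeneous element `g H (n + 1)` of degree `n`. -/
def cls (n : ℕ+) (g : G) (hg : g ∈ H.term n) : H.Gr := H.incl n (H.layerMk n g hg)

theorem cls_mul (n : ℕ+) {g h : G} (hg : g ∈ H.term n) (hh : h ∈ H.term n) :
    H.cls n (g * h) (mul_mem hg hh) = H.cls n g hg + H.cls n h hh := by
  rw [cls, layerMk_mul, map_add]; rfl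

theorem cls_inv (n : ℕ+) {g : G} (hg : g ∈ H.term n) :
    H.cls n g⁻¹ (inv_mem hg) = - H.cls n g hg := by
  rw [eq_neg_iff_add_eq_zero, ← cls_mul, cls]
  simp [layerMk_one]

theorem cls_congr {n m : ℕ+} (h : n = m) {g : G} (hg : g ∈ H.term n) (hg' : g ∈ H.term m) :
    H.cls n g hg = H.cls m g hg' := by
  subst h; rfl

theorem cls_congr_left {n : ℕ+} {g h : G} (hg : g ∈ H.term n) (hh : h ∈ H.term n)
    (e : g⁻¹ * h ∈ H.term (n + 1)) : H.cls n g hg = H.cls n h hh :=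
  congrArg _ (H.layerMk_eq.2 e)

theorem cls_eq_zero {n : ℕ+} {g : G} (hg : g ∈ H.term n) (h : g ∈ H.term (n + 1)) :
    H.cls n g hg = 0 := by
  rw [cls, H.layerMk_eq_zero.2 h, map_zero]

/-- Additive maps out of the graded group, given on each component. -/
def toHom {A : Type*} [AddCommGroup A] (f : ∀ n, H.Layer n →+ A) : H.Gr →+ A :=
  DirectSum.toAddMonoid f

theorem toHom_incl {A : Type*} [AddCommGroup A] (f : ∀ n, H.Layer n →+ A) (n : ℕ+)
    (x : H.Layer n) : H.toHom f (H.incl n x) = f n x :=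
  DirectSum.toAddMonoid_of f n x

theorem gr_induction {P : H.Gr → Prop} (h0 : P 0) (h1 : ∀ n g hg, P (H.cls n g hg))
    (h2 : ∀ x y, P x → P y → P (x + y)) (x : H.Gr) : P x := by
  refine DirectSum.induction_on x h0 ?_ h2
  intro n y
  obtain ⟨g, hg, rfl⟩ := H.layerMk_surj n y
  exact h1 n g hg

/-- The bracket with a fixed homogeneous element `x H (i + 1)`, on the `j`-th component. -/
def adLayer (i j : ℕ+) (x : H.term i) : H.Layer j →+ H.Layer (i + j) :=
  H.liftHom (fun y => H.layerMk (i + j) ⁅(x : G), (y : G)⁆ (H.comm_mem x.2 y.2))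
    (by
      intro y z
      have e := commutatorElement_mul_right_eq_mul_conj (x : G) y z
      have hz := H.comm_mem x.2 z.2
      rw [← H.layerMk_conj y.2 hz, ← layerMk_mul]
      refine H.layerMk_congr ?_ _ _
      rw [Subgroup.coe_mul, e]
      simp only [mul_assoc])
    (by
      intro y hy
      rw [layerMk_eq_zero]
      have := H.comm_mem x.2 hy
      rwa [← add_assoc] at this)

theorem adLayer_mk (i j : ℕ+) (x : H.term i) (y : G) (hy : y ∈ H.term j) :
    H.adLayer i j x (H.layerMk j y hy) = H.layerMk (i + j) ⁅(x : G), y⁆ (H.comm_mem x.2 hy) := rfl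

/-- The biadditive map `(x H (i + 1), y H (j + 1)) ↦ ⁅x, y⁆ H (i + j + 1)`. -/
def layerBracket (i j : ℕ+) : H.Layer i →+ H.Layer j →+ H.Layer (i + j) :=
  H.liftHom (H.adLayer i j)
    (by
      intro x y
      ext t
      obtain ⟨z, hz, rfl⟩ := H.layerMk_surj j t
      rw [AddMonoidHom.add_apply, adLayer_mk, adLayer_mk, adLayer_mk]
      have e := commutatorElement_mul_left_eq_conj_mul (x : G) y z
      have hy := H.comm_mem y.2 hz
      rw [← H.layerMk_conj x.2 hy, add_comm (H.layerMk _ _ _), ← layerMk_mul]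
      exact H.layerMk_congr e _ _)
    (by
      intro x hx
      ext t
      obtain ⟨z, hz, rfl⟩ := H.layerMk_surj j t
      rw [adLayer_mk, AddMonoidHom.zero_apply, layerMk_eq_zero]
      have := H.comm_mem hx hz
      rwa [show i + 1 + j = i + j + 1 by ring] at this)

/-- The bracket of the graded Lie ring as a biadditive map. -/
def bracketHom : H.Gr →+ H.Gr →+ H.Gr :=
  H.toHom fun i => AddMonoidHom.flip (H.toHom fun j =>
    AddMonoidHom.flip ((AddMonoidHom.compHom (H.incl (i + j))).comp (H.layerBracket i j)))

instance : Bracket H.Gr H.Gr where bracket x y := H.bracketHom x y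

theorem lie_def (x y : H.Gr) : ⁅x, y⁆ = H.bracketHom x y := rfl

theorem cls_lie_cls {i j : ℕ+} {x y : G} (hx : x ∈ H.term i) (hy : y ∈ H.term j) :
    ⁅H.cls i x hx, H.cls j y hy⁆ = H.cls (i + j) ⁅x, y⁆ (H.comm_mem hx hy) := by
  rw [lie_def, bracketHom, cls, toHom_incl, AddMonoidHom.flip_apply, cls, toHom_incl]
  rfl

theorem gr_lie_add (x y z : H.Gr) : ⁅x, y + z⁆ = ⁅x, y⁆ + ⁅x, z⁆ := map_add (H.bracketHom x) y z

theorem gr_add_lie (x y z : H.Gr) : ⁅x + y, z⁆ = ⁅x, z⁆ + ⁅y, z⁆ := by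
  simp only [lie_def, map_add, AddMonoidHom.add_apply]

theorem gr_lie_zero (x : H.Gr) : ⁅x, (0 : H.Gr)⁆ = 0 := map_zero (H.bracketHom x)

theorem gr_zero_lie (x : H.Gr) : ⁅(0 : H.Gr), x⁆ = 0 := by
  simp only [lie_def, map_zero, AddMonoidHom.zero_apply]

theorem gr_skew (x y : H.Gr) : ⁅x, y⁆ + ⁅y, x⁆ = 0 := by
  induction x using H.gr_induction with
  | h0 => rw [gr_lie_zero, gr_zero_lie, add_zero]
  | h2 x x' hx hx' =>
    rw [gr_lie_add, gr_add_lie, add_add_add_comm, hx, hx', add_zero]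
  | h1 i g hg =>
    induction y using H.gr_induction with
    | h0 => rw [gr_lie_zero, gr_zero_lie, add_zero]
    | h2 y y' hy hy' =>
      rw [gr_lie_add, gr_add_lie, add_add_add_comm, hy, hy', add_zero]
    | h1 j h hh =>
      rw [cls_lie_cls, cls_lie_cls,
        H.cls_congr (add_comm j i) _ (add_comm j i ▸ H.comm_mem hh hg), ← cls_mul]
      refine H.cls_eq_zero _ ?_
      rw [← commutatorElement_inv g h, mul_inv_cancel]
      exact one_mem _

theorem gr_lie_self (x : H.Gr) : ⁅x, x⁆ = 0 := by
  induction x using H.gr_induction with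
  | h0 => exact H.gr_lie_zero 0
  | h1 i g hg =>
    rw [cls_lie_cls]
    refine H.cls_eq_zero _ ?_
    rw [commutatorElement_self]
    exact one_mem _
  | h2 x y hx hy =>
    rw [gr_lie_add, gr_add_lie, gr_add_lie, hx, hy, zero_add, add_zero, add_comm, gr_skew]

theorem gr_jacobi_cls {i j k : ℕ+} {x y z : G} (hx : x ∈ H.term i) (hy : y ∈ H.term j)
    (hz : z ∈ H.term k) :
    ⁅⁅H.cls i x hx, H.cls j y hy⁆, H.cls k z hz⁆ + ⁅⁅H.cls j y hy, H.cls k z hz⁆, H.cls i x hx⁆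
      + ⁅⁅H.cls k z hz, H.cls i x hx⁆, H.cls j y hy⁆ = 0 := by
  have key : ∀ {a b : ℕ+} {g h : G} (hg : g ∈ H.term a) (hh : h ∈ H.term b),
      H.cls a g hg = H.cls a (h * g * h⁻¹) (H.conj_mem hh hg) := by
    intro a b g h hg hh
    exact congrArg _ (H.layerMk_conj hh hg).symm
  have f1 : ⁅⁅H.cls i x hx, H.cls j y hy⁆, H.cls k z hz⁆ = H.cls (i + j + k) _
      (H.comm_mem (H.comm_mem hx hy) (H.conj_mem hy hz)) := by
    rw [key hz hy, cls_lie_cls, cls_lie_cls]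
  have f2 : ⁅⁅H.cls j y hy, H.cls k z hz⁆, H.cls i x hx⁆ = H.cls (j + k + i) _
      (H.comm_mem (H.comm_mem hy hz) (H.conj_mem hz hx)) := by
    rw [key hx hz, cls_lie_cls, cls_lie_cls]
  have f3 : ⁅⁅H.cls k z hz, H.cls i x hx⁆, H.cls j y hy⁆ = H.cls (k + i + j) _
      (H.comm_mem (H.comm_mem hz hx) (H.conj_mem hx hy)) := by
    rw [key hy hx, cls_lie_cls, cls_lie_cls]
  rw [f1, f2, f3]
  have e1 : j + k + i = i + j + k := by ring
  have e2 : k + i + j = i + j + k := by ring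
  have m1 := H.comm_mem (H.comm_mem hx hy) (H.conj_mem hy hz)
  have m2 := e1 ▸ H.comm_mem (H.comm_mem hy hz) (H.conj_mem hz hx)
  have m3 := e2 ▸ H.comm_mem (H.comm_mem hz hx) (H.conj_mem hx hy)
  rw [H.cls_congr e1 _ m2, H.cls_congr e2 _ m3, ← cls_mul, ← cls_mul]
  refine H.cls_eq_zero _ ?_
  rw [commutatorElement_commutatorElement_conj_mul]
  exact one_mem _

theorem gr_jacobi (x y z : H.Gr) : ⁅⁅x, y⁆, z⁆ + ⁅⁅y, z⁆, x⁆ + ⁅⁅z, x⁆, y⁆ = 0 := by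
  induction x using H.gr_induction with
  | h0 => simp only [gr_zero_lie, gr_lie_zero, add_zero]
  | h2 x x' h h' =>
    simp only [gr_add_lie, gr_lie_add]
    rw [← add_zero (0 : H.Gr)]
    nth_rewrite 1 [← h]
    rw [← h']
    abel
  | h1 i g hg =>
    induction y using H.gr_induction with
    | h0 => simp only [gr_zero_lie, gr_lie_zero, add_zero]
    | h2 x x' h h' =>
      simp only [gr_add_lie, gr_lie_add]
      rw [← add_zero (0 : H.Gr)]
      nth_rewrite 1 [← h]
      rw [← h']
      abel
    | h1 j h hh =>
      induction z using H.gr_induction with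
      | h0 => simp only [gr_zero_lie, gr_lie_zero, add_zero]
      | h2 x x' h h' =>
        simp only [gr_add_lie, gr_lie_add]
        rw [← add_zero (0 : H.Gr)]
        nth_rewrite 1 [← h]
        rw [← h']
        abel
      | h1 k z hz => exact H.gr_jacobi_cls hg hh hz

theorem gr_neg_lie (x y : H.Gr) : ⁅-x, y⁆ = -⁅x, y⁆ := by
  simp only [lie_def, map_neg, AddMonoidHom.neg_apply]

/-- The graded Lie ring of a strongly central series, with
`⁅x H (i + 1), y H (j + 1)⁆ = ⁅x, y⁆ H (i + j + 1)`. -/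
instance : LieRing H.Gr where
  add_lie := H.gr_add_lie
  lie_add := H.gr_lie_add
  lie_self := H.gr_lie_self
  leibniz_lie x y z := by
    have h := H.gr_jacobi x y z
    have e1 : ⁅x, ⁅y, z⁆⁆ = -⁅⁅y, z⁆, x⁆ := eq_neg_of_add_eq_zero_left (H.gr_skew _ _)
    have e2 : ⁅y, ⁅x, z⁆⁆ = ⁅⁅z, x⁆, y⁆ := by
      rw [eq_neg_of_add_eq_zero_left (H.gr_skew y _),
        eq_neg_of_add_eq_zero_left (H.gr_skew x z), gr_neg_lie, neg_neg]
    rw [e1, e2, neg_eq_iff_add_eq_zero, ← h]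
    abel

end CentralSeries

/-- For `x y` in a Lie ring and a central indeterminate `t`, this is the coefficient of `t ^ k`
in the formal expression `ad(t x + y) ^ m (x)`. -/
def adCoeff {L : Type u} [Zero L] [Add L] [Bracket L L] (x y : L) : ℕ → ℕ → L
  | 0, 0 => x
  | 0, _ + 1 => 0
  | m + 1, 0 => ⁅y, adCoeff x y m 0⁆
  | m + 1, k + 1 => ⁅x, adCoeff x y m k⁆ + ⁅y, adCoeff x y m (k + 1)⁆

/-- A restricted Lie algebra structure (a `p`-map) on a Lie algebra `L` over a field `F`; the field
is meant to have characteristic `p`. The element `s_k(x, y)`, the coefficient of `t ^ (k - 1)` in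
`ad(t x + y) ^ (p - 1) (x)`, is `adCoeff x y (p - 1) (k - 1)`. -/
class RestrictedLieAlgebra (p : ℕ) (F : Type v) (L : Type u) [Field F] [LieRing L]
    [LieAlgebra F L] where
  /-- the `p`-map -/
  pmap : L → L
  pmap_smul : ∀ (a : F) (x : L), pmap (a • x) = a ^ p • pmap x
  pmap_add : ∀ x y : L, pmap (x + y) = pmap x + pmap y +
    ∑ k ∈ Finset.Icc 1 (p - 1), (k : F)⁻¹ • adCoeff x y (p - 1) (k - 1)
  lie_pmap : ∀ x y : L, ⁅pmap x, y⁆ = (LieAlgebra.ad F L x ^ p) y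

theorem map_adCoeff {F : Type v} {L : Type u} {L' : Type w} [CommRing F] [LieRing L]
    [LieAlgebra F L] [LieRing L'] [LieAlgebra F L'] (f : L →ₗ⁅F⁆ L') (x y : L) :
    ∀ m k, f (adCoeff x y m k) = adCoeff (f x) (f y) m k
  | 0, 0 => rfl
  | 0, _ + 1 => map_zero f
  | m + 1, 0 => by
    rw [adCoeff, adCoeff, LieHom.map_lie, map_adCoeff f x y m 0]
  | m + 1, k + 1 => by
    rw [adCoeff, adCoeff, map_add, LieHom.map_lie, LieHom.map_lie, map_adCoeff f x y m k,
      map_adCoeff f x y m (k + 1)]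

section Jacobson

open Polynomial

attribute [local instance] LieRing.ofAssociativeRing

variable {p : ℕ} [hp : Fact p.Prime]

theorem cast_choose_prime_sub_one (m : ℕ) (hm : m < p) :
    (((p - 1).choose m : ℕ) : ZMod p) = (-1) ^ m := by
  induction m with
  | zero => simp
  | succ m ih =>
    have h1 : p.choose (m + 1) = (p - 1).choose m + (p - 1).choose (m + 1) := by
      rw [← Nat.choose_succ_succ, Nat.succ_eq_add_one, Nat.sub_add_cancel hp.out.one_le]
    have h2 : (p.choose (m + 1) : ZMod p) = 0 :=
      (ZMod.natCast_eq_zero_iff _ _).2 (hp.out.dvd_choose_self (Nat.succ_ne_zero m) hm)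
    rw [h1, Nat.cast_add, ih (by omega)] at h2
    rw [pow_succ, mul_neg_one]
    exact eq_neg_of_add_eq_zero_right h2

theorem sub_pow_prime_sub_one {E : Type*} [Ring E] [Algebra (ZMod p) E] {l r : E}
    (h : Commute l r) :
    (l - r) ^ (p - 1) = ∑ i ∈ Finset.range p, l ^ i * r ^ (p - 1 - i) := by
  rw [sub_eq_add_neg, h.neg_right.add_pow, Nat.sub_add_cancel hp.out.one_le]
  by_cases h2 : p = 2
  · subst h2
    have hneg : (-1 : E) = 1 := by
      have : algebraMap (ZMod 2) E (-1) = algebraMap (ZMod 2) E 1 := by congr 1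
      rwa [map_neg, map_one] at this
    have hr : -r = r := by rw [← neg_one_mul, hneg, one_mul]
    simp [Finset.sum_range_succ, hr]
  · have hodd : Even (p - 1) := hp.out.even_sub_one h2
    refine Finset.sum_congr rfl fun i hi => ?_
    have hi' : i < p := Finset.mem_range.1 hi
    have hc : (((p - 1).choose i : ℕ) : E) = (-1) ^ i := by
      have := congrArg (algebraMap (ZMod p) E) (cast_choose_prime_sub_one i hi')
      simpa using this
    have hs : ((-1 : E)) ^ (p - 1 - i) * (-1) ^ i = 1 := by
      rw [← pow_add, Nat.sub_add_cancel (by omega), hodd.neg_one_pow]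
    rw [hc, neg_pow r, mul_assoc, mul_assoc, ((Commute.neg_one_left (r ^ (p - 1 - i))).pow_left i).eq.symm,
      ← mul_assoc ((-1 : E) ^ (p - 1 - i)), hs, one_mul]

variable {A : Type*} [Ring A]

theorem derivative_linear_pow (a b : A) (n : ℕ) :
    derivative ((C a * X + C b) ^ n) =
      ∑ i ∈ Finset.range n, (C a * X + C b) ^ i * C a * (C a * X + C b) ^ (n - 1 - i) := by
  induction n with
  | zero => simp
  | succ n ih =>
    rw [pow_succ, derivative_mul, ih, Finset.sum_range_succ, Finset.sum_mul]
    congr 1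
    · refine Finset.sum_congr rfl fun i hi => ?_
      have := Finset.mem_range.1 hi
      rw [mul_assoc _ _ (C a * X + C b), ← pow_succ]
      congr 2
      omega
    · simp

theorem coeff_ad_linear (R : Type*) [CommRing R] [Algebra R A] (a b : A) (m : ℕ) : ∀ k,
    ((LieAlgebra.ad R A[X] (C a * X + C b) ^ m) (C a)).coeff k = adCoeff a b m k := by
  induction m with
  | zero =>
    intro k
    cases k <;> simp [adCoeff, coeff_C]
  | succ m ih =>
    intro k
    rw [pow_succ', Module.End.mul_apply, LieAlgebra.ad_apply, Ring.lie_def]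
    rw [add_mul, mul_add, coeff_sub, coeff_add, coeff_add, coeff_C_mul, coeff_mul_C,
      ← X_mul_C, mul_assoc X]
    cases k with
    | zero =>
      rw [coeff_X_mul_zero, X_mul_C, ← mul_assoc, coeff_mul_X_zero, adCoeff, ← ih, Ring.lie_def]
      simp
    | succ k =>
      rw [coeff_X_mul, coeff_C_mul, X_mul_C, ← mul_assoc, coeff_mul_X, coeff_mul_C, adCoeff,
        ← ih, ← ih, Ring.lie_def, Ring.lie_def]
      abel

theorem commute_mulLeft_mulRight [Algebra (ZMod p) A] (f : A) :
    Commute (LinearMap.mulLeft (ZMod p) f) (LinearMap.mulRight (ZMod p) f) :=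
  LinearMap.ext fun x => (mul_assoc f x f).symm

theorem ad_pow_prime_sub_one [Algebra (ZMod p) A] (f g : A) :
    (LieAlgebra.ad (ZMod p) A f ^ (p - 1)) g =
      ∑ i ∈ Finset.range p, f ^ i * g * f ^ (p - 1 - i) := by
  rw [LieAlgebra.ad_eq_lmul_left_sub_lmul_right, Pi.sub_apply,
    sub_pow_prime_sub_one (commute_mulLeft_mulRight f), LinearMap.sum_apply]
  refine Finset.sum_congr rfl fun i _ => ?_
  rw [Module.End.mul_apply, LinearMap.pow_mulLeft, LinearMap.pow_mulRight,
    LinearMap.mulLeft_apply, LinearMap.mulRight_apply, mul_assoc]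

theorem ad_pow_prime [Algebra (ZMod p) A] (x y : A) :
    ⁅x ^ p, y⁆ = (LieAlgebra.ad (ZMod p) A x ^ p) y := by
  have hE : CharP (Module.End (ZMod p) A) p ∨ Subsingleton A := by
    rcases subsingleton_or_nontrivial A with h | h
    · exact Or.inr h
    · exact Or.inl (charP_of_injective_algebraMap' (ZMod p) p)
  rcases hE with hE | hE
  · rw [LieAlgebra.ad_eq_lmul_left_sub_lmul_right, Pi.sub_apply,
      sub_pow_char_of_commute _ (commute_mulLeft_mulRight x),
      LinearMap.sub_apply, LinearMap.pow_mulLeft, LinearMap.pow_mulRight,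
      LinearMap.mulLeft_apply, LinearMap.mulRight_apply, Ring.lie_def]
  · exact Subsingleton.elim _ _

/-- Jacobson's formula for the `p`-th power in an associative algebra of characteristic `p`. -/
theorem add_pow_prime_jacobson [Algebra (ZMod p) A] (a b : A) :
    (a + b) ^ p = a ^ p + b ^ p +
      ∑ k ∈ Finset.Icc 1 (p - 1), (k : ZMod p)⁻¹ • adCoeff a b (p - 1) (k - 1) := by
  set f : A[X] := C a * X + C b with hf
  have hdeg : f.natDegree ≤ 1 := natDegree_linear_le
  have hdegp : (f ^ p).natDegree ≤ p := by
    simpa using natDegree_pow_le_of_le p hdeg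
  have hd : ∀ k, (derivative (f ^ p)).coeff k = adCoeff a b (p - 1) k := by
    intro k
    rw [← coeff_ad_linear (ZMod p) a b, ad_pow_prime_sub_one, hf, derivative_linear_pow]
  have hmid : ∀ k ∈ Finset.Icc 1 (p - 1),
      (f ^ p).coeff k = (k : ZMod p)⁻¹ • adCoeff a b (p - 1) (k - 1) := by
    intro k hk
    obtain ⟨h1, h2⟩ := Finset.mem_Icc.1 hk
    have hpp := hp.out.two_le
    have hne : (k : ZMod p) ≠ 0 := by
      rw [Ne, ZMod.natCast_eq_zero_iff]
      exact Nat.not_dvd_of_pos_of_lt h1 (by omega)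
    have h := hd (k - 1)
    rw [coeff_derivative, Nat.sub_add_cancel h1] at h
    rw [← h]
    have e : (((k - 1 : ℕ) : A) + 1) = algebraMap (ZMod p) A k := by
      rw [map_natCast, ← Nat.cast_succ, Nat.succ_eq_add_one, Nat.sub_add_cancel h1]
    rw [e, ← Algebra.commutes, ← Algebra.smul_def, smul_smul, inv_mul_cancel₀ hne, one_smul]
  have h0 : (f ^ p).coeff 0 = b ^ p := by
    have : constantCoeff (f ^ p) = b ^ p := by
      rw [map_pow]
      simp [hf]
    exact this
  have hpc : (f ^ p).coeff p = a ^ p := by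
    have := coeff_pow_of_natDegree_le (m := p) hdeg
    rw [mul_one] at this
    rw [this]
    simp [hf]
  have hev : (f ^ p).sum (fun _ c => c) = (a + b) ^ p := by
    have h := map_pow (eval₂RingHom' (RingHom.id A) 1 (fun c => Commute.one_right c)) f p
    simp only [eval₂RingHom', RingHom.coe_mk, MonoidHom.coe_mk, OneHom.coe_mk] at h
    rw [eval₂_eq_sum] at h
    simpa [hf] using h
  rw [← hev, sum_over_range' _ _ (p + 1) (by omega)]
  · rw [Finset.sum_range_succ, Finset.range_eq_Ico, Finset.sum_eq_sum_Ico_succ_bot hp.out.pos, h0,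
      hpc, ← Finset.sum_congr rfl hmid]
    have : Finset.Ico (0 + 1) p = Finset.Icc 1 (p - 1) := by
      ext k
      simp only [Finset.mem_Ico, Finset.mem_Icc]
      have := hp.out.two_le
      omega
    rw [this]
    abel
  · intro _; rfl

end Jacobson

namespace CentralSeries

variable {G : Type u} [Group G]

/-- If `H n ≤ K n` for all `n`, the inclusions induce a homomorphism of graded Lie rings
`x H (n + 1) ↦ x K (n + 1)`. -/
def mapAdd (H K : CentralSeries G) (h : ∀ n, H.term n ≤ K.term n) : H.Gr →+ K.Gr :=
  H.toHom fun n => H.liftHom (fun x => K.cls n x (h n x.2)) (fun _ _ => K.cls_mul n _ _)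
    (fun _ hx => K.cls_eq_zero _ (h (n + 1) hx))

theorem mapAdd_cls (H K : CentralSeries G) (h : ∀ n, H.term n ≤ K.term n) (n : ℕ+) (g : G)
    (hg : g ∈ H.term n) : mapAdd H K h (H.cls n g hg) = K.cls n g (h n hg) := by
  rw [mapAdd, cls, toHom_incl, liftHom_mk]

theorem map_lie_of_cls (H : CentralSeries G) {L : Type*} [LieRing L] (f : H.Gr →+ L)
    (hf : ∀ i j x y hx hy,
      f ⁅H.cls i x hx, H.cls j y hy⁆ = ⁅f (H.cls i x hx), f (H.cls j y hy)⁆)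
    (x y : H.Gr) : f ⁅x, y⁆ = ⁅f x, f y⁆ := by
  induction x using H.gr_induction with
  | h0 => rw [zero_lie, map_zero, zero_lie]
  | h2 x x' hx hx' => rw [add_lie, map_add, map_add, add_lie, hx, hx']
  | h1 i g hg =>
    induction y using H.gr_induction with
    | h0 => rw [lie_zero, map_zero, lie_zero]
    | h2 x x' hx hx' => rw [lie_add, map_add, map_add, lie_add, hx, hx']
    | h1 j h hh => exact hf _ _ _ _ _ _

/-- The homomorphism `x H (n + 1) ↦ x K (n + 1)` as a homomorphism of Lie algebras over `ℤ`. -/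
def map (H K : CentralSeries G) (h : ∀ n, H.term n ≤ K.term n) : H.Gr →ₗ⁅ℤ⁆ K.Gr :=
  { (mapAdd H K h).toIntLinearMap with
    map_lie' := by
      intro x y
      refine H.map_lie_of_cls (mapAdd H K h) ?_ x y
      intro i j x y hx hy
      rw [cls_lie_cls, mapAdd_cls, mapAdd_cls, mapAdd_cls, cls_lie_cls] }

theorem map_cls (H K : CentralSeries G) (h : ∀ n, H.term n ≤ K.term n) (n : ℕ+) (g : G)
    (hg : g ∈ H.term n) : map H K h (H.cls n g hg) = K.cls n g (h n hg) :=
  mapAdd_cls H K h n g hg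

end CentralSeries

section LowerCentral

variable (G : Type u) [Group G]

theorem lowerCentralSeries_commutator_le (j : ℕ) : ∀ i : ℕ,
    ⁅(⊤ : Subgroup G).lowerCentralSeries i, (⊤ : Subgroup G).lowerCentralSeries j⁆ ≤
      (⊤ : Subgroup G).lowerCentralSeries (i + j + 1) := by
  induction j with
  | zero => intro i; exact le_rfl
  | succ j ih =>
    intro i
    let N : Subgroup G := (⊤ : Subgroup G).lowerCentralSeries (i + j + 2)
    have hN : ∀ K : Subgroup G, K ≤ N ↔ K.map (QuotientGroup.mk' N) = ⊥ := by
      intro K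
      rw [Subgroup.map_eq_bot_iff, QuotientGroup.ker_mk']
    change _ ≤ N
    rw [Subgroup.lowerCentralSeries_succ, Subgroup.commutator_comm, hN, Subgroup.map_commutator,
      Subgroup.map_commutator]
    refine Subgroup.commutator_commutator_eq_bot_of_rotate ?_ ?_
    · rw [← Subgroup.map_commutator, ← Subgroup.map_commutator, ← hN,
        Subgroup.commutator_comm ⊤, ← Subgroup.lowerCentralSeries_succ]
      refine (ih (i + 1)).trans (le_of_eq ?_)
      congr 1
      omega
    · rw [← Subgroup.map_commutator, ← Subgroup.map_commutator, ← hN]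
      exact Subgroup.commutator_mono (ih i) le_rfl

/-- The lower central series `γ_1(G) = G`, `γ_{n+1}(G) = ⁅γ_n(G), G⁆` as a central series
(Mathlib's indexing starts at `0`). -/
def gammaSeries : CentralSeries G where
  term n := (⊤ : Subgroup G).lowerCentralSeries n.natPred
  antitone := by
    intro i j h
    exact Subgroup.lowerCentralSeries_antitone _ (PNat.natPred_le_natPred.2 h)
  commutator_le i j := by
    refine (lowerCentralSeries_commutator_le G _ _).trans (le_of_eq ?_)
    congr 1
    have h1 := PNat.natPred_add_one i
    have h2 := PNat.natPred_add_one j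
    have h3 := PNat.natPred_add_one (i + j)
    rw [PNat.add_coe] at h3
    omega

/-- The Magnus Lie ring `gr^M(G) = ⨁_{n ≥ 1} γ_n(G) / γ_{n+1}(G)`. -/
abbrev MagnusLie : Type u := (gammaSeries G).Gr

/-- The part `gr^M_{≥ 2}(G)` of degree at least `2`, i.e. the elements whose component of degree
`1` vanishes. -/
def magnusGeTwo : Submodule ℤ (MagnusLie G) :=
  LinearMap.ker ((gammaSeries G).proj 1).toIntLinearMap

theorem gammaSeries_le (H : CentralSeries G) (h1 : H.term 1 = ⊤) (n : ℕ+) :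
    (gammaSeries G).term n ≤ H.term n := by
  induction n with
  | one => rw [h1]; exact le_top
  | succ n ih =>
    have e : (gammaSeries G).term (n + 1) = ⁅(gammaSeries G).term n, ⊤⁆ := by
      change Subgroup.lowerCentralSeries ⊤ (n + 1).natPred = _
      rw [show (n + 1).natPred = n.natPred + 1 by
        rw [PNat.natPred_add_one]; rfl]
      rfl
    rw [e, ← h1]
    exact (Subgroup.commutator_mono ih le_rfl).trans (H.commutator_le n 1)

end LowerCentral

noncomputable section Dimension

variable (R : Type v) [CommRing R] (G : Type u) [Group G]

/-- The augmentation map `R[G] → R`, `g ↦ 1`. -/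
def augmentation : MonoidAlgebra R G →ₐ[R] R := MonoidAlgebra.lift R R G 1

/-- The augmentation ideal `ω_R(G)` of the group ring. -/
def augmentationIdeal : Ideal (MonoidAlgebra R G) := RingHom.ker (augmentation R G)

instance : (augmentationIdeal R G).IsTwoSided :=
  inferInstanceAs (RingHom.ker (augmentation R G)).IsTwoSided

/-- The group element `g` in the group ring. -/
abbrev grp (g : G) : MonoidAlgebra R G := MonoidAlgebra.of R G g

variable {G}

theorem one_sub_mem_augmentationIdeal (g : G) : 1 - grp R G g ∈ augmentationIdeal R G := by
  rw [augmentationIdeal, RingHom.mem_ker, map_sub, map_one, augmentation, MonoidAlgebra.lift_of]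
  simp

variable {R}

theorem aug_mul_mem {m n : ℕ} {x y : MonoidAlgebra R G} (hx : x ∈ augmentationIdeal R G ^ m)
    (hy : y ∈ augmentationIdeal R G ^ n) : x * y ∈ augmentationIdeal R G ^ (m + n) := by
  rw [Ideal.IsTwoSided.pow_add]
  exact Ideal.mul_mem_mul hx hy

theorem aug_of_le {m n : ℕ} (h : m ≤ n) {x : MonoidAlgebra R G}
    (hx : x ∈ augmentationIdeal R G ^ n) : x ∈ augmentationIdeal R G ^ m :=
  Ideal.pow_le_pow_right h hx

theorem grp_mul (g h : G) : grp R G (g * h) = grp R G g * grp R G h := map_mul _ _ _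

theorem grp_one : grp R G 1 = 1 := map_one _

theorem grp_inv_mul (g : G) : grp R G g⁻¹ * grp R G g = 1 := by
  rw [← grp_mul, inv_mul_cancel, grp_one]

theorem grp_mul_inv (g : G) : grp R G g * grp R G g⁻¹ = 1 := by
  rw [← grp_mul, mul_inv_cancel, grp_one]

variable (R G)

/-- The dimension subgroup `D_n(G, R) = {g ∈ G | 1 - g ∈ ω_R(G) ^ n}`. -/
def dimensionSubgroup (n : ℕ) : Subgroup G where
  carrier := {g | 1 - grp R G g ∈ augmentationIdeal R G ^ n}
  one_mem' := by
    rw [Set.mem_ofPred_eq, grp_one, sub_self]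
    exact zero_mem _
  mul_mem' := by
    intro g h hg hh
    have e : 1 - grp R G (g * h) = (1 - grp R G g) + grp R G g * (1 - grp R G h) := by
      rw [grp_mul]; noncomm_ring
    rw [Set.mem_ofPred_eq, e]
    exact add_mem hg (Ideal.mul_mem_left _ _ hh)
  inv_mem' := by
    intro g hg
    have e : 1 - grp R G g⁻¹ = - (grp R G g⁻¹ * (1 - grp R G g)) := by
      rw [mul_sub, grp_inv_mul]; noncomm_ring
    rw [Set.mem_ofPred_eq, e]
    exact neg_mem (Ideal.mul_mem_left _ _ hg)

variable {R G}

theorem mem_dimensionSubgroup {n : ℕ} {g : G} :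
    g ∈ dimensionSubgroup R G n ↔ grp R G g - 1 ∈ augmentationIdeal R G ^ n := by
  rw [← neg_mem_iff (x := grp R G g - 1), neg_sub]
  rfl

theorem commutator_sub_one (x y : G) :
    grp R G (x * y * x⁻¹ * y⁻¹) - 1 =
      ((grp R G x - 1) * (grp R G y - 1) - (grp R G y - 1) * (grp R G x - 1)) *
        (grp R G x⁻¹ * grp R G y⁻¹) := by
  have h1 : (grp R G x - 1) * (grp R G y - 1) - (grp R G y - 1) * (grp R G x - 1) =
      grp R G x * grp R G y - grp R G y * grp R G x := by noncomm_ring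
  have h2 : grp R G y * grp R G x * (grp R G x⁻¹ * grp R G y⁻¹) = 1 := by
    rw [mul_assoc, ← mul_assoc (grp R G x), grp_mul_inv, one_mul, grp_mul_inv]
  rw [h1, sub_mul, h2, grp_mul, grp_mul, grp_mul, mul_assoc (grp R G x * grp R G y)]

variable (R G)

/-- The series `D_n(G, R)`, `n ≥ 1`. -/
def dimensionSeries : CentralSeries G where
  term n := dimensionSubgroup R G n
  antitone := by
    intro i j h g hg
    rw [mem_dimensionSubgroup] at hg ⊢
    exact aug_of_le h hg
  commutator_le i j := by
    rw [Subgroup.commutator_le]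
    intro x hx y hy
    rw [mem_dimensionSubgroup] at hx hy ⊢
    rw [commutatorElement_def, commutator_sub_one, PNat.add_coe]
    refine Ideal.mul_mem_right _ _ (sub_mem (aug_mul_mem hx hy) ?_)
    rw [add_comm]
    exact aug_mul_mem hy hx

variable {R G}

theorem mem_dimensionSeries {n : ℕ+} {g : G} :
    g ∈ (dimensionSeries R G).term n ↔ grp R G g - 1 ∈ augmentationIdeal R G ^ (n : ℕ) :=
  mem_dimensionSubgroup

variable (R G)

theorem dimensionSeries_one : (dimensionSeries R G).term 1 = ⊤ := by
  rw [eq_top_iff]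
  intro g _
  rw [mem_dimensionSeries, PNat.one_coe, Submodule.pow_one, ← neg_mem_iff, neg_sub]
  exact one_sub_mem_augmentationIdeal R g

end Dimension

noncomputable section AssocGraded

open Polynomial

attribute [local instance] LieRing.ofAssociativeRing

variable (R : Type v) [CommRing R] (G : Type u) [Group G]

/-- The Rees algebra `⨁_n ω ^ n t ^ n` of the augmentation ideal `ω`. -/
def reesSubalgebra : Subalgebra R (MonoidAlgebra R G)[X] where
  carrier := {f | ∀ n, f.coeff n ∈ augmentationIdeal R G ^ n}
  mul_mem' := by
    intro f g hf hg n
    rw [coeff_mul]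
    refine sum_mem fun ij hij => ?_
    rw [← Finset.HasAntidiagonal.mem_antidiagonal.1 hij]
    exact aug_mul_mem (hf _) (hg _)
  add_mem' := by
    intro f g hf hg n
    rw [coeff_add]
    exact add_mem (hf n) (hg n)
  algebraMap_mem' := by
    intro r n
    rw [Polynomial.algebraMap_apply, coeff_C]
    split_ifs with h
    · rw [h, Submodule.pow_zero, Ideal.one_eq_top]
      exact Submodule.mem_top
    · exact zero_mem _

/-- The Rees algebra as a type. -/
def ReesAlg : Type (max u v) := ↥(reesSubalgebra R G)

instance : Ring (ReesAlg R G) := inferInstanceAs (Ring ↥(reesSubalgebra R G))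

instance : Algebra R (ReesAlg R G) := inferInstanceAs (Algebra R ↥(reesSubalgebra R G))

/-- The underlying polynomial. -/
def reesVal : ReesAlg R G →ₐ[R] (MonoidAlgebra R G)[X] := (reesSubalgebra R G).val

theorem reesVal_mem (f : ReesAlg R G) (n : ℕ) :
    (reesVal R G f).coeff n ∈ augmentationIdeal R G ^ n := f.2 n

theorem reesVal_inj : Function.Injective (reesVal R G) := Subtype.val_injective

/-- The ideal `⨁_n ω ^ (n + 1) t ^ n` of the Rees algebra. -/
def reesIdeal : Ideal (ReesAlg R G) where
  carrier := {f | ∀ n, (reesVal R G f).coeff n ∈ augmentationIdeal R G ^ (n + 1)}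
  zero_mem' := by
    intro n
    rw [map_zero, coeff_zero]
    exact zero_mem _
  add_mem' := by
    intro f g hf hg n
    rw [map_add, coeff_add]
    exact add_mem (hf n) (hg n)
  smul_mem' := by
    intro f g hg n
    rw [smul_eq_mul, map_mul, coeff_mul]
    refine sum_mem fun ij hij => ?_
    rw [← Finset.HasAntidiagonal.mem_antidiagonal.1 hij, add_assoc]
    exact aug_mul_mem (reesVal_mem R G f _) (hg _)

instance : (reesIdeal R G).IsTwoSided where
  mul_mem_of_left := by
    intro f g hf n
    rw [map_mul, coeff_mul]
    refine sum_mem fun ij hij => ?_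
    rw [← Finset.HasAntidiagonal.mem_antidiagonal.1 hij, add_right_comm]
    exact aug_mul_mem (hf _) (reesVal_mem R G g _)

/-- The associated graded algebra `⨁_n ω ^ n / ω ^ (n + 1)` of the group algebra. -/
def AssocGr : Type (max u v) := ReesAlg R G ⧸ reesIdeal R G

instance : Ring (AssocGr R G) := inferInstanceAs (Ring (ReesAlg R G ⧸ reesIdeal R G))

instance : Algebra R (AssocGr R G) := inferInstanceAs (Algebra R (ReesAlg R G ⧸ reesIdeal R G))

/-- The projection of the Rees algebra onto the associated graded algebra. -/
def assocMk : ReesAlg R G →+* AssocGr R G := Ideal.Quotient.mk (reesIdeal R G)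

variable {R G}

/-- The element `x t ^ n` of the Rees algebra, for `x ∈ ω ^ n`. -/
def reesMonomial (n : ℕ) (x : MonoidAlgebra R G) (hx : x ∈ augmentationIdeal R G ^ n) :
    ReesAlg R G :=
  ⟨monomial n x, by
    intro m
    rw [coeff_monomial]
    split_ifs with h
    · exact h ▸ hx
    · exact zero_mem _⟩

theorem reesVal_monomial (n : ℕ) (x : MonoidAlgebra R G)
    (hx : x ∈ augmentationIdeal R G ^ n) :
    reesVal R G (reesMonomial n x hx) = monomial n x := rfl

/-- The class of `x ∈ ω ^ n` in degree `n`. -/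
def symb (n : ℕ) (x : MonoidAlgebra R G) (hx : x ∈ augmentationIdeal R G ^ n) : AssocGr R G :=
  assocMk R G (reesMonomial n x hx)

theorem symb_congr {n m : ℕ} (h : n = m) {x y : MonoidAlgebra R G}
    (hx : x ∈ augmentationIdeal R G ^ n) (hy : y ∈ augmentationIdeal R G ^ m)
    (e : x - y ∈ augmentationIdeal R G ^ (n + 1)) : symb n x hx = symb m y hy := by
  subst h
  refine Ideal.Quotient.eq.2 ?_
  intro k
  rw [map_sub, coeff_sub, reesVal_monomial, reesVal_monomial, coeff_monomial, coeff_monomial]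
  split_ifs with h
  · exact h ▸ e
  · rw [sub_zero]; exact zero_mem _

theorem symb_add {n : ℕ} {x y : MonoidAlgebra R G} (hx : x ∈ augmentationIdeal R G ^ n)
    (hy : y ∈ augmentationIdeal R G ^ n) :
    symb n (x + y) (add_mem hx hy) = symb n x hx + symb n y hy := by
  rw [symb, symb, symb, ← map_add]
  congr 1
  exact Subtype.ext (map_add (monomial n) x y)

theorem symb_sub {n : ℕ} {x y : MonoidAlgebra R G} (hx : x ∈ augmentationIdeal R G ^ n)
    (hy : y ∈ augmentationIdeal R G ^ n) :
    symb n (x - y) (sub_mem hx hy) = symb n x hx - symb n y hy := by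
  rw [symb, symb, symb, ← map_sub]
  congr 1
  exact Subtype.ext (map_sub (monomial n) x y)

theorem symb_mul {n m : ℕ} {x y : MonoidAlgebra R G} (hx : x ∈ augmentationIdeal R G ^ n)
    (hy : y ∈ augmentationIdeal R G ^ m) :
    symb (n + m) (x * y) (aug_mul_mem hx hy) = symb n x hx * symb m y hy := by
  rw [symb, symb, symb, ← map_mul]
  congr 1
  exact Subtype.ext (monomial_mul_monomial n m x y).symm

theorem aug_pow_mem {n : ℕ} {x : MonoidAlgebra R G} (hx : x ∈ augmentationIdeal R G ^ n) (k : ℕ) :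
    x ^ k ∈ augmentationIdeal R G ^ (n * k) := by
  induction k with
  | zero =>
    rw [Nat.mul_zero, Submodule.pow_zero, Ideal.one_eq_top]
    exact Submodule.mem_top
  | succ k ih =>
    rw [pow_succ, Nat.mul_succ]
    exact aug_mul_mem ih hx

theorem symb_pow {n : ℕ} {x : MonoidAlgebra R G} (hx : x ∈ augmentationIdeal R G ^ n) (k : ℕ) :
    symb (n * k) (x ^ k) (aug_pow_mem hx k) = symb n x hx ^ k := by
  rw [symb, symb, ← map_pow]
  congr 1
  exact Subtype.ext (monomial_pow n x k).symm

/-- The coefficient of degree `n` of an element of the associated graded algebra. -/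
def assocCoeff (n : ℕ) :
    AssocGr R G →+ MonoidAlgebra R G ⧸ (augmentationIdeal R G ^ (n + 1)).toAddSubgroup :=
  QuotientAddGroup.lift (reesIdeal R G).toAddSubgroup
    ((QuotientAddGroup.mk' _).comp
      ((lcoeff (MonoidAlgebra R G) n).toAddMonoidHom.comp
        (reesVal R G).toRingHom.toAddMonoidHom))
    (fun _ hf => (QuotientAddGroup.eq_zero_iff _).2 (hf n))

theorem assocCoeff_symb (n m : ℕ) (x : MonoidAlgebra R G)
    (hx : x ∈ augmentationIdeal R G ^ m) :
    assocCoeff n (symb m x hx) = if m = n then QuotientAddGroup.mk x else 0 := by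
  have : assocCoeff n (symb m x hx) = QuotientAddGroup.mk ((monomial m x).coeff n) := rfl
  rw [this, coeff_monomial]
  split_ifs <;> rfl

variable (R G)

/-- The map `x D_{n+1} ↦ (x - 1) + ω ^ (n + 1)` from the graded group of the dimension series to
the associated graded algebra of the group algebra. -/
def dimToAssocAdd : (dimensionSeries R G).Gr →+ AssocGr R G :=
  (dimensionSeries R G).toHom fun n => (dimensionSeries R G).liftHom
    (fun x => symb n (grp R G x - 1) (mem_dimensionSeries.1 x.2))
    (by
      intro x y
      rw [← symb_add]
      refine symb_congr rfl _ _ ?_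
      have e : grp R G ↑(x * y) - 1 - (grp R G x - 1 + (grp R G y - 1)) =
          (grp R G x - 1) * (grp R G y - 1) := by
        rw [Subgroup.coe_mul, grp_mul]; noncomm_ring
      rw [e]
      refine aug_of_le ?_ (aug_mul_mem (mem_dimensionSeries.1 x.2) (mem_dimensionSeries.1 y.2))
      have := n.pos
      omega)
    (by
      intro x hx
      have h0 : symb n (0 : MonoidAlgebra R G) (zero_mem _) = 0 := by
        have h := symb_add (zero_mem (augmentationIdeal R G ^ (n : ℕ))) (zero_mem _)
        simpa using h
      rw [← h0]
      refine symb_congr rfl _ _ ?_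
      rw [sub_zero]
      exact mem_dimensionSeries.1 hx)

theorem dimToAssocAdd_cls (n : ℕ+) (g : G) (hg : g ∈ (dimensionSeries R G).term n) :
    dimToAssocAdd R G ((dimensionSeries R G).cls n g hg) =
      symb n (grp R G g - 1) (mem_dimensionSeries.1 hg) := by
  rw [dimToAssocAdd, CentralSeries.cls, CentralSeries.toHom_incl, CentralSeries.liftHom_mk]

theorem dimToAssocAdd_lie (x y : (dimensionSeries R G).Gr) :
    dimToAssocAdd R G ⁅x, y⁆ = ⁅dimToAssocAdd R G x, dimToAssocAdd R G y⁆ := by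
  refine CentralSeries.map_lie_of_cls _ _ ?_ x y
  intro i j g h hg hh
  rw [CentralSeries.cls_lie_cls, dimToAssocAdd_cls, dimToAssocAdd_cls, dimToAssocAdd_cls,
    Ring.lie_def, ← symb_mul, ← symb_mul]
  have hg' := mem_dimensionSeries.1 hg
  have hh' := mem_dimensionSeries.1 hh
  have m1 := aug_mul_mem hg' hh'
  have m2 := aug_mul_mem hh' hg'
  have m2' := (add_comm (j : ℕ) i) ▸ m2
  rw [symb_congr (add_comm (j : ℕ) i) m2 m2' (by rw [sub_self]; exact zero_mem _), ← symb_sub]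
  refine symb_congr (PNat.add_coe i j) _ _ ?_
  rw [commutatorElement_def, commutator_sub_one, ← mul_sub_one, PNat.add_coe]
  refine aug_mul_mem (sub_mem m1 m2') ?_
  rw [Submodule.pow_one, ← grp_mul, ← neg_mem_iff, neg_sub]
  exact one_sub_mem_augmentationIdeal R _

theorem dimToAssocAdd_injective : Function.Injective (dimToAssocAdd R G) := by
  rw [injective_iff_map_eq_zero]
  intro x hx
  have key : ∀ (n : ℕ+) (y : (dimensionSeries R G).Gr), ∃ g, ∃ hg,
      (dimensionSeries R G).proj n y = (dimensionSeries R G).layerMk n g hg ∧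
      assocCoeff (n : ℕ) (dimToAssocAdd R G y) = QuotientAddGroup.mk (grp R G g - 1) := by
    intro n y
    induction y using CentralSeries.gr_induction with
    | h0 =>
      refine ⟨1, one_mem _, ?_, ?_⟩
      · rw [map_zero, CentralSeries.layerMk_one]
      · rw [map_zero, map_zero, grp_one, sub_self]; rfl
    | h1 m g hg =>
      rw [dimToAssocAdd_cls, assocCoeff_symb]
      by_cases h : m = n
      · subst h
        refine ⟨g, hg, DirectSum.of_eq_same _ _, ?_⟩
        rw [if_pos rfl]
      · refine ⟨1, one_mem _, DirectSum.of_eq_of_ne _ _ _ (Ne.symm h), ?_⟩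
        rw [if_neg (fun h' => h (PNat.coe_injective h')), grp_one, sub_self]
        rfl
    | h2 y z hy hz =>
      obtain ⟨g, hg, e1, e2⟩ := hy
      obtain ⟨h, hh, f1, f2⟩ := hz
      refine ⟨g * h, mul_mem hg hh, ?_, ?_⟩
      · rw [map_add, e1, f1, CentralSeries.layerMk_mul]
      · rw [map_add, map_add, e2, f2, ← QuotientAddGroup.mk_add, QuotientAddGroup.eq]
        have e : -(grp R G g - 1 + (grp R G h - 1)) + (grp R G (g * h) - 1) =
            (grp R G g - 1) * (grp R G h - 1) := by
          rw [grp_mul]; noncomm_ring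
        rw [e]
        refine aug_of_le ?_ (aug_mul_mem (mem_dimensionSeries.1 hg) (mem_dimensionSeries.1 hh))
        have := n.pos
        omega
  refine DFinsupp.ext fun n => ?_
  obtain ⟨g, hg, e, h⟩ := key n x
  rw [hx, map_zero, eq_comm, QuotientAddGroup.eq_zero_iff] at h
  refine e.trans ?_
  exact (dimensionSeries R G).layerMk_eq_zero.2 (mem_dimensionSeries.2 h)

end AssocGraded

noncomputable section Zassenhaus

attribute [local instance] LieRing.ofAssociativeRing

variable (p : ℕ) [hp : Fact p.Prime] (G : Type u) [Group G]

/-- The Zassenhaus Lie ring `gr^{Z,p}(G) = ⨁_{n ≥ 1} D_n(G) / D_{n+1}(G)`, where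
`D_n(G) = D_n(G, 𝔽_p)`. -/
abbrev ZassenhausLie : Type u := (dimensionSeries (ZMod p) G).Gr

theorem zassenhaus_nsmul (x : ZassenhausLie p G) : p • x = 0 := by
  apply dimToAssocAdd_injective
  rw [map_nsmul, map_zero, ← Nat.cast_smul_eq_nsmul (ZMod p), CharP.cast_eq_zero, zero_smul]

instance : Module (ZMod p) (ZassenhausLie p G) :=
  AddCommGroup.zmodModule (zassenhaus_nsmul p G)

instance : LieAlgebra (ZMod p) (ZassenhausLie p G) where
  lie_smul t x y := ZMod.map_smul ((dimensionSeries (ZMod p) G).bracketHom x) t y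

/-- The injective homomorphism `x D_{n+1} ↦ (x - 1) + ω ^ (n + 1)` of Lie algebras from `gr^{Z,p}`
to the associated graded algebra of the group algebra. -/
def zassenhausToAssoc : ZassenhausLie p G →ₗ⁅ZMod p⁆ AssocGr (ZMod p) G :=
  { toFun := dimToAssocAdd (ZMod p) G
    map_add' := map_add _
    map_smul' := ZMod.map_smul (dimToAssocAdd (ZMod p) G)
    map_lie' := dimToAssocAdd_lie (ZMod p) G _ _ }

theorem zassenhausToAssoc_apply (x : ZassenhausLie p G) :
    zassenhausToAssoc p G x = dimToAssocAdd (ZMod p) G x := rfl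

theorem zassenhausToAssoc_injective : Function.Injective (zassenhausToAssoc p G) :=
  dimToAssocAdd_injective (ZMod p) G

variable {p G}

theorem grp_pow_sub_one (g : G) : grp (ZMod p) G (g ^ p) - 1 = (grp (ZMod p) G g - 1) ^ p := by
  have : CharP (MonoidAlgebra (ZMod p) G) p := charP_of_injective_algebraMap' (ZMod p) p
  rw [sub_pow_char_of_commute _ (Commute.one_right _), one_pow]
  congr 1
  exact map_pow _ _ _

theorem pow_mem_dimensionSeries {n m : ℕ+} (hm : (m : ℕ) = n * p) {g : G}
    (hg : g ∈ (dimensionSeries (ZMod p) G).term n) :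
    g ^ p ∈ (dimensionSeries (ZMod p) G).term m := by
  rw [mem_dimensionSeries] at hg ⊢
  rw [grp_pow_sub_one, hm]
  exact aug_pow_mem hg p

theorem zassenhausToAssoc_pow {n m : ℕ+} (hm : (m : ℕ) = n * p) {g : G}
    (hg : g ∈ (dimensionSeries (ZMod p) G).term n) :
    zassenhausToAssoc p G ((dimensionSeries (ZMod p) G).cls m (g ^ p)
      (pow_mem_dimensionSeries hm hg)) =
      zassenhausToAssoc p G ((dimensionSeries (ZMod p) G).cls n g hg) ^ p := by
  rw [zassenhausToAssoc_apply, zassenhausToAssoc_apply, dimToAssocAdd_cls, dimToAssocAdd_cls, ← symb_pow]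
  refine symb_congr hm _ _ ?_
  rw [grp_pow_sub_one, sub_self]
  exact zero_mem _

theorem exists_zassenhaus_pow (x : ZassenhausLie p G) :
    ∃ y, zassenhausToAssoc p G y = zassenhausToAssoc p G x ^ p := by
  induction x using CentralSeries.gr_induction with
  | h0 => exact ⟨0, by rw [map_zero, zero_pow hp.out.ne_zero]⟩
  | h1 n g hg =>
    obtain ⟨m, hm⟩ : ∃ m : ℕ+, (m : ℕ) = n * p :=
      ⟨⟨n * p, Nat.mul_pos n.pos hp.out.pos⟩, rfl⟩
    exact ⟨_, zassenhausToAssoc_pow hm hg⟩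
  | h2 x y hx hy =>
    obtain ⟨x', hx'⟩ := hx
    obtain ⟨y', hy'⟩ := hy
    refine ⟨x' + y' + ∑ k ∈ Finset.Icc 1 (p - 1),
      (k : ZMod p)⁻¹ • adCoeff x y (p - 1) (k - 1), ?_⟩
    rw [map_add, map_add, map_add, add_pow_prime_jacobson, hx', hy', map_sum]
    congr 1
    refine Finset.sum_congr rfl fun k _ => ?_
    rw [map_smul, map_adCoeff]

theorem zassenhausToAssoc_ad_pow (x y : ZassenhausLie p G) (m : ℕ) :
    zassenhausToAssoc p G ((LieAlgebra.ad (ZMod p) _ x ^ m) y) =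
      (LieAlgebra.ad (ZMod p) _ (zassenhausToAssoc p G x) ^ m) (zassenhausToAssoc p G y) := by
  induction m with
  | zero => rfl
  | succ m ih =>
    rw [pow_succ', pow_succ', Module.End.mul_apply, Module.End.mul_apply, LieAlgebra.ad_apply,
      LieAlgebra.ad_apply, LieHom.map_lie, ih]

variable (p G)

/-- The restricted Lie algebra structure on `gr^{Z,p}(G)`: the `p`-map is induced by the power map
`x D_{n+1} ↦ x ^ p D_{pn+1}` on homogeneous elements (see `zassenhaus_pmap_cls`) and by Jacobson's
formula on sums. It is realized as the `p`-th power in the associated graded algebra of the group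
algebra, in which `gr^{Z,p}(G)` embeds. -/
instance : RestrictedLieAlgebra p (ZMod p) (ZassenhausLie p G) where
  pmap x := (exists_zassenhaus_pow x).choose
  pmap_smul a x := by
    apply zassenhausToAssoc_injective
    rw [(exists_zassenhaus_pow (a • x)).choose_spec, map_smul, map_smul, smul_pow,
      (exists_zassenhaus_pow x).choose_spec]
  pmap_add x y := by
    apply zassenhausToAssoc_injective
    rw [(exists_zassenhaus_pow (x + y)).choose_spec, map_add, map_add, map_add,
      (exists_zassenhaus_pow x).choose_spec, (exists_zassenhaus_pow y).choose_spec,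
      add_pow_prime_jacobson, map_sum]
    congr 1
    refine Finset.sum_congr rfl fun k _ => ?_
    rw [map_smul, map_adCoeff]
  lie_pmap x y := by
    apply zassenhausToAssoc_injective
    rw [LieHom.map_lie, (exists_zassenhaus_pow x).choose_spec, zassenhausToAssoc_ad_pow,
      ad_pow_prime]

/-- The `p`-map of `gr^{Z,p}(G)` is induced by the `p`-th power map of `G`. -/
theorem zassenhaus_pmap_cls {n m : ℕ+} (hm : (m : ℕ) = n * p) {g : G}
    (hg : g ∈ (dimensionSeries (ZMod p) G).term n) :
    RestrictedLieAlgebra.pmap p (ZMod p) ((dimensionSeries (ZMod p) G).cls n g hg) =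
      (dimensionSeries (ZMod p) G).cls m (g ^ p) (pow_mem_dimensionSeries hm hg) := by
  apply zassenhausToAssoc_injective
  rw [zassenhausToAssoc_pow hm hg]
  exact (exists_zassenhaus_pow _).choose_spec

end Zassenhaus


set_option linter.unusedSectionVars false

section Restrictification

variable (p : ℕ) (F : Type v) (L : Type u)

/-- Formal expressions in elements of `L` and the operations of a restricted Lie algebra. -/
inductive RTerm : Type (max u v)
  | of (x : L) : RTerm
  | zero : RTerm
  | add (x y : RTerm) : RTerm
  | neg (x : RTerm) : RTerm
  | smul (a : F) (x : RTerm) : RTerm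
  | lie (x y : RTerm) : RTerm
  | pmap (x : RTerm) : RTerm

namespace RTerm

instance : Zero (RTerm F L) := ⟨zero⟩
instance : Add (RTerm F L) := ⟨add⟩
instance : Neg (RTerm F L) := ⟨neg⟩
instance : SMul F (RTerm F L) := ⟨smul⟩
instance : Bracket (RTerm F L) (RTerm F L) := ⟨lie⟩

variable {F L}

/-- `ad(x) ^ m (y)` as a formal expression. -/
def adPow (x y : RTerm F L) : ℕ → RTerm F L
  | 0 => y
  | m + 1 => ⁅x, adPow x y m⁆

variable [Field F]

/-- `∑_{k=1}^{n} s_k(x, y) / k` as a formal expression, where `s_k(x, y)` is the coefficient of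
`t ^ (k - 1)` in `ad(t x + y) ^ (p - 1) (x)`. -/
def jacSum (x y : RTerm F L) : ℕ → RTerm F L
  | 0 => 0
  | n + 1 => jacSum x y n + ((n + 1 : ℕ) : F)⁻¹ • adCoeff x y (p - 1) n

variable [LieRing L] [LieAlgebra F L]

/-- The congruence generated by the axioms of a restricted Lie algebra over `F` and by the
requirement that `of : L → RTerm F L` becomes a homomorphism of Lie algebras. -/
inductive Rel : RTerm F L → RTerm F L → Prop
  | refl (x : RTerm F L) : Rel x x
  | symm {x y : RTerm F L} : Rel x y → Rel y x
  | trans {x y z : RTerm F L} : Rel x y → Rel y z → Rel x z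
  | add_congr {x x' y y' : RTerm F L} : Rel x x' → Rel y y' → Rel (x + y) (x' + y')
  | neg_congr {x x' : RTerm F L} : Rel x x' → Rel (-x) (-x')
  | smul_congr (a : F) {x x' : RTerm F L} : Rel x x' → Rel (a • x) (a • x')
  | lie_congr {x x' y y' : RTerm F L} : Rel x x' → Rel y y' → Rel ⁅x, y⁆ ⁅x', y'⁆
  | pmap_congr {x x' : RTerm F L} : Rel x x' → Rel (pmap x) (pmap x')
  | add_assoc (x y z : RTerm F L) : Rel (x + y + z) (x + (y + z))
  | add_comm (x y : RTerm F L) : Rel (x + y) (y + x)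
  | zero_add (x : RTerm F L) : Rel (0 + x) x
  | neg_add_cancel (x : RTerm F L) : Rel (-x + x) 0
  | smul_add (a : F) (x y : RTerm F L) : Rel (a • (x + y)) (a • x + a • y)
  | add_smul (a b : F) (x : RTerm F L) : Rel ((a + b) • x) (a • x + b • x)
  | mul_smul (a b : F) (x : RTerm F L) : Rel ((a * b) • x) (a • b • x)
  | one_smul (x : RTerm F L) : Rel ((1 : F) • x) x
  | add_lie (x y z : RTerm F L) : Rel ⁅x + y, z⁆ (⁅x, z⁆ + ⁅y, z⁆)
  | lie_add (x y z : RTerm F L) : Rel ⁅x, y + z⁆ (⁅x, y⁆ + ⁅x, z⁆)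
  | lie_self (x : RTerm F L) : Rel ⁅x, x⁆ 0
  | leibniz_lie (x y z : RTerm F L) : Rel ⁅x, ⁅y, z⁆⁆ (⁅⁅x, y⁆, z⁆ + ⁅y, ⁅x, z⁆⁆)
  | lie_smul (a : F) (x y : RTerm F L) : Rel ⁅x, a • y⁆ (a • ⁅x, y⁆)
  | pmap_smul (a : F) (x : RTerm F L) : Rel (pmap (a • x)) (a ^ p • pmap x)
  | pmap_add (x y : RTerm F L) :
      Rel (pmap (x + y)) (pmap x + pmap y + jacSum p x y (p - 1))
  | lie_pmap (x y : RTerm F L) : Rel ⁅pmap x, y⁆ (adPow x y p)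
  | of_add (x y : L) : Rel (of (x + y)) (of x + of y)
  | of_smul (a : F) (x : L) : Rel (of (a • x)) (a • of x)
  | of_lie (x y : L) : Rel (of ⁅x, y⁆) ⁅(of x : RTerm F L), (of y : RTerm F L)⁆

variable (F L)

/-- The setoid of the congruence. -/
def relSetoid : Setoid (RTerm F L) := ⟨Rel p, ⟨Rel.refl, Rel.symm, Rel.trans⟩⟩

end RTerm

variable [Field F] [LieRing L] [LieAlgebra F L]

/-- The restrictification `L^{[p]}` of a Lie algebra `L`: the value at `L` of the left adjoint of
the forgetful functor from restricted Lie algebras to Lie algebras, i.e. the universal restricted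
Lie algebra with a Lie algebra homomorphism from `L` (see `Restrictification.lift`). -/
def Restrictification : Type (max u v) := Quotient (RTerm.relSetoid p F L)

namespace Restrictification

open RTerm

variable {p F L}

/-- The class of a formal expression. -/
def mk (x : RTerm F L) : Restrictification p F L := Quotient.mk (relSetoid p F L) x

theorem mk_eq {x y : RTerm F L} (h : Rel p x y) : mk (p := p) x = mk y :=
  Quotient.sound (s := relSetoid p F L) h

theorem ind {P : Restrictification p F L → Prop} (h : ∀ x, P (mk x)) (x) : P x :=
  Quotient.inductionOn x h

instance : Zero (Restrictification p F L) := ⟨mk 0⟩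

instance : Add (Restrictification p F L) :=
  ⟨Quotient.map₂ (· + ·) fun _ _ h _ _ h' => Rel.add_congr h h'⟩

instance : Neg (Restrictification p F L) := ⟨Quotient.map (- ·) fun _ _ h => Rel.neg_congr h⟩

instance : SMul F (Restrictification p F L) :=
  ⟨fun a => Quotient.map (a • ·) fun _ _ h => Rel.smul_congr a h⟩

instance : Bracket (Restrictification p F L) (Restrictification p F L) :=
  ⟨Quotient.map₂ (fun x y => ⁅x, y⁆) fun _ _ h _ _ h' => Rel.lie_congr h h'⟩

/-- The `p`-map of the restrictification. -/
def pMap : Restrictification p F L → Restrictification p F L :=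
  Quotient.map RTerm.pmap fun _ _ h => Rel.pmap_congr h

theorem mk_zero : (mk 0 : Restrictification p F L) = 0 := rfl
theorem mk_add (x y : RTerm F L) : (mk (x + y) : Restrictification p F L) = mk x + mk y := rfl
theorem mk_neg (x : RTerm F L) : (mk (-x) : Restrictification p F L) = -mk x := rfl
theorem mk_smul (a : F) (x : RTerm F L) :
    (mk (a • x) : Restrictification p F L) = a • mk x := rfl
theorem mk_lie (x y : RTerm F L) : (mk ⁅x, y⁆ : Restrictification p F L) =
    ⁅(mk x : Restrictification p F L), (mk y : Restrictification p F L)⁆ := rfl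
theorem mk_pmap (x : RTerm F L) :
    (mk (RTerm.pmap x) : Restrictification p F L) = pMap (mk x) := rfl

instance : AddCommGroup (Restrictification p F L) where
  add_assoc := ind fun x => ind fun y => ind fun z => mk_eq (Rel.add_assoc x y z)
  zero_add := ind fun x => mk_eq (Rel.zero_add x)
  add_zero := ind fun x => mk_eq ((Rel.add_comm x 0).trans (Rel.zero_add x))
  neg_add_cancel := ind fun x => mk_eq (Rel.neg_add_cancel x)
  add_comm := ind fun x => ind fun y => mk_eq (Rel.add_comm x y)
  nsmul := nsmulRec
  zsmul := zsmulRec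

instance : LieRing (Restrictification p F L) where
  add_lie := ind fun x => ind fun y => ind fun z => mk_eq (Rel.add_lie x y z)
  lie_add := ind fun x => ind fun y => ind fun z => mk_eq (Rel.lie_add x y z)
  lie_self := ind fun x => mk_eq (Rel.lie_self x)
  leibniz_lie := ind fun x => ind fun y => ind fun z => mk_eq (Rel.leibniz_lie x y z)

instance : Module F (Restrictification p F L) where
  one_smul := ind fun x => mk_eq (Rel.one_smul x)
  mul_smul a b := ind fun x => mk_eq (Rel.mul_smul a b x)
  smul_add a := ind fun x => ind fun y => mk_eq (Rel.smul_add a x y)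
  add_smul a b := ind fun x => mk_eq (Rel.add_smul a b x)
  smul_zero a := by
    have h : a • (0 : Restrictification p F L) = a • 0 + a • 0 := by
      conv_lhs => rw [← add_zero (0 : Restrictification p F L)]
      exact mk_eq (Rel.smul_add a 0 0)
    exact left_eq_add.1 h
  zero_smul := ind fun x => by
    have h : (0 : F) • (mk x : Restrictification p F L) = (0 : F) • mk x + (0 : F) • mk x := by
      conv_lhs => rw [← add_zero (0 : F)]
      exact mk_eq (Rel.add_smul 0 0 x)
    exact left_eq_add.1 h

instance : LieAlgebra F (Restrictification p F L) where
  lie_smul a := ind fun x => ind fun y => mk_eq (Rel.lie_smul a x y)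

theorem mk_adCoeff (x y : RTerm F L) : ∀ m k,
    (mk (adCoeff x y m k) : Restrictification p F L) = adCoeff (mk x) (mk y) m k
  | 0, 0 => rfl
  | 0, _ + 1 => rfl
  | m + 1, 0 => by rw [adCoeff, adCoeff, mk_lie, mk_adCoeff x y m 0]
  | m + 1, k + 1 => by
    rw [adCoeff, adCoeff, mk_add, mk_lie, mk_lie, mk_adCoeff x y m k, mk_adCoeff x y m (k + 1)]

theorem mk_jacSum (x y : RTerm F L) (n : ℕ) :
    (mk (jacSum p x y n) : Restrictification p F L) =
      ∑ k ∈ Finset.Icc 1 n, (k : F)⁻¹ • adCoeff (mk x) (mk y) (p - 1) (k - 1) := by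
  induction n with
  | zero => rfl
  | succ n ih =>
    rw [jacSum, mk_add, ih, mk_smul, mk_adCoeff, Finset.sum_Icc_succ_top (by omega)]
    rfl

theorem mk_adPow (x y : RTerm F L) (m : ℕ) :
    (mk (adPow x y m) : Restrictification p F L) = (LieAlgebra.ad F _ (mk x) ^ m) (mk y) := by
  induction m with
  | zero => rfl
  | succ m ih => rw [adPow, mk_lie, ih, pow_succ', Module.End.mul_apply, LieAlgebra.ad_apply]

instance : RestrictedLieAlgebra p F (Restrictification p F L) where
  pmap := pMap
  pmap_smul a := ind fun x => mk_eq (Rel.pmap_smul a x)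
  pmap_add := ind fun x => ind fun y => by
    rw [← mk_jacSum]
    exact mk_eq (Rel.pmap_add x y)
  lie_pmap := ind fun x => ind fun y => by
    rw [← mk_adPow]
    exact mk_eq (Rel.lie_pmap x y)

variable (p F L)

/-- The canonical Lie algebra homomorphism `L → L^{[p]}`. -/
def of : L →ₗ⁅F⁆ Restrictification p F L where
  toFun x := mk (RTerm.of x)
  map_add' x y := mk_eq (Rel.of_add x y)
  map_smul' a x := mk_eq (Rel.of_smul a x)
  map_lie' {x y} := mk_eq (Rel.of_lie x y)

variable {p F L}

variable {R : Type w} [LieRing R] [LieAlgebra F R] [RestrictedLieAlgebra p F R]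

/-- The value of a formal expression in a restricted Lie algebra. -/
def eval (f : L → R) : RTerm F L → R
  | .of x => f x
  | .zero => 0
  | .add x y => eval f x + eval f y
  | .neg x => -eval f x
  | .smul a x => a • eval f x
  | .lie x y => ⁅eval f x, eval f y⁆
  | .pmap x => RestrictedLieAlgebra.pmap p F (eval f x)

theorem eval_adCoeff (f : L → R) (x y : RTerm F L) : ∀ m k,
    eval (p := p) f (adCoeff x y m k) = adCoeff (eval (p := p) f x) (eval (p := p) f y) m k
  | 0, 0 => rfl
  | 0, _ + 1 => rfl
  | m + 1, 0 => congrArg (fun z => ⁅eval (p := p) f y, z⁆) (eval_adCoeff f x y m 0)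
  | m + 1, k + 1 => congrArg₂ (fun z w => ⁅eval (p := p) f x, z⁆ + ⁅eval (p := p) f y, w⁆)
      (eval_adCoeff f x y m k) (eval_adCoeff f x y m (k + 1))

theorem eval_jacSum (f : L → R) (x y : RTerm F L) (n : ℕ) :
    eval (p := p) f (jacSum p x y n) =
      ∑ k ∈ Finset.Icc 1 n,
        (k : F)⁻¹ • adCoeff (eval (p := p) f x) (eval (p := p) f y) (p - 1) (k - 1) := by
  induction n with
  | zero => rfl
  | succ n ih =>
    rw [Finset.sum_Icc_succ_top (by omega), ← ih, Nat.add_sub_cancel, ← eval_adCoeff]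
    rfl

theorem eval_adPow (f : L → R) (x y : RTerm F L) (m : ℕ) :
    eval (p := p) f (adPow x y m) =
      (LieAlgebra.ad F _ (eval (p := p) f x) ^ m) (eval (p := p) f y) := by
  induction m with
  | zero => rfl
  | succ m ih =>
    rw [pow_succ', Module.End.mul_apply, LieAlgebra.ad_apply, ← ih]
    rfl

theorem eval_rel (f : L →ₗ⁅F⁆ R) {x y : RTerm F L} (h : Rel p x y) :
    eval (p := p) f x = eval (p := p) f y := by
  induction h with
  | refl x => rfl
  | symm _ ih => exact ih.symm
  | trans _ _ ih ih' => exact ih.trans ih'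
  | add_congr _ _ ih ih' => exact congrArg₂ (· + ·) ih ih'
  | neg_congr _ ih => exact congrArg (- ·) ih
  | smul_congr a _ ih => exact congrArg (a • ·) ih
  | lie_congr _ _ ih ih' => exact congrArg₂ (fun x y => ⁅x, y⁆) ih ih'
  | pmap_congr _ ih => exact congrArg (RestrictedLieAlgebra.pmap p F) ih
  | add_assoc x y z => exact _root_.add_assoc (eval f x) _ _
  | add_comm x y => exact _root_.add_comm (eval f x) _
  | zero_add x => exact _root_.zero_add (eval f x)
  | neg_add_cancel x => exact _root_.neg_add_cancel (eval f x)
  | smul_add a x y => exact _root_.smul_add a (eval f x) _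
  | add_smul a b x => exact _root_.add_smul a b (eval f x)
  | mul_smul a b x => exact SemigroupAction.mul_smul a b (eval f x)
  | one_smul x => exact _root_.one_smul F (eval f x)
  | add_lie x y z => exact _root_.add_lie (eval f x) (eval f y) (eval f z)
  | lie_add x y z => exact _root_.lie_add (eval f x) (eval f y) (eval f z)
  | lie_self x => exact _root_.lie_self (eval f x)
  | leibniz_lie x y z => exact _root_.leibniz_lie (eval f x) (eval f y) (eval f z)
  | lie_smul a x y => exact _root_.lie_smul a (eval f x) (eval f y)
  | pmap_smul a x => exact RestrictedLieAlgebra.pmap_smul a (eval f x)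
  | pmap_add x y =>
    refine (RestrictedLieAlgebra.pmap_add (p := p) (F := F) (eval f x) (eval f y)).trans ?_
    rw [← eval_jacSum]
    rfl
  | lie_pmap x y =>
    refine (RestrictedLieAlgebra.lie_pmap (p := p) (F := F) (eval f x) (eval f y)).trans ?_
    rw [← eval_adPow]
  | of_add x y => exact map_add f x y
  | of_smul a x => exact map_smul f a x
  | of_lie x y => exact f.map_lie x y

/-- The universal property: a Lie algebra homomorphism `f` from `L` to a restricted Lie algebra `R`
extends to a homomorphism `L^{[p]} → R` of restricted Lie algebras (see `lift_of`, `lift_pmap`),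
and the extension is unique (see `lift_unique`). -/
def lift (f : L →ₗ⁅F⁆ R) : Restrictification p F L →ₗ⁅F⁆ R where
  toFun := Quotient.lift (eval (p := p) f) fun _ _ h => eval_rel f h
  map_add' := ind fun _ => ind fun _ => rfl
  map_smul' _ := ind fun _ => rfl
  map_lie' {x y} := by
    induction x using ind
    induction y using ind
    rfl

theorem lift_of (f : L →ₗ⁅F⁆ R) (x : L) : lift f (of p F L x) = f x := rfl

theorem lift_pmap (f : L →ₗ⁅F⁆ R) (x : Restrictification p F L) :
    lift f (RestrictedLieAlgebra.pmap p F x) = RestrictedLieAlgebra.pmap p F (lift f x) := by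
  revert x
  exact ind fun _ => rfl

theorem lift_unique (f : L →ₗ⁅F⁆ R) (g : Restrictification p F L →ₗ⁅F⁆ R)
    (hp : ∀ x, g (RestrictedLieAlgebra.pmap p F x) = RestrictedLieAlgebra.pmap p F (g x))
    (hf : ∀ x, g (of p F L x) = f x) : g = lift f := by
  refine LieHom.ext (ind fun x => ?_)
  induction x with
  | of x => exact hf x
  | zero => exact (map_zero g).trans (map_zero (lift f)).symm
  | add x y hx hy =>
    change g (mk x + mk y) = lift f (mk x + mk y)
    rw [map_add, map_add, hx, hy]
  | neg x hx =>
    change g (-mk x) = lift f (-mk x)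
    rw [map_neg, map_neg, hx]
  | smul a x hx =>
    change g (a • mk x) = lift f (a • mk x)
    rw [map_smul, map_smul, hx]
  | lie x y hx hy =>
    change g ⁅(mk x : Restrictification p F L), (mk y : Restrictification p F L)⁆ =
      lift f ⁅(mk x : Restrictification p F L), (mk y : Restrictification p F L)⁆
    rw [LieHom.map_lie, LieHom.map_lie, hx, hy]
  | pmap x hx =>
    change g (RestrictedLieAlgebra.pmap p F (mk x)) = lift f (RestrictedLieAlgebra.pmap p F (mk x))
    rw [hp, lift_pmap, hx]

end Restrictification

end Restrictification

/-- The restricted Lie ideal generated by a set `S`: the smallest Lie ideal that contains `S` and is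
closed under the `p`-map. -/
def restrictedIdealSpan (p : ℕ) (F : Type v) {L : Type u} [Field F] [LieRing L] [LieAlgebra F L]
    [RestrictedLieAlgebra p F L] (S : Set L) : LieIdeal F L :=
  sInf {I : LieIdeal F L | S ⊆ I ∧ ∀ x ∈ I, RestrictedLieAlgebra.pmap p F x ∈ I}

theorem mem_restrictedIdealSpan {p : ℕ} {F : Type v} {L : Type u} [Field F] [LieRing L]
    [LieAlgebra F L] [RestrictedLieAlgebra p F L] (S : Set L) (x : L) :
    x ∈ restrictedIdealSpan p F S ↔ ∀ I : LieIdeal F L, S ⊆ I →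
      (∀ y ∈ I, RestrictedLieAlgebra.pmap p F y ∈ I) → x ∈ I := by
  rw [restrictedIdealSpan, ← LieSubmodule.mem_coe, LieSubmodule.coe_sInf, Set.mem_iInter₂]
  exact ⟨fun h I h1 h2 => h I ⟨h1, h2⟩, fun h I hI => h I hI.1 hI.2⟩

theorem subset_restrictedIdealSpan {p : ℕ} {F : Type v} {L : Type u} [Field F] [LieRing L]
    [LieAlgebra F L] [RestrictedLieAlgebra p F L] (S : Set L) :
    S ⊆ restrictedIdealSpan p F S := fun _ hx =>
  (mem_restrictedIdealSpan _ _).2 fun _ hI _ => hI hx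

theorem pmap_mem_restrictedIdealSpan {p : ℕ} {F : Type v} {L : Type u} [Field F] [LieRing L]
    [LieAlgebra F L] [RestrictedLieAlgebra p F L] {S : Set L} {x : L}
    (hx : x ∈ restrictedIdealSpan p F S) :
    RestrictedLieAlgebra.pmap p F x ∈ restrictedIdealSpan p F S :=
  (mem_restrictedIdealSpan _ _).2 fun I h1 h2 =>
    h2 x ((mem_restrictedIdealSpan _ _).1 hx I h1 h2)


noncomputable section Theta

variable (p : ℕ) [hp : Fact p.Prime] (G : Type u) [Group G]

/-- The homomorphism `ρ : gr^M(G) → gr^{Z,p}(G)`, `x γ_{n+1}(G) ↦ x D_{n+1}(G)`, of Lie rings. -/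
def rho : MagnusLie G →ₗ⁅ℤ⁆ ZassenhausLie p G :=
  CentralSeries.map (gammaSeries G) (dimensionSeries (ZMod p) G)
    (gammaSeries_le G _ (dimensionSeries_one (ZMod p) G))

/-- The Lie algebra `gr^M(G) ⊗ 𝔽_p` over `𝔽_p`. -/
abbrev MagnusLieMod : Type u := ZMod p ⊗[ℤ] MagnusLie G

/-- The homomorphism `θ : gr^M(G) ⊗ 𝔽_p → gr^{Z,p}(G)` of Lie algebras over `𝔽_p` given by
`θ(a ⊗ x) = a ρ(x)`. -/
def theta : MagnusLieMod p G →ₗ⁅ZMod p⁆ ZassenhausLie p G :=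
  { (rho p G : MagnusLie G →ₗ[ℤ] ZassenhausLie p G).liftBaseChange (ZMod p) with
    map_lie' := by
      intro x y
      change LinearMap.liftBaseChange (ZMod p) (rho p G : MagnusLie G →ₗ[ℤ] ZassenhausLie p G) _ =
        ⁅LinearMap.liftBaseChange (ZMod p) (rho p G : MagnusLie G →ₗ[ℤ] ZassenhausLie p G) x,
          LinearMap.liftBaseChange (ZMod p) (rho p G : MagnusLie G →ₗ[ℤ] ZassenhausLie p G) y⁆
      induction x using TensorProduct.induction_on with
      | zero => rw [zero_lie, map_zero, zero_lie]
      | add x x' hx hx' => rw [add_lie, map_add, map_add, add_lie, hx, hx']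
      | tmul a x =>
        induction y using TensorProduct.induction_on with
        | zero => rw [lie_zero, map_zero, lie_zero]
        | add y y' hy hy' => rw [lie_add, map_add, map_add, lie_add, hy, hy']
        | tmul b y =>
          rw [LieAlgebra.ExtendScalars.bracket_tmul, LinearMap.liftBaseChange_tmul,
            LinearMap.liftBaseChange_tmul, LinearMap.liftBaseChange_tmul, smul_lie, lie_smul,
            smul_smul]
          congr 1
          exact (rho p G).map_lie x y }

theorem theta_tmul (a : ZMod p) (x : MagnusLie G) : theta p G (a ⊗ₜ x) = a • rho p G x :=
  LinearMap.liftBaseChange_tmul _ _ _ _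

/-- The homomorphism of restricted Lie algebras
`θ̂ : (gr^M(G) ⊗ 𝔽_p)^{[p]} → gr^{Z,p}(G)` that corresponds to `θ` under the adjunction. -/
def thetaHat : Restrictification p (ZMod p) (MagnusLieMod p G) →ₗ⁅ZMod p⁆ ZassenhausLie p G :=
  Restrictification.lift (theta p G)

/-- The subspace `gr^M_{≥ 2}(G) ⊗ 𝔽_p` of `gr^M(G) ⊗ 𝔽_p`. -/
def magnusModGeTwo : Submodule (ZMod p) (MagnusLieMod p G) :=
  (magnusGeTwo G).baseChange (ZMod p)

end Theta

section Uniform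

variable (p : ℕ) (G : Type u) [Group G] [TopologicalSpace G]

/-- A topological group is pro-`p` if it is profinite, i.e. compact and totally disconnected (hence
Hausdorff), and every open normal subgroup has index a power of `p`. -/
structure IsProPGroup : Prop where
  isTopologicalGroup : IsTopologicalGroup G
  compactSpace : CompactSpace G
  totallyDisconnectedSpace : TotallyDisconnectedSpace G
  index_eq : ∀ N : Subgroup G, N.Normal → IsOpen (N : Set G) → ∃ k : ℕ, N.index = p ^ k

/-- The subgroup `G ^ m` generated by all `m`-th powers. -/
def powSubgroup (G : Type u) [Group G] (m : ℕ) : Subgroup G :=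
  Subgroup.closure (Set.range fun g : G => g ^ m)

/-- A uniform (uniformly powerful) pro-`p` group: a (topologically) finitely generated pro-`p` group
that is torsion-free and powerful, i.e. `⁅G, G⁆` is contained in the closure of `G ^ p`
(of `G ^ 4` if `p = 2`). -/
structure IsUniformProP : Prop extends IsProPGroup p G where
  finitelyGenerated : ∃ S : Finset G, closure (Subgroup.closure (S : Set G) : Set G) = Set.univ
  torsionFree : ∀ g : G, IsOfFinOrder g → g = 1
  powerful : (commutator G : Set G) ⊆ closure (powSubgroup G (if p = 2 then 4 else p) : Set G)

end Uniform

/-! ### Generation in degree one, and commutativity, of the associated graded algebra -/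

section AssocGradedCommutative

variable {R : Type v} [CommRing R] {G : Type u} [Group G]

/-! Write `P_0 = G` and let `P_{n+1}` be the closed subgroup generated by the `p`-th powers of
elements of `P_n` (`powSeries`). The group theory is that of powerful groups. From `[G, G] ≤ P_1`
(`≤ P_2` if `p = 2`) one gets `[P_n, G] ≤ P_{n+1}` (respectively `P_{n+2}`) by an induction carried
out in finite, hence nilpotent, quotients (`isPowSeriesCentral`). So `x ↦ x ^ p` is a homomorphism
`P_n → G / P_{n+2}`, and compactness shows that every element of `P_{n+1}` is a `p`-th power from
`P_n`. Torsion-freeness makes `P_n / P_{n+1} → P_{n+1} / P_{n+2}` injective, so `G / P_n` has order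
`p ^ (d n)`, where `|G / P_1| = p ^ d`.

Consequently commutators are `p`-th powers, or fourth powers if `p = 2`, and lie in `D_3`. The
graded algebra of the group algebra is generated in degree one, where its generators now commute, so
it is commutative. The Zassenhaus algebra embeds into it and is therefore abelian. Moreover `γ_n ≤
D_{n+1}` for `n ≥ 2`, so the ideal `I` generated by the degrees at least two lies in the kernel of
`θ̂`.

For the converse, all brackets of the restrictification lie in `I`, so modulo `I` the `p`-map is
additive and every element is a finite sum of iterated `p`-maps of order `k` applied to degree-one
classes of elements `v_k` of `G`. Its image under `θ̂` has the class of `v_k ^ p ^ k` in degree `p ^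
k`, and these degrees are distinct. If the image is zero, then `v_k ^ p ^ k ∈ D_{p^k+1}` for each
`k`. It remains to see that this forces `v_k` to be a `p`-th power, for then its class in `G / γ_2 ⊗
𝔽_p` is zero (`ker_thetaHat_eq`).

That last point is a dimension count (`coeff_eq_zero_of_sum_symbOne_pow_eq_zero`). Let `Q = G /
P_{k+1}` and `q = p ^ (k + 1)`, so `|Q| = q ^ d`. The graded algebra of `𝔽_p[Q]` is commutative,
generated by `d` classes `X_i` with `X_i ^ q = 0`, and its total dimension is `q ^ d`. Hence the
truncated monomials are independent. If `v_k` has coordinates `c_i` in `G / P_1`, the class of `v_k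
^ p ^ k - 1` is `(∑ c_i X_i) ^ p ^ k = ∑ c_i X_i ^ p ^ k`. Its vanishing gives `c = 0`, so `v_k ∈
P_1` is a `p`-th power. -/

/-- Both sides are linear, and on a group element the difference is `g - 1`. So the `g - 1` span the
augmentation ideal over `R`, without multiplying by ring elements. -/
theorem sub_augmentation_mem_span (x : MonoidAlgebra R G) :
    x - augmentation R G x • (1 : MonoidAlgebra R G) ∈
      Submodule.span R (Set.range fun g : G => grp R G g - 1) := by
  induction x using MonoidAlgebra.induction_on with
  | of g =>
    have h : augmentation R G (MonoidAlgebra.of R G g) = 1 := by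
      rw [augmentation, MonoidAlgebra.lift_of]; rfl
    rw [h, one_smul]
    exact Submodule.subset_span ⟨g, rfl⟩
  | add x y hx hy =>
    have e : x + y - augmentation R G (x + y) • (1 : MonoidAlgebra R G) =
        (x - augmentation R G x • (1 : MonoidAlgebra R G)) +
          (y - augmentation R G y • (1 : MonoidAlgebra R G)) := by
      rw [map_add, add_smul]; abel
    rw [e]
    exact add_mem hx hy
  | smul r x hx =>
    have e : r • x - augmentation R G (r • x) • (1 : MonoidAlgebra R G) =
        r • (x - augmentation R G x • (1 : MonoidAlgebra R G)) := by
      rw [map_smul, smul_sub, smul_assoc]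
    rw [e]
    exact Submodule.smul_mem _ _ hx

theorem mem_span_of_mem_augmentationIdeal {x : MonoidAlgebra R G}
    (hx : x ∈ augmentationIdeal R G) :
    x ∈ Submodule.span R (Set.range fun g : G => grp R G g - 1) := by
  have h := sub_augmentation_mem_span x
  rwa [show augmentation R G x = 0 from hx, zero_smul, sub_zero] at h

theorem grp_sub_one_mem (g : G) : grp R G g - 1 ∈ augmentationIdeal R G := by
  rw [← neg_mem_iff, neg_sub]
  exact one_sub_mem_augmentationIdeal R g

theorem grp_sub_one_mem_pow_one (g : G) : grp R G g - 1 ∈ augmentationIdeal R G ^ 1 := by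
  rw [Submodule.pow_one]
  exact grp_sub_one_mem g

theorem smul_mem_aug_pow {n : ℕ} (r : R) {x : MonoidAlgebra R G}
    (hx : x ∈ augmentationIdeal R G ^ n) : r • x ∈ augmentationIdeal R G ^ n := by
  rw [← one_mul x, ← smul_mul_assoc]
  exact Ideal.mul_mem_left _ _ hx

theorem symb_smul {n : ℕ} (r : R) {x : MonoidAlgebra R G}
    (hx : x ∈ augmentationIdeal R G ^ n) :
    symb n (r • x) (smul_mem_aug_pow r hx) = r • symb n x hx := by
  have e : reesMonomial n (r • x) (smul_mem_aug_pow r hx) = r • reesMonomial n x hx :=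
    Subtype.ext (Polynomial.smul_monomial r n x).symm
  rw [symb, e]
  rfl

theorem symb_zero (n : ℕ) : symb n (0 : MonoidAlgebra R G) (zero_mem _) = 0 := by
  have h := symb_add (zero_mem (augmentationIdeal R G ^ n)) (zero_mem _)
  simpa using h

theorem symb_zero_one (h : (1 : MonoidAlgebra R G) ∈ augmentationIdeal R G ^ 0) :
    symb 0 (1 : MonoidAlgebra R G) h = 1 := by
  have e : reesMonomial 0 (1 : MonoidAlgebra R G) h = 1 := Subtype.ext rfl
  rw [symb, e, map_one]

theorem symb_eq_zero_iff {n : ℕ} {x : MonoidAlgebra R G} (hx : x ∈ augmentationIdeal R G ^ n) :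
    symb n x hx = 0 ↔ x ∈ augmentationIdeal R G ^ (n + 1) := by
  constructor
  · intro h
    have h' := assocCoeff_symb n n x hx
    rw [h, map_zero, if_pos rfl, eq_comm, QuotientAddGroup.eq_zero_iff] at h'
    exact h'
  · intro h
    rw [← symb_zero n]
    refine symb_congr rfl _ _ ?_
    rwa [sub_zero]

theorem mem_aug_pow_zero (x : MonoidAlgebra R G) : x ∈ augmentationIdeal R G ^ 0 := by
  rw [Submodule.pow_zero, Ideal.one_eq_top]
  exact Submodule.mem_top

/-- An induction principle for the homogeneous elements of the associated graded algebra, which is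
generated by its elements of degree `1`. -/
theorem symb_mem (W : ℕ → Submodule R (AssocGr R G)) (h0 : 1 ∈ W 0)
    (h1 : ∀ n g, ∀ b ∈ W n, symb 1 (grp R G g - 1) (grp_sub_one_mem_pow_one g) * b ∈ W (n + 1))
    (n : ℕ) : ∀ x hx, symb n x hx ∈ W n := by
  induction n with
  | zero =>
    intro x hx
    -- In degree `0` only the augmentation of `x` survives modulo `ω`.
    have hm : augmentation R G x • (1 : MonoidAlgebra R G) ∈ augmentationIdeal R G ^ 0 :=
      mem_aug_pow_zero _
    have e : symb 0 x hx = symb 0 _ hm := by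
      refine symb_congr rfl _ _ ?_
      rw [zero_add, Submodule.pow_one, augmentationIdeal, RingHom.mem_ker]
      simp
    rw [e, symb_smul _ (mem_aug_pow_zero _), symb_zero_one]
    exact Submodule.smul_mem _ _ h0
  | succ n ih =>
    intro x hx
    -- The membership proof is quantified inside the predicate so that it can be carried through the
    -- induction on `ω * ω ^ n`.
    have key : ∃ h, symb (n + 1) x h ∈ W (n + 1) := by
      have hx' := hx
      rw [Ideal.IsTwoSided.pow_succ] at hx'
      refine Submodule.mul_induction_on hx' ?_ ?_
      · intro a ha b hb
        have ha1 : a ∈ augmentationIdeal R G ^ 1 := by rwa [Submodule.pow_one]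
        have hab := aug_mul_mem ha1 hb
        have hab' : a * b ∈ augmentationIdeal R G ^ (n + 1) := by rwa [add_comm] at hab
        refine ⟨hab', ?_⟩
        rw [symb_congr (add_comm n 1) hab' hab (by rw [sub_self]; exact zero_mem _), symb_mul ha1 hb]
        have hs := ih b hb
        have key2 : ∃ h, symb 1 a h * symb n b hb ∈ W (n + 1) := by
          refine Submodule.span_induction (p := fun a _ => ∃ h, symb 1 a h * symb n b hb ∈ W (n + 1))
            ?_ ?_ ?_ ?_ (mem_span_of_mem_augmentationIdeal ha)
          · rintro _ ⟨g, rfl⟩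
            exact ⟨_, h1 n g _ hs⟩
          · exact ⟨zero_mem _, by rw [symb_zero, zero_mul]; exact zero_mem _⟩
          · rintro x y _ _ ⟨h, hx⟩ ⟨h', hy⟩
            exact ⟨add_mem h h', by rw [symb_add h h', add_mul]; exact add_mem hx hy⟩
          · rintro r x _ ⟨h, hx⟩
            exact ⟨smul_mem_aug_pow r h, by
              rw [symb_smul r h, smul_mul_assoc]; exact Submodule.smul_mem _ _ hx⟩
        exact key2.2
      · rintro x y ⟨h, hx⟩ ⟨h', hy⟩
        exact ⟨add_mem h h', by rw [symb_add h h']; exact add_mem hx hy⟩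
    exact key.2

theorem symb_mem_adjoin (n : ℕ) (x : MonoidAlgebra R G) (hx : x ∈ augmentationIdeal R G ^ n) :
    symb n x hx ∈ Algebra.adjoin R
      (Set.range fun g : G => symb 1 (grp R G g - 1) (grp_sub_one_mem_pow_one g)) :=
  symb_mem (fun _ => Subalgebra.toSubmodule (Algebra.adjoin R
      (Set.range fun g : G => symb 1 (grp R G g - 1) (grp_sub_one_mem_pow_one g))))
    (one_mem (Algebra.adjoin R _))
    (fun _ g _ hb => (Algebra.adjoin R _).mul_mem (Algebra.subset_adjoin ⟨g, rfl⟩) hb) n x hx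

/-- An element of the Rees algebra is the sum of its homogeneous parts, each of which is in the Rees
algebra again. -/
theorem assocGr_induction {P : AssocGr R G → Prop} (h0 : P 0) (h1 : ∀ n x hx, P (symb n x hx))
    (h2 : ∀ a b, P a → P b → P (a + b)) (b : AssocGr R G) : P b := by
  obtain ⟨f, rfl⟩ := Ideal.Quotient.mk_surjective b
  have e : f = ∑ n ∈ (reesVal R G f).support,
      reesMonomial n ((reesVal R G f).coeff n) (reesVal_mem R G f n) := by
    apply reesVal_inj
    rw [map_sum]
    exact (reesVal R G f).as_sum_support
  rw [e, map_sum]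
  exact Finset.sum_induction _ P h2 h0 fun n _ => h1 n _ (reesVal_mem R G f n)

/-- If all commutators lie in the third dimension subgroup, the associated graded algebra of the
group algebra is commutative. -/
theorem assocGr_mul_comm (h : ∀ x y : G, x * y * x⁻¹ * y⁻¹ ∈ dimensionSubgroup R G 3)
    (a b : AssocGr R G) : a * b = b * a := by
  have hgen : ∀ x y : G,
      Commute (symb 1 (grp R G x - 1) (grp_sub_one_mem_pow_one x))
        (symb 1 (grp R G y - 1) (grp_sub_one_mem_pow_one y)) := by
    intro x y
    rw [Commute, SemiconjBy, ← symb_mul, ← symb_mul]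
    refine symb_congr rfl _ _ ?_
    have h1 := mem_dimensionSubgroup.1 (h x y)
    rw [commutator_sub_one] at h1
    -- The commutator minus `1` is the ring commutator of `x - 1` and `y - 1` times `x⁻¹ y⁻¹`;
    -- multiplying by `y x` removes this unit.
    have h2 := Ideal.mul_mem_right (grp R G y * grp R G x) _ h1
    rwa [mul_assoc, mul_assoc (grp R G x⁻¹), ← mul_assoc (grp R G y⁻¹), grp_inv_mul, one_mul,
      grp_inv_mul, mul_one] at h2
  have hs : ∀ n x hx m y hy, Commute (symb n x hx : AssocGr R G) (symb m y hy) := by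
    intro n x hx m y hy
    refine Algebra.commute_of_mem_adjoin_of_forall_mem_commute (symb_mem_adjoin m y hy) ?_
    rintro _ ⟨g, rfl⟩
    refine Commute.symm ?_
    refine Algebra.commute_of_mem_adjoin_of_forall_mem_commute (symb_mem_adjoin n x hx) ?_
    rintro _ ⟨g', rfl⟩
    exact hgen g g'
  change Commute a b
  induction a using assocGr_induction with
  | h0 => exact Commute.zero_left b
  | h2 a a' ha ha' => exact ha.add_left ha'
  | h1 n x hx =>
    induction b using assocGr_induction with
    | h0 => exact Commute.zero_right _
    | h2 b b' hb hb' => exact hb.add_right hb'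
    | h1 m y hy => exact hs n x hx m y hy

/-- The defect of additivity is `(g - 1) * (h - 1)`, which lies in `ω ^ 2`. -/
theorem symb_one_mul (g h : G) :
    symb 1 (grp R G (g * h) - 1) (grp_sub_one_mem_pow_one (g * h)) =
      symb 1 (grp R G g - 1) (grp_sub_one_mem_pow_one g) +
        symb 1 (grp R G h - 1) (grp_sub_one_mem_pow_one h) := by
  rw [← symb_add]
  refine symb_congr rfl _ _ ?_
  have e : grp R G (g * h) - 1 - (grp R G g - 1 + (grp R G h - 1)) =
      (grp R G g - 1) * (grp R G h - 1) := by
    rw [grp_mul]; noncomm_ring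
  rw [e]
  exact aug_mul_mem (grp_sub_one_mem_pow_one g) (grp_sub_one_mem_pow_one h)

end AssocGradedCommutative

theorem zassenhausLie_isLieAbelian {p : ℕ} [Fact p.Prime] {G : Type u} [Group G]
    (h : ∀ x y : G, x * y * x⁻¹ * y⁻¹ ∈ dimensionSubgroup (ZMod p) G 3) :
    IsLieAbelian (ZassenhausLie p G) where
  trivial x y := by
    apply dimToAssocAdd_injective
    rw [dimToAssocAdd_lie, map_zero, Ring.lie_def, assocGr_mul_comm h, sub_self]

/-! ### Nilpotency of the augmentation ideal of a finite `p`-group over `𝔽_p` -/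

section Nilpotent

variable {p : ℕ} [hp : Fact p.Prime] {Q : Type u} [Group Q] [Finite Q]

/-- The number of fixed points of a `p`-group on a finite set of order divisible by `p` is divisible
by `p`. Since `0` is fixed, there is another fixed point. -/
theorem exists_ne_zero_forall_grp_smul_eq (hQ : IsPGroup p Q) (M : Type*) [AddCommGroup M]
    [Module (MonoidAlgebra (ZMod p) Q) M] [Finite M] [Nontrivial M] :
    ∃ m : M, m ≠ 0 ∧ ∀ g : Q, grp (ZMod p) Q g • m = m := by
  let _ : MulAction Q M := MulAction.compHom M (MonoidAlgebra.of (ZMod p) Q)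
  let _ : Module (ZMod p) M :=
    Module.compHom M (algebraMap (ZMod p) (MonoidAlgebra (ZMod p) Q))
  have hdvd : p ∣ Nat.card M := by
    obtain ⟨m, hm⟩ := exists_ne (0 : M)
    have h1 : addOrderOf m = p := by
      refine addOrderOf_eq_prime ?_ hm
      rw [← Nat.cast_smul_eq_nsmul (ZMod p), CharP.cast_eq_zero, zero_smul]
    rw [← h1]
    exact addOrderOf_dvd_natCard m
  have h0 : (0 : M) ∈ MulAction.fixedPoints Q M := fun g => smul_zero (grp (ZMod p) Q g)
  obtain ⟨b, hb, hne⟩ := hQ.exists_fixed_point_of_prime_dvd_card_of_fixed_point M hdvd h0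
  exact ⟨b, hne.symm, hb⟩

theorem augmentationIdeal_smul_eq_zero {M : Type*} [AddCommGroup M]
    [Module (MonoidAlgebra (ZMod p) Q) M] {m : M} (hm : ∀ g : Q, grp (ZMod p) Q g • m = m)
    {x : MonoidAlgebra (ZMod p) Q} (hx : x ∈ augmentationIdeal (ZMod p) Q) : x • m = 0 := by
  refine Submodule.span_induction (p := fun x _ => x • m = 0) ?_ ?_ ?_ ?_
    (mem_span_of_mem_augmentationIdeal hx)
  · rintro _ ⟨g, rfl⟩
    change (grp (ZMod p) Q g - 1) • m = 0
    rw [sub_smul, hm, one_smul, sub_self]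
  · exact zero_smul _ m
  · intro x y _ _ hx hy
    rw [add_smul, hx, hy, add_zero]
  · intro r x _ hx
    rw [← one_mul x, ← smul_mul_assoc, mul_smul, hx, smul_zero]

/-- The elements annihilated by `ω ^ n` from the left. -/
def augAnnihilator (p : ℕ) (Q : Type u) [Group Q] (n : ℕ) : Ideal (MonoidAlgebra (ZMod p) Q) where
  carrier := {x | ∀ w ∈ augmentationIdeal (ZMod p) Q ^ n, w * x = 0}
  zero_mem' _ _ := mul_zero _
  add_mem' hx hy w hw := by rw [mul_add, hx w hw, hy w hw, add_zero]
  smul_mem' a x hx w hw := by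
    rw [smul_eq_mul, ← mul_assoc]
    exact hx _ (Ideal.mul_mem_right _ _ hw)

/-- The left annihilation conditions by `ω ^ n` give an ascending chain of ideals in a finite ring,
stationary from some `N` on. If the `N`-th were proper, a nonzero fixed vector of the quotient would
lift to an `x` with `ω x` killed by `ω ^ N`. Then `x` lies in the next annihilator, which is the
same one, a contradiction. So `ω ^ N` kills `1`. -/
theorem exists_augmentationIdeal_pow_eq_bot (hQ : IsPGroup p Q) :
    ∃ N, augmentationIdeal (ZMod p) Q ^ N = ⊥ := by
  have : Finite (MonoidAlgebra (ZMod p) Q) :=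
    Module.finite_of_finite (ZMod p)
  let r : ℕ →o Ideal (MonoidAlgebra (ZMod p) Q) :=
    ⟨augAnnihilator p Q, fun n m h x hx w hw => hx w (aug_of_le h hw)⟩
  obtain ⟨N, hN⟩ := WellFoundedGT.monotone_chain_condition r
  refine ⟨N, ?_⟩
  have htop : augAnnihilator p Q N = ⊤ := by
    by_contra hne
    have : Nontrivial (MonoidAlgebra (ZMod p) Q ⧸ augAnnihilator p Q N) :=
      Submodule.Quotient.nontrivial_iff.2 hne
    have : Finite (MonoidAlgebra (ZMod p) Q ⧸ augAnnihilator p Q N) :=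
      Finite.of_surjective _ (Submodule.mkQ_surjective _)
    obtain ⟨m, hm0, hm⟩ := exists_ne_zero_forall_grp_smul_eq hQ
      (MonoidAlgebra (ZMod p) Q ⧸ augAnnihilator p Q N)
    obtain ⟨x, rfl⟩ := Submodule.mkQ_surjective _ m
    refine hm0 ((Submodule.Quotient.mk_eq_zero _).2 ?_)
    have hx : x ∈ augAnnihilator p Q (N + 1) := by
      intro w hw
      rw [Submodule.pow_succ] at hw
      refine Submodule.mul_induction_on hw ?_ ?_
      · intro a ha b hb
        have h : b * x ∈ augAnnihilator p Q N := by
          rw [← Submodule.Quotient.mk_eq_zero]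
          exact augmentationIdeal_smul_eq_zero hm hb
        rw [mul_assoc]
        exact h a ha
      · intro a b ha hb
        rw [add_mul, ha, hb, add_zero]
    have h := hN (N + 1) (Nat.le_succ N)
    change augAnnihilator p Q N = augAnnihilator p Q (N + 1) at h
    rwa [h]
  rw [eq_bot_iff]
  intro w hw
  have h : (1 : MonoidAlgebra (ZMod p) Q) ∈ augAnnihilator p Q N := htop ▸ Submodule.mem_top
  have := h w hw
  rwa [mul_one] at this

end Nilpotent

/-! ### Independence of truncated monomials by counting dimensions -/

section MonomialCount

variable {R : Type v} [CommRing R] {G : Type u} [Group G]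

/-- The commutative ring structure on the associated graded algebra of the group algebra of a group
whose commutators lie in the third dimension subgroup. -/
noncomputable abbrev assocGrCommRing (h : ∀ x y : G, x * y * x⁻¹ * y⁻¹ ∈ dimensionSubgroup R G 3) :
    CommRing (AssocGr R G) where
  mul_comm := assocGr_mul_comm h

/-- The class of `g - 1` in degree `1` of the associated graded algebra. -/
noncomputable def symbOne (R : Type v) [CommRing R] {G : Type u} [Group G] (g : G) : AssocGr R G :=
  symb 1 (grp R G g - 1) (grp_sub_one_mem_pow_one g)

theorem symbOne_pow (g : G) (n : ℕ) :
    ∃ h, symbOne R g ^ n = symb n ((grp R G g - 1) ^ n) h := by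
  have h := aug_pow_mem (grp_sub_one_mem_pow_one (R := R) g) n
  have h' : (grp R G g - 1) ^ n ∈ augmentationIdeal R G ^ n := by rwa [one_mul] at h
  refine ⟨h', ?_⟩
  rw [symbOne, ← symb_pow]
  exact symb_congr (one_mul n) _ _ (by rw [sub_self]; exact zero_mem _)

/-- Symbols are multiplicative, so a monomial in degree-one classes lifts to the power of `ω` given
by its degree. These lifts become a basis of the group algebra in the dimension count; the order of
their factors is immaterial. -/
theorem exists_symb_eq_prod (hc : ∀ x y : G, x * y * x⁻¹ * y⁻¹ ∈ dimensionSubgroup R G 3)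
    {ι : Type*} (a : ι → G) (f : ι → ℕ) (s : Finset ι) :
    letI := assocGrCommRing hc
    ∃ x, ∃ hx : x ∈ augmentationIdeal R G ^ (∑ i ∈ s, f i),
      symb _ x hx = ∏ i ∈ s, symbOne R (a i) ^ f i := by
  classical
  let _ := assocGrCommRing hc
  induction s using Finset.induction_on with
  | empty => exact ⟨1, mem_aug_pow_zero 1, symb_zero_one _⟩
  | insert i s hi ih =>
    obtain ⟨x, hx, e⟩ := ih
    obtain ⟨h, e'⟩ := symbOne_pow (R := R) (a i) (f i)
    have hm := aug_mul_mem h hx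
    rw [← Finset.sum_insert hi (f := f)] at hm
    refine ⟨_, hm, ?_⟩
    rw [Finset.prod_insert hi, ← e, e']
    refine (symb_congr ?_ _ (aug_mul_mem h hx) (by rw [sub_self]; exact zero_mem _)).trans
      (symb_mul h hx)
    rw [Finset.sum_insert hi]

variable {p : ℕ} [hp : Fact p.Prime] {Q : Type u} [Group Q] [Finite Q] {ι : Type} [Fintype ι]

/-- By `symb_mem` it is enough that multiplication by a degree-one class sends the span in degree
`n` to the span in degree `n + 1`. By `hcg` that class may be taken to be a single generator, which
either raises one exponent or produces a `q`-th power, which is zero. -/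
theorem symb_mem_span_monomials
    (hc : ∀ x y : Q, x * y * x⁻¹ * y⁻¹ ∈ dimensionSubgroup (ZMod p) Q 3)
    (a : ι → Q) (c : Q → ι → ZMod p)
    (hcg : ∀ g, symbOne (ZMod p) g = ∑ i, c g i • symbOne (ZMod p) (a i))
    {q : ℕ} [NeZero q] (haq : ∀ i, symbOne (ZMod p) (a i) ^ q = 0) (n : ℕ)
    (x : MonoidAlgebra (ZMod p) Q) (hx : x ∈ augmentationIdeal (ZMod p) Q ^ n) :
    letI := assocGrCommRing hc
    symb n x hx ∈ Submodule.span (ZMod p)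
      ((fun e : ι → Fin q => ∏ i, symbOne (ZMod p) (a i) ^ (e i : ℕ)) ''
        {e | ∑ i, (e i : ℕ) = n}) := by
  classical
  let _ := assocGrCommRing hc
  refine symb_mem (fun n => Submodule.span (ZMod p)
      ((fun e : ι → Fin q => ∏ i, symbOne (ZMod p) (a i) ^ (e i : ℕ)) ''
        {e | ∑ i, (e i : ℕ) = n})) ?_ ?_ n x hx
  · refine Submodule.subset_span ⟨fun _ => 0, by simp, by simp⟩
  · intro n g b hb
    change symbOne (ZMod p) g * b ∈ _
    rw [hcg, Finset.sum_mul]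
    refine sum_mem fun i _ => ?_
    rw [smul_mul_assoc]
    refine Submodule.smul_mem _ _ ?_
    refine Submodule.span_induction
      (p := fun b _ => symbOne (ZMod p) (a i) * b ∈ Submodule.span (ZMod p)
        ((fun e : ι → Fin q => ∏ i, symbOne (ZMod p) (a i) ^ (e i : ℕ)) ''
          {e | ∑ i, (e i : ℕ) = n + 1}))
      ?_ ?_ ?_ ?_ hb
    · rintro _ ⟨e, he, rfl⟩
      have hprod : symbOne (ZMod p) (a i) * ∏ j, symbOne (ZMod p) (a j) ^ (e j : ℕ) =
          symbOne (ZMod p) (a i) ^ ((e i : ℕ) + 1) *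
            ∏ j ∈ Finset.univ.erase i, symbOne (ZMod p) (a j) ^ (e j : ℕ) := by
        rw [← Finset.mul_prod_erase _ _ (Finset.mem_univ i), ← mul_assoc, pow_succ']
      dsimp only
      rw [hprod]
      -- Either the raised exponent is still admissible, or it equals `q` and the monomial vanishes.
      by_cases hi : (e i : ℕ) + 1 < q
      · refine Submodule.subset_span ⟨Function.update e i ⟨e i + 1, hi⟩, ?_, ?_⟩
        · have he' : ∑ i, (e i : ℕ) = n := he
          change ∑ j, (Function.update e i ⟨e i + 1, hi⟩ j : ℕ) = n + 1
          rw [← he', ← Finset.add_sum_erase _ _ (Finset.mem_univ i),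
            ← Finset.add_sum_erase Finset.univ (fun i => (e i : ℕ)) (Finset.mem_univ i),
            Function.update_self, Finset.sum_congr rfl fun j hj => by
              rw [Function.update_of_ne (Finset.ne_of_mem_erase hj)]]
          exact Nat.add_right_comm _ _ _
        · dsimp only
          rw [← Finset.mul_prod_erase _ _ (Finset.mem_univ i), Function.update_self]
          congr 1
          refine Finset.prod_congr rfl fun j hj => ?_
          rw [Function.update_of_ne (Finset.ne_of_mem_erase hj)]
      · have : (e i : ℕ) + 1 = q := by have := (e i).2; omega
        rw [this, haq, zero_mul]
        exact zero_mem _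
    · rw [mul_zero]; exact zero_mem _
    · intro x y _ _ hx hy
      rw [mul_add]; exact add_mem hx hy
    · intro r x _ hx
      rw [mul_smul_comm]; exact Submodule.smul_mem _ _ hx

/-- If the group algebra of a finite `p`-group has the dimension of a truncated polynomial algebra
`𝔽_p[X_i] / (X_i ^ q)` and its associated graded algebra is a quotient of it, then the powers
`X_i ^ k`, `k < q`, are linearly independent in the associated graded algebra. -/
theorem coeff_eq_zero_of_sum_symbOne_pow_eq_zero (hQ : IsPGroup p Q)
    (hc : ∀ x y : Q, x * y * x⁻¹ * y⁻¹ ∈ dimensionSubgroup (ZMod p) Q 3)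
    (a : ι → Q) (c : Q → ι → ZMod p)
    (hcg : ∀ g, symbOne (ZMod p) g = ∑ i, c g i • symbOne (ZMod p) (a i))
    {q : ℕ} (haq : ∀ i, symbOne (ZMod p) (a i) ^ q = 0)
    (hcard : Nat.card Q = q ^ Fintype.card ι) {k : ℕ} (hk0 : 0 < k) (hk : k < q)
    (z : ι → ZMod p) (hz : ∑ i, z i • symbOne (ZMod p) (a i) ^ k = 0) : z = 0 := by
  classical
  have : NeZero q := ⟨by omega⟩
  let _ := assocGrCommRing hc
  let A := MonoidAlgebra (ZMod p) Q
  let w : (ι → Fin q) → ℕ := fun e => ∑ i, (e i : ℕ)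
  have hF := fun e : ι → Fin q => exists_symb_eq_prod (R := ZMod p) hc a (fun i => (e i : ℕ))
    Finset.univ
  choose F hFm hFs using hF
  -- `F e` is a lift of the monomial with exponents `e`, of weight `w e`. The aim is that `ω ^ n`
  -- lies in the span `T n` of the lifts of weight at least `n`.
  let T : ℕ → Submodule (ZMod p) A := fun n => Submodule.span (ZMod p) (F '' {e | n ≤ w e})
  have hTle : ∀ n, T (n + 1) ≤ T n := fun n =>
    Submodule.span_mono (Set.image_mono fun e (he : n + 1 ≤ w e) => (Nat.le_succ n).trans he)
  have hT : ∀ n x, x ∈ augmentationIdeal (ZMod p) Q ^ n → x ∈ T n := by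
    -- Descending induction from an `N` with `ω ^ N = 0`: subtracting a combination of lifts with
    -- the same symbol moves an element of `ω ^ n` into `ω ^ (n + 1)`.
    obtain ⟨N, hN⟩ := exists_augmentationIdeal_pow_eq_bot hQ
    have hbig : ∀ n, N ≤ n → ∀ x, x ∈ augmentationIdeal (ZMod p) Q ^ n → x ∈ T n := by
      intro n hn x hx
      have hx0 := aug_of_le hn hx
      rw [hN, Submodule.mem_bot] at hx0
      rw [hx0]
      exact zero_mem _
    have hstep : ∀ n, (∀ x, x ∈ augmentationIdeal (ZMod p) Q ^ (n + 1) → x ∈ T (n + 1)) →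
        ∀ x, x ∈ augmentationIdeal (ZMod p) Q ^ n → x ∈ T n := by
      intro n ih x hx
      have hspan := symb_mem_span_monomials hc a c hcg haq n x hx
      have hlift : ∃ y ∈ T n, ∃ hy, symb n y hy = symb n x hx := by
        refine Submodule.span_induction
          (p := fun b _ => ∃ y ∈ T n, ∃ hy, symb n y hy = b) ?_ ?_ ?_ ?_ hspan
        · rintro _ ⟨e, he, rfl⟩
          have he' : w e = n := he
          subst he'
          exact ⟨F e, Submodule.subset_span ⟨e, le_refl (w e), rfl⟩, hFm e, hFs e⟩
        · exact ⟨0, zero_mem _, zero_mem _, symb_zero n⟩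
        · rintro _ _ _ _ ⟨y, hy, hy', rfl⟩ ⟨y₂, hy₂, hy₂', rfl⟩
          exact ⟨_, add_mem hy hy₂, add_mem hy' hy₂', symb_add _ _⟩
        · rintro r _ _ ⟨y, hy, hy', rfl⟩
          exact ⟨_, Submodule.smul_mem _ r hy, smul_mem_aug_pow r hy', symb_smul r hy'⟩
      obtain ⟨y, hyT, hy, e⟩ := hlift
      have h0 : symb n (x - y) (sub_mem hx hy) = 0 := by rw [symb_sub hx hy, e, sub_self]
      have h1 := hTle n (ih _ ((symb_eq_zero_iff _).1 h0))
      have := add_mem h1 hyT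
      rwa [sub_add_cancel] at this
    have hall : ∀ j n, N ≤ n + j →
        ∀ x, x ∈ augmentationIdeal (ZMod p) Q ^ n → x ∈ T n := by
      intro j
      induction j with
      | zero => exact fun n hn => hbig n hn
      | succ j ih => exact fun n hn => hstep n (ih (n + 1) (by omega))
    exact fun n => hall N n (by omega)
  have hfin : Module.finrank (ZMod p) A = Nat.card Q := by
    have := Fintype.ofFinite Q
    rw [Nat.card_eq_fintype_card]
    exact Module.finrank_eq_card_basis (MonoidAlgebra.basis Q (ZMod p))
  -- The case `n = 0` says that the `q ^ |ι|` lifts span the group algebra, whose dimension is also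
  -- `q ^ |ι|`.
  have hli : LinearIndependent (ZMod p) F := by
    refine linearIndependent_of_top_le_span_of_card_eq_finrank ?_ ?_
    · intro x _
      exact Submodule.span_mono (Set.image_subset_range _ _) (hT 0 x (mem_aug_pow_zero x))
    · rw [hfin, hcard, Fintype.card_fun, Fintype.card_fin]
  -- `ε i` is the exponent vector of `X_i ^ k`. Positivity of `k` makes these vectors distinct, and
  -- `k < q` makes them admissible.
  let ε : ι → ι → Fin q := fun i j => if j = i then ⟨k, hk⟩ else 0
  have hεw : ∀ i, w (ε i) = k := by
    intro i
    have : ∀ j, (ε i j : ℕ) = if j = i then k else 0 := by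
      intro j
      dsimp only [ε]
      split_ifs <;> rfl
    simp only [w, this, Finset.sum_ite_eq', Finset.mem_univ, if_true]
  have hεinj : Function.Injective ε := by
    intro i j h
    by_contra hne
    have h1 := congrArg Fin.val (congrFun h i)
    dsimp only [ε] at h1
    rw [if_pos rfl, if_neg hne] at h1
    exact hk0.ne' h1
  have hεF : ∀ i, ∃ h, symb k (F (ε i)) h = symbOne (ZMod p) (a i) ^ k := by
    intro i
    have hm : F (ε i) ∈ augmentationIdeal (ZMod p) Q ^ k := by
      have := hFm (ε i)
      change _ ∈ _ ^ w (ε i) at this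
      rwa [hεw] at this
    refine ⟨hm, ?_⟩
    refine ((symb_congr (hεw i).symm _ (hFm (ε i)) (by rw [sub_self]; exact zero_mem _)).trans
      (hFs (ε i))).trans ?_
    rw [Finset.prod_eq_single i]
    · dsimp only [ε]
      rw [if_pos rfl]
    · intro j _ hj
      dsimp only [ε]
      rw [if_neg hj, Fin.val_zero, pow_zero]
    · exact fun h => absurd (Finset.mem_univ i) h
  choose hεm hεs using hεF
  have hsum : ∀ s : Finset ι, ∃ h, symb k (∑ i ∈ s, z i • F (ε i)) h =
      ∑ i ∈ s, z i • symbOne (ZMod p) (a i) ^ k := by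
    intro s
    induction s using Finset.induction_on with
    | empty => exact ⟨zero_mem _, symb_zero k⟩
    | insert i s hi ih =>
      obtain ⟨h, e⟩ := ih
      have hm := smul_mem_aug_pow (z i) (hεm i)
      refine ⟨by rw [Finset.sum_insert hi]; exact add_mem hm h, ?_⟩
      refine (symb_congr rfl _ (add_mem hm h)
        (by rw [Finset.sum_insert hi, sub_self]; exact zero_mem _)).trans ?_
      rw [symb_add hm h, symb_smul (z i) (hεm i), hεs, e, Finset.sum_insert hi]
  obtain ⟨hm, e⟩ := hsum Finset.univ
  rw [hz, symb_eq_zero_iff] at e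
  -- The symbol of the combination in degree `k` is zero, so the combination is spanned by lifts of
  -- weight above `k`. It is also spanned by lifts of weight exactly `k`, and independence leaves
  -- only `0`.
  have h1 := hT _ _ e
  have h2 : ∑ i, z i • F (ε i) ∈ Submodule.span (ZMod p) (F '' {e | w e = k}) :=
    sum_mem fun i _ => Submodule.smul_mem _ _ (Submodule.subset_span ⟨ε i, hεw i, rfl⟩)
  have hdisj : Disjoint {e | w e = k} {e | k + 1 ≤ w e} :=
    Set.disjoint_left.2 fun e (he : w e = k) (he' : k + 1 ≤ w e) => by omega
  have h0 := (Submodule.disjoint_def.1 (hli.disjoint_span_image hdisj)) _ h2 h1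
  exact funext (Fintype.linearIndependent_iff.1 (hli.comp ε hεinj) z h0)

end MonomialCount

/-! ### Ideals containing all brackets, and additivity of the `p`-map modulo them -/

section RestrictedIdeal

variable {p : ℕ} {F : Type v} [Field F] {L : Type u} [LieRing L] [LieAlgebra F L]

/-- For `m ≠ 0` each coefficient is a bracket or a sum of two. For `m = 0` this fails, as the
coefficient at `k = 0` is `x`. -/
theorem adCoeff_mem_of_lie_mem {I : LieIdeal F L} (hI : ∀ x y : L, ⁅x, y⁆ ∈ I) (x y : L)
    {m : ℕ} (hm : m ≠ 0) (k : ℕ) : adCoeff x y m k ∈ I := by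
  obtain ⟨m, rfl⟩ := Nat.exists_eq_succ_of_ne_zero hm
  cases k with
  | zero => exact hI _ _
  | succ k => exact add_mem (hI _ _) (hI _ _)

variable [RestrictedLieAlgebra p F L]

/-- The correction terms in Jacobson's formula use `adCoeff` at `p - 1 ≥ 1`, so they are sums of
brackets. -/
theorem pmap_add_sub_mem (hp : 2 ≤ p) {I : LieIdeal F L} (hI : ∀ x y : L, ⁅x, y⁆ ∈ I) (x y : L) :
    RestrictedLieAlgebra.pmap p F (x + y) -
      (RestrictedLieAlgebra.pmap p F x + RestrictedLieAlgebra.pmap p F y) ∈ I := by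
  rw [RestrictedLieAlgebra.pmap_add, add_sub_cancel_left]
  refine sum_mem fun k _ => I.smul_mem _ ?_
  exact adCoeff_mem_of_lie_mem hI x y (by omega) _

/-- A Lie ideal closed under the `p`-map that contains all brackets of generators of a
restrictification contains all brackets. -/
theorem Restrictification.lie_mem {M : Type u} [LieRing M] [LieAlgebra F M] (hp : p ≠ 0)
    {I : LieIdeal F (Restrictification p F M)}
    (h : ∀ x y : M, of p F M ⁅x, y⁆ ∈ I) (x y : Restrictification p F M) : ⁅x, y⁆ ∈ I := by
  have hcomm : ∀ a b : Restrictification p F M, ⁅a, b⁆ ∈ I → ⁅b, a⁆ ∈ I := by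
    intro a b hab
    rw [← lie_skew]
    exact neg_mem hab
  -- Induction on the formal expression in the left slot reduces it to a generator, the right slot
  -- being fixed; with antisymmetry this is used once for each slot.
  have hgen : ∀ z : Restrictification p F M, (∀ m : M, ⁅of p F M m, z⁆ ∈ I) →
      ∀ x : RTerm F M, ⁅(mk x : Restrictification p F M), z⁆ ∈ I := by
    intro z hz x
    induction x with
    | of m => exact hz m
    | zero =>
      change ⁅(0 : Restrictification p F M), z⁆ ∈ I
      rw [zero_lie]; exact zero_mem _
    | add x y hx hy =>
      change ⁅(mk x + mk y : Restrictification p F M), z⁆ ∈ I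
      rw [add_lie]; exact add_mem hx hy
    | neg x hx =>
      change ⁅(-mk x : Restrictification p F M), z⁆ ∈ I
      rw [neg_lie]; exact neg_mem hx
    | smul a x hx =>
      change ⁅(a • mk x : Restrictification p F M), z⁆ ∈ I
      rw [smul_lie]; exact I.smul_mem a hx
    | lie x y hx hy =>
      change ⁅⁅(mk x : Restrictification p F M), (mk y : Restrictification p F M)⁆, z⁆ ∈ I
      rw [lie_lie]
      exact sub_mem (lie_mem_right F _ I _ _ hy) (lie_mem_right F _ I _ _ hx)
    | pmap x hx =>
      change ⁅RestrictedLieAlgebra.pmap p F (mk x : Restrictification p F M), z⁆ ∈ I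
      rw [RestrictedLieAlgebra.lie_pmap]
      -- Bracketing with a `p`-map is `ad ^ p`. Since `p ≠ 0`, at least one bracket with `x` occurs,
      -- and the induction hypothesis covers the innermost one.
      have : ∀ n, n ≠ 0 → (LieAlgebra.ad F (Restrictification p F M) (mk x) ^ n) z ∈ I := by
        intro n hn
        obtain ⟨n, rfl⟩ := Nat.exists_eq_succ_of_ne_zero hn
        induction n with
        | zero => simpa using hx
        | succ n ih =>
          rw [pow_succ', Module.End.mul_apply, LieAlgebra.ad_apply]
          exact lie_mem_right F _ I _ _ (ih (Nat.succ_ne_zero n))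
      exact this p hp
  revert x
  refine ind (hgen y fun m => hcomm _ _ ?_)
  revert y
  refine ind (hgen _ fun m' => ?_)
  rw [← LieHom.map_lie]
  exact h m' m

end RestrictedIdeal

/-! ### The restrictification modulo degrees at least two, and the kernel of `θ̂` -/

section ThetaKernel

variable {p : ℕ} [hp : Fact p.Prime] {G : Type u} [Group G]

theorem mem_gammaSeries_one (g : G) : g ∈ (gammaSeries G).term 1 := Subgroup.mem_top g

theorem mem_dimensionSeries_one (g : G) : g ∈ (dimensionSeries (ZMod p) G).term 1 := by
  rw [dimensionSeries_one]; exact Subgroup.mem_top g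

/-- The element `g γ_2(G) ⊗ 1` of degree `1`. -/
noncomputable def magnusModOne (p : ℕ) [Fact p.Prime] {G : Type u} [Group G] (g : G) : MagnusLieMod p G :=
  (1 : ZMod p) ⊗ₜ (gammaSeries G).cls 1 g (mem_gammaSeries_one g)

theorem magnusModOne_mul (g h : G) :
    magnusModOne p (g * h) = magnusModOne p g + magnusModOne p h := by
  rw [magnusModOne, (gammaSeries G).cls_mul 1 (mem_gammaSeries_one g) (mem_gammaSeries_one h),
    TensorProduct.tmul_add]
  rfl

theorem magnusModOne_one : magnusModOne p (1 : G) = 0 := by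
  have h := magnusModOne_mul (p := p) (1 : G) 1
  rw [mul_one] at h
  exact left_eq_add.1 h

theorem magnusModOne_pow (g : G) (n : ℕ) : magnusModOne p (g ^ n) = n • magnusModOne p g := by
  induction n with
  | zero => rw [pow_zero, magnusModOne_one, zero_smul]
  | succ n ih => rw [pow_succ, magnusModOne_mul, ih, succ_nsmul]

/-- This is the only source of vanishing in degree one that the kernel computation needs. -/
theorem magnusModOne_pow_prime (g : G) : magnusModOne p (g ^ p) = 0 := by
  rw [magnusModOne_pow, ← Nat.cast_smul_eq_nsmul (ZMod p), CharP.cast_eq_zero, zero_smul]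

/-- The degree-one part is `G / γ_2 ⊗ 𝔽_p`, in which scalars of the prime field are absorbed into
powers of `g`. Hence one group element is enough, even for a sum. -/
theorem exists_sub_magnusModOne_mem (x : MagnusLieMod p G) :
    ∃ g : G, x - magnusModOne p g ∈ magnusModGeTwo p G := by
  induction x using TensorProduct.induction_on with
  | zero => exact ⟨1, by rw [magnusModOne_one, sub_zero]; exact zero_mem _⟩
  | add x y hx hy =>
    obtain ⟨g, hg⟩ := hx
    obtain ⟨h, hh⟩ := hy
    refine ⟨g * h, ?_⟩
    rw [magnusModOne_mul, add_sub_add_comm]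
    exact add_mem hg hh
  | tmul a x =>
    induction x using CentralSeries.gr_induction with
    | h0 => exact ⟨1, by rw [magnusModOne_one, TensorProduct.tmul_zero, sub_zero]; exact zero_mem _⟩
    | h1 n g hg =>
      by_cases hn : n = 1
      · subst hn
        refine ⟨g ^ a.val, ?_⟩
        rw [magnusModOne_pow, magnusModOne, ← Nat.cast_smul_eq_nsmul (ZMod p),
          ZMod.natCast_zmod_val, TensorProduct.smul_tmul', smul_eq_mul, mul_one, sub_self]
        exact zero_mem _
      · refine ⟨1, ?_⟩
        rw [magnusModOne_one, sub_zero]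
        refine Submodule.tmul_mem_baseChange_of_mem a ?_
        rw [magnusGeTwo, LinearMap.mem_ker]
        exact DirectSum.of_eq_of_ne _ _ _ (Ne.symm hn)
    | h2 x y hx hy =>
      obtain ⟨g, hg⟩ := hx
      obtain ⟨h, hh⟩ := hy
      refine ⟨g * h, ?_⟩
      rw [magnusModOne_mul, TensorProduct.tmul_add, add_sub_add_comm]
      exact add_mem hg hh

/-- A bracket of homogeneous elements of degrees `i, j ≥ 1` has degree `i + j ≥ 2`. -/
theorem lie_mem_magnusModGeTwo (x y : MagnusLieMod p G) : ⁅x, y⁆ ∈ magnusModGeTwo p G := by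
  have hgr : ∀ x y : MagnusLie G, ⁅x, y⁆ ∈ magnusGeTwo G := by
    intro x y
    induction x using CentralSeries.gr_induction with
    | h0 => rw [zero_lie]; exact zero_mem _
    | h2 x x' hx hx' => rw [add_lie]; exact add_mem hx hx'
    | h1 i g hg =>
      induction y using CentralSeries.gr_induction with
      | h0 => rw [lie_zero]; exact zero_mem _
      | h2 x x' hx hx' => rw [lie_add]; exact add_mem hx hx'
      | h1 j h hh =>
        rw [CentralSeries.cls_lie_cls, magnusGeTwo, LinearMap.mem_ker]
        refine DirectSum.of_eq_of_ne _ _ _ ?_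
        intro e
        have h1 := congrArg PNat.val e
        have := i.pos
        have := j.pos
        rw [PNat.add_coe, PNat.one_coe] at h1
        omega
  induction x using TensorProduct.induction_on with
  | zero => rw [zero_lie]; exact zero_mem _
  | add x x' hx hx' => rw [add_lie]; exact add_mem hx hx'
  | tmul a x =>
    induction y using TensorProduct.induction_on with
    | zero => rw [lie_zero (L := MagnusLieMod p G)]; exact zero_mem _
    | add y y' hy hy' => rw [lie_add (L := MagnusLieMod p G)]; exact add_mem hy hy'
    | tmul b y =>
      rw [LieAlgebra.ExtendScalars.bracket_tmul]
      exact Submodule.tmul_mem_baseChange_of_mem _ (hgr x y)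

/-- The power `p ^ k` as a positive integer. -/
def primePow (p : ℕ) [hp : Fact p.Prime] (k : ℕ) : ℕ+ := ⟨p ^ k, pow_pos hp.out.pos k⟩

theorem primePow_coe (k : ℕ) : (primePow p k : ℕ) = p ^ k := rfl

/-- The iterated `p`-map of an element of degree `1` of the restrictification. -/
noncomputable def magnusPow (p : ℕ) [Fact p.Prime] {G : Type u} [Group G] (k : ℕ) (g : G) :
    Restrictification p (ZMod p) (MagnusLieMod p G) :=
  (RestrictedLieAlgebra.pmap p (ZMod p))^[k]
    (Restrictification.of p (ZMod p) (MagnusLieMod p G) (magnusModOne p g))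

theorem magnusPow_succ (k : ℕ) (g : G) :
    magnusPow p (k + 1) g = RestrictedLieAlgebra.pmap p (ZMod p) (magnusPow p k g) :=
  Function.iterate_succ_apply' _ _ _

theorem pmap_zero {L : Type*} [LieRing L] [LieAlgebra (ZMod p) L]
    [RestrictedLieAlgebra p (ZMod p) L] :
    RestrictedLieAlgebra.pmap p (ZMod p) (0 : L) = 0 := by
  have h := RestrictedLieAlgebra.pmap_smul (p := p) (F := ZMod p) 0 (0 : L)
  rwa [zero_smul, zero_pow hp.out.ne_zero, zero_smul] at h

theorem magnusPow_eq_zero (k : ℕ) {g : G} (hg : magnusModOne p g = 0) : magnusPow p k g = 0 := by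
  induction k with
  | zero => rw [magnusPow, Function.iterate_zero, id_eq, hg, map_zero]
  | succ k ih => rw [magnusPow_succ, ih, pmap_zero]

/-- `θ̂` commutes with the `p`-maps, and that of the Zassenhaus algebra is induced by `x ↦ x ^ p`,
multiplying degrees by `p`. -/
theorem thetaHat_magnusPow (k : ℕ) (g : G) :
    ∃ h, thetaHat p G (magnusPow p k g) =
      (dimensionSeries (ZMod p) G).cls (primePow p k) (g ^ p ^ k) h := by
  induction k with
  | zero =>
    have h1 : g ^ p ^ 0 = g := by rw [pow_zero, pow_one]
    refine ⟨by rw [h1]; exact mem_dimensionSeries_one g, ?_⟩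
    have h2 : thetaHat p G (magnusPow p 0 g) = theta p G (magnusModOne p g) := rfl
    rw [h2, magnusModOne, theta_tmul, one_smul, rho, CentralSeries.map_cls]
    exact congrArg _ (CentralSeries.layerMk_congr _ h1.symm _ _)
  | succ k ih =>
    obtain ⟨h, e⟩ := ih
    have hm : (primePow p (k + 1) : ℕ) =
        primePow p k * p := pow_succ p k
    have e1 : (g ^ p ^ k) ^ p = g ^ p ^ (k + 1) := by rw [← pow_mul, ← pow_succ]
    refine ⟨e1 ▸ pow_mem_dimensionSeries hm h, ?_⟩
    rw [magnusPow_succ, thetaHat, Restrictification.lift_pmap]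
    rw [thetaHat] at e
    rw [e, zassenhaus_pmap_cls (p := p) (G := G) hm h]
    exact congrArg _ (CentralSeries.layerMk_congr _ e1 _ _)

/-- The restricted ideal generated by the part of degree at least `2`. -/
noncomputable abbrev magnusIdeal (p : ℕ) [Fact p.Prime] (G : Type u) [Group G] :
    LieIdeal (ZMod p) (Restrictification p (ZMod p) (MagnusLieMod p G)) :=
  restrictedIdealSpan p (ZMod p)
    (Restrictification.of p (ZMod p) (MagnusLieMod p G) '' (magnusModGeTwo p G))

/-- So the quotient by this ideal is abelian and its `p`-map is additive. -/
theorem lie_mem_magnusIdeal (x y : Restrictification p (ZMod p) (MagnusLieMod p G)) :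
    ⁅x, y⁆ ∈ magnusIdeal p G :=
  Restrictification.lie_mem hp.out.ne_zero
    (fun a b => subset_restrictedIdealSpan _ (Set.mem_image_of_mem _ (lie_mem_magnusModGeTwo a b))) x y

/-- Additivity modulo the ideal, applied to `x = (x - y) + y`: the `p`-map descends to the quotient.
-/
theorem pmap_sub_pmap_mem_magnusIdeal {x y : Restrictification p (ZMod p) (MagnusLieMod p G)}
    (h : x - y ∈ magnusIdeal p G) :
    RestrictedLieAlgebra.pmap p (ZMod p) x - RestrictedLieAlgebra.pmap p (ZMod p) y ∈
      magnusIdeal p G := by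
  have h1 := pmap_add_sub_mem hp.out.two_le (lie_mem_magnusIdeal (p := p) (G := G)) (x - y) y
  rw [sub_add_cancel] at h1
  have h2 := add_mem h1 (pmap_mem_restrictedIdealSpan h)
  convert h2 using 1
  abel

theorem magnusPow_mul (k : ℕ) (g h : G) :
    magnusPow p k (g * h) - (magnusPow p k g + magnusPow p k h) ∈ magnusIdeal p G := by
  induction k with
  | zero =>
    rw [magnusPow, magnusPow, magnusPow, Function.iterate_zero, id_eq, id_eq, id_eq, magnusModOne_mul,
      map_add, sub_self]
    exact zero_mem _
  | succ k ih =>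
    have h1 := pmap_sub_pmap_mem_magnusIdeal ih
    have h2 := pmap_add_sub_mem hp.out.two_le (lie_mem_magnusIdeal (p := p) (G := G))
      (magnusPow p k g) (magnusPow p k h)
    rw [← magnusPow_succ] at h1
    rw [← magnusPow_succ, ← magnusPow_succ] at h2
    have := add_mem h1 h2
    rwa [sub_add_sub_cancel] at this

theorem magnusPow_one (k : ℕ) : magnusPow p k (1 : G) = 0 :=
  magnusPow_eq_zero k magnusModOne_one

/-- Modulo the ideal generated by the part of degree at least `2`, the restrictification is spanned
by iterated `p`-th powers of elements of degree `1`. -/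
theorem exists_sub_sum_magnusPow_mem (x : Restrictification p (ZMod p) (MagnusLieMod p G)) :
    ∃ v : ℕ → G, ∃ N : ℕ, ∀ n, N ≤ n →
      x - ∑ k ∈ Finset.range n, magnusPow p k (v k) ∈ magnusIdeal p G := by
  -- Asking for the congruence at all large lengths `n` allows two sums to be compared at a common
  -- length. The sequences are multiplied termwise, by `magnusPow_mul`.
  have hadd : ∀ x y : Restrictification p (ZMod p) (MagnusLieMod p G),
      (∃ v : ℕ → G, ∃ N : ℕ, ∀ n, N ≤ n →
        x - ∑ k ∈ Finset.range n, magnusPow p k (v k) ∈ magnusIdeal p G) →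
      (∃ v : ℕ → G, ∃ N : ℕ, ∀ n, N ≤ n →
        y - ∑ k ∈ Finset.range n, magnusPow p k (v k) ∈ magnusIdeal p G) →
      ∃ v : ℕ → G, ∃ N : ℕ, ∀ n, N ≤ n →
        x + y - ∑ k ∈ Finset.range n, magnusPow p k (v k) ∈ magnusIdeal p G := by
    rintro x y ⟨v, N, hv⟩ ⟨w, M, hw⟩
    refine ⟨fun k => v k * w k, max N M, fun n hn => ?_⟩
    have h1 := hv n (le_of_max_le_left hn)
    have h2 := hw n (le_of_max_le_right hn)
    have h3 : ∑ k ∈ Finset.range n, (magnusPow p k (v k * w k) -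
        (magnusPow p k (v k) + magnusPow p k (w k))) ∈ magnusIdeal p G :=
      sum_mem fun k _ => magnusPow_mul k _ _
    rw [Finset.sum_sub_distrib, Finset.sum_add_distrib] at h3
    have := sub_mem (add_mem h1 h2) h3
    convert this using 1
    abel
  have hzero : ∃ v : ℕ → G, ∃ N : ℕ, ∀ n, N ≤ n →
      (0 : Restrictification p (ZMod p) (MagnusLieMod p G)) -
        ∑ k ∈ Finset.range n, magnusPow p k (v k) ∈ magnusIdeal p G := by
    refine ⟨fun _ => 1, 0, fun n _ => ?_⟩
    rw [Finset.sum_eq_zero fun k _ => magnusPow_one k, sub_zero]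
    exact zero_mem _
  have hnsmul : ∀ x : Restrictification p (ZMod p) (MagnusLieMod p G),
      (∃ v : ℕ → G, ∃ N : ℕ, ∀ n, N ≤ n →
        x - ∑ k ∈ Finset.range n, magnusPow p k (v k) ∈ magnusIdeal p G) →
      ∀ a : ZMod p, ∃ v : ℕ → G, ∃ N : ℕ, ∀ n, N ≤ n →
        a • x - ∑ k ∈ Finset.range n, magnusPow p k (v k) ∈ magnusIdeal p G := by
    intro x hx a
    -- A scalar of the prime field acts as a natural multiple, that is, by repeated addition.
    rw [← ZMod.natCast_zmod_val a, Nat.cast_smul_eq_nsmul]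
    induction a.val with
    | zero => rw [zero_smul]; exact hzero
    | succ m ih => rw [succ_nsmul]; exact hadd _ _ ih hx
  revert x
  refine Restrictification.ind fun x => ?_
  induction x with
  | of m =>
    obtain ⟨g, hg⟩ := exists_sub_magnusModOne_mem m
    refine ⟨fun k => if k = 0 then g else 1, 1, fun n hn => ?_⟩
    rw [Finset.sum_eq_single_of_mem 0 (Finset.mem_range.2 hn)
      (fun k _ hk => by dsimp only; rw [if_neg hk, magnusPow_one])]
    dsimp only
    rw [if_pos rfl]
    refine subset_restrictedIdealSpan _ ⟨_, hg, ?_⟩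
    rw [map_sub]
    rfl
  | zero => exact hzero
  | add x y hx hy => exact hadd _ _ hx hy
  | neg x hx =>
    have := hnsmul _ hx (-1)
    rwa [neg_smul, one_smul] at this
  | smul a x hx => exact hnsmul _ hx a
  | lie x y _ _ =>
    obtain ⟨v, N, h⟩ := hzero
    refine ⟨v, N, fun n hn => ?_⟩
    have := add_mem (lie_mem_magnusIdeal (p := p) (G := G) (Restrictification.mk x)
      (Restrictification.mk y)) (h n hn)
    rwa [zero_sub, ← sub_eq_add_neg] at this
  | pmap x hx =>
    obtain ⟨v, N, hv⟩ := hx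
    -- The `p`-map raises every order of iteration by one, so the sequence is shifted and its vacant
    -- entry at `0` is filled by `1`.
    refine ⟨fun k => if k = 0 then 1 else v (k - 1), N + 1, fun n hn => ?_⟩
    obtain ⟨n, rfl⟩ : ∃ m, n = m + 1 := ⟨n - 1, by omega⟩
    have h1 := pmap_sub_pmap_mem_magnusIdeal (hv n (by omega))
    rw [Finset.sum_range_succ']
    dsimp only
    rw [if_pos rfl, magnusPow_one, add_zero]
    simp only [Nat.succ_ne_zero, if_false, Nat.add_sub_cancel]
    have h2 : ∀ s : Finset ℕ, RestrictedLieAlgebra.pmap p (ZMod p) (∑ k ∈ s, magnusPow p k (v k)) -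
        ∑ k ∈ s, magnusPow p (k + 1) (v k) ∈ magnusIdeal p G := by
      intro s
      induction s using Finset.induction_on with
      | empty =>
        rw [Finset.sum_empty, Finset.sum_empty, pmap_zero, sub_zero]
        exact zero_mem _
      | insert i s hi ih =>
        rw [Finset.sum_insert hi, Finset.sum_insert hi]
        have h3 := add_mem (pmap_add_sub_mem hp.out.two_le (lie_mem_magnusIdeal (p := p) (G := G))
          (magnusPow p i (v i)) (∑ k ∈ s, magnusPow p k (v k))) ih
        convert h3 using 1
        rw [magnusPow_succ]
        abel
    have := add_mem h1 (h2 (Finset.range n))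
    rwa [sub_add_sub_cancel] at this

/-- Commutators start one step deeper than their weight, in `D_3` instead of `D_2`, and commutation
with `G = D_1` preserves this gain. -/
theorem gammaSeries_succ_le
    (h : ∀ x y : G, x * y * x⁻¹ * y⁻¹ ∈ dimensionSubgroup (ZMod p) G 3) (n : ℕ+) :
    (gammaSeries G).term (n + 1) ≤ (dimensionSeries (ZMod p) G).term (n + 1 + 1) := by
  have e : ∀ n : ℕ+, (gammaSeries G).term (n + 1) = ⁅(gammaSeries G).term n, ⊤⁆ := by
    intro n
    change Subgroup.lowerCentralSeries ⊤ (n + 1).natPred = _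
    rw [show (n + 1).natPred = n.natPred + 1 by
      rw [PNat.natPred_add_one]; rfl]
    rfl
  induction n with
  | one =>
    rw [e, Subgroup.commutator_le]
    exact fun x _ y _ => h x y
  | succ n ih =>
    rw [e, ← dimensionSeries_one (ZMod p) G]
    exact (Subgroup.commutator_mono ih le_rfl).trans
      ((dimensionSeries (ZMod p) G).commutator_le (n + 1 + 1) 1)

theorem theta_eq_zero_of_mem_magnusModGeTwo
    (h : ∀ x y : G, x * y * x⁻¹ * y⁻¹ ∈ dimensionSubgroup (ZMod p) G 3) {x : MagnusLieMod p G}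
    (hx : x ∈ magnusModGeTwo p G) : theta p G x = 0 := by
  -- `ρ` factors through the projection to degree one, because `γ_n ≤ D_{n+1}` for `n ≥ 2`.
  have hrho : ∀ y : MagnusLie G, rho p G y =
      rho p G ((gammaSeries G).incl 1 ((gammaSeries G).proj 1 y)) := by
    intro y
    induction y using CentralSeries.gr_induction with
    | h0 => rw [map_zero, map_zero, map_zero, map_zero]
    | h2 x y hx hy => rw [map_add, hx, hy, map_add, map_add, map_add]
    | h1 n g hg =>
      by_cases hn : n = 1
      · subst hn
        exact congrArg (fun t => rho p G ((gammaSeries G).incl 1 t)) (DirectSum.of_eq_same _ _).symm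
      · have h0 : (gammaSeries G).proj 1 ((gammaSeries G).cls n g hg) = 0 :=
          DirectSum.of_eq_of_ne _ _ _ (Ne.symm hn)
        obtain ⟨m, rfl⟩ := PNat.exists_eq_succ_of_ne_one hn
        rw [h0, map_zero, map_zero, rho, CentralSeries.map_cls]
        exact CentralSeries.cls_eq_zero _ _ (gammaSeries_succ_le h m hg)
  rw [magnusModGeTwo, Submodule.baseChange_eq_span] at hx
  refine Submodule.span_induction (p := fun x _ => theta p G x = 0) ?_ ?_ ?_ ?_ hx
  · rintro _ ⟨y, hy, rfl⟩
    have hy0 : (gammaSeries G).proj 1 y = 0 := hy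
    change theta p G ((1 : ZMod p) ⊗ₜ y) = 0
    rw [theta_tmul, hrho, hy0, map_zero, map_zero, smul_zero]
  · exact map_zero _
  · intro x y _ _ hx hy
    rw [map_add, hx, hy, add_zero]
  · intro a x _ hx
    rw [map_smul, hx, smul_zero]

/-- The kernel of `θ̂` is a Lie ideal closed under the `p`-map, and it contains the generators
because `θ` kills them. -/
theorem magnusIdeal_le_ker
    (h : ∀ x y : G, x * y * x⁻¹ * y⁻¹ ∈ dimensionSubgroup (ZMod p) G 3) :
    magnusIdeal p G ≤ (thetaHat p G).ker := by
  intro x hx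
  refine (mem_restrictedIdealSpan _ _).1 hx (thetaHat p G).ker ?_ ?_
  · rintro _ ⟨y, hy, rfl⟩
    exact LieHom.mem_ker.2 (theta_eq_zero_of_mem_magnusModGeTwo h hy)
  · intro y hy
    rw [LieHom.mem_ker] at hy ⊢
    rw [thetaHat, Restrictification.lift_pmap]
    rw [thetaHat] at hy
    rw [hy, pmap_zero]

/-- If all commutators lie in the third dimension subgroup and the class of `g ^ p ^ k` in degree
`p ^ k` vanishes only if `g` is a `p`-th power, the kernel of `θ̂` is generated by the part of degree
at least `2`. -/
theorem ker_thetaHat_eq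
    (h : ∀ x y : G, x * y * x⁻¹ * y⁻¹ ∈ dimensionSubgroup (ZMod p) G 3)
    (hpow : ∀ (k : ℕ) (g : G), g ^ p ^ k ∈ dimensionSubgroup (ZMod p) G (p ^ k + 1) →
      ∃ x, x ^ p = g) : (thetaHat p G).ker = magnusIdeal p G := by
  refine le_antisymm (fun x hx => ?_) (magnusIdeal_le_ker h)
  obtain ⟨v, N, hv⟩ := exists_sub_sum_magnusPow_mem x
  have h1 := hv N le_rfl
  have h2 := LieHom.mem_ker.1 (magnusIdeal_le_ker h h1)
  rw [map_sub, LieHom.mem_ker.1 hx, zero_sub, neg_eq_zero, map_sum] at h2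
  choose hm he using fun k => thetaHat_magnusPow (p := p) k (v k)
  rw [Finset.sum_congr rfl fun k _ => he k] at h2
  -- The degrees `p ^ j` are distinct, so the `j`-th term can be isolated by projection. It gives `v
  -- j ^ p ^ j ∈ D_{p^j+1}`, so `v j` is a `p`-th power and its degree-one class is already zero.
  have h3 : ∀ j ∈ Finset.range N, magnusPow p j (v j) = 0 := by
    intro j hj
    have h4 := congrArg ((dimensionSeries (ZMod p) G).proj (primePow p j)) h2
    rw [map_zero, map_sum, Finset.sum_eq_single_of_mem j hj] at h4
    · have h5 : (dimensionSeries (ZMod p) G).layerMk (primePow p j)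
          (v j ^ p ^ j) (hm j) = 0 := (DirectSum.of_eq_same _ _).symm.trans h4
      have h6 := mem_dimensionSeries.1 ((dimensionSeries (ZMod p) G).layerMk_eq_zero.1 h5)
      rw [PNat.add_coe, PNat.one_coe, primePow_coe] at h6
      obtain ⟨y, hy⟩ := hpow j _ (mem_dimensionSubgroup.2 h6)
      rw [← hy]
      exact magnusPow_eq_zero j (magnusModOne_pow_prime y)
    · intro k _ hk
      refine DirectSum.of_eq_of_ne _ _ _ fun e => hk ?_
      exact (Nat.pow_right_injective hp.out.two_le (congrArg PNat.val e)).symm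
  rwa [Finset.sum_eq_zero h3, sub_zero] at h1

end ThetaKernel

/-! ### Power formula in class two, and centrality of powers in nilpotent groups -/

section ClassTwo

variable {G : Type u} [Group G]

/-- Collecting the `x`'s on the left makes each `x` pass all earlier `y`'s, with one central factor
`z` per passage: `n.choose 2` in all. -/
theorem mul_pow_of_class_two {x y z : G} (h : y * x = x * y * z) (hx : Commute z x)
    (hy : Commute z y) (n : ℕ) : (x * y) ^ n = x ^ n * y ^ n * z ^ n.choose 2 := by
  have aux : ∀ n : ℕ, y ^ n * x = x * y ^ n * z ^ n := by
    intro n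
    induction n with
    | zero => simp
    | succ n ih =>
      rw [pow_succ', mul_assoc, ih, ← mul_assoc, ← mul_assoc, h, mul_assoc (x * y),
        (hy.pow_right n).eq, pow_succ' z]
      simp only [mul_assoc]
  induction n with
  | zero => simp
  | succ n ih =>
    have hc : Commute (z ^ n.choose 2) (x * y) := ((hx.mul_right hy)).pow_left _
    have h2 : Commute (z ^ n) y := hy.pow_left n
    rw [pow_succ, ih, mul_assoc, hc.eq, Nat.choose_succ_succ', Nat.choose_one_right, pow_add z]
    calc x ^ n * y ^ n * (x * y * z ^ n.choose 2)
        = x ^ n * (y ^ n * x) * y * z ^ n.choose 2 := by simp only [mul_assoc]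
      _ = x ^ n * x * y ^ n * (z ^ n * y) * z ^ n.choose 2 := by rw [aux]; simp only [mul_assoc]
      _ = x ^ (n + 1) * y ^ (n + 1) * (z ^ n * z ^ n.choose 2) := by
        rw [h2.eq, pow_succ, pow_succ]; simp only [mul_assoc]

/-- The subgroup generated by the `n`-th powers of the elements of `N`. -/
def Subgroup.powSpan (n : ℕ) (N : Subgroup G) : Subgroup G :=
  Subgroup.closure {x | ∃ y ∈ N, y ^ n = x}

theorem Subgroup.pow_mem_powSpan (n : ℕ) {N : Subgroup G} {y : G} (hy : y ∈ N) :
    y ^ n ∈ N.powSpan n := Subgroup.subset_closure ⟨y, hy, rfl⟩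

theorem Subgroup.powSpan_le {n : ℕ} {N K : Subgroup G} : N.powSpan n ≤ K ↔ ∀ y ∈ N, y ^ n ∈ K := by
  rw [powSpan, Subgroup.closure_le]
  exact ⟨fun h y hy => h ⟨y, hy, rfl⟩, fun h x ⟨y, hy, e⟩ => e ▸ h y hy⟩

theorem Subgroup.map_powSpan {H : Type*} [Group H] (f : G →* H) (n : ℕ) (N : Subgroup G) :
    (N.powSpan n).map f ≤ (N.map f).powSpan n := by
  rw [Subgroup.map_le_iff_le_comap, powSpan_le]
  intro y hy
  rw [Subgroup.mem_comap, map_pow]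
  exact pow_mem_powSpan n (Subgroup.mem_map_of_mem f hy)

instance Subgroup.powSpan_normal (n : ℕ) (N : Subgroup G) [hN : N.Normal] :
    (N.powSpan n).Normal := by
  refine ⟨fun x hx g => ?_⟩
  have h : N.powSpan n ≤ (N.powSpan n).comap (MulAut.conj g).toMonoidHom := by
    rw [powSpan_le]
    intro y hy
    rw [Subgroup.mem_comap, map_pow]
    exact pow_mem_powSpan n (hN.conj_mem y hy g)
  exact h hx

theorem conj_eq_mul_commutator (x g : G) : g * x * g⁻¹ = x * (x⁻¹ * (g * x * g⁻¹)) := by group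

/-- The base on the left is `g * x * g⁻¹`, written as `x` times a commutator so that the power
formula applies to the two factors. -/
theorem pow_mem_center_of_forall_conj {n : ℕ} {x : G}
    (h : ∀ g, (x * (x⁻¹ * (g * x * g⁻¹))) ^ n = x ^ n) : x ^ n ∈ Subgroup.center G := by
  rw [Subgroup.mem_center_iff]
  intro g
  have := h g
  rw [← conj_eq_mul_commutator, conj_pow] at this
  exact mul_inv_eq_iff_eq_mul.1 this

theorem map_mk_commutator {H : Type*} [Group H] (f : G →* H) (hf : Function.Surjective f)
    {N M : Subgroup G}
    (h : ∀ x ∈ N, ∀ g : G, x⁻¹ * (g * x * g⁻¹) ∈ M) :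
    ∀ x ∈ N.map f, ∀ g : H, x⁻¹ * (g * x * g⁻¹) ∈ M.map f := by
  rintro _ ⟨x, hx, rfl⟩ g
  obtain ⟨g, rfl⟩ := hf g
  exact ⟨_, h x hx g, by simp only [map_mul, map_inv]⟩

theorem map_pow_eq_one {H : Type*} [Group H] (f : G →* H) {M : Subgroup G} {n : ℕ}
    (h : ∀ x ∈ M, x ^ n = 1) : ∀ x ∈ M.map f, x ^ n = 1 := by
  rintro _ ⟨x, hx, rfl⟩
  rw [← map_pow, h x hx, map_one]

theorem commutator_mem_center_of_map_le {M : Subgroup G}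
    (h : M.map (QuotientGroup.mk' (Subgroup.center G)) ≤ Subgroup.center (G ⧸ Subgroup.center G))
    {c : G} (hc : c ∈ M) (g : G) : c⁻¹ * (g * c * g⁻¹) ∈ Subgroup.center G := by
  have h1 := Subgroup.mem_center_iff.1 (h (Subgroup.mem_map_of_mem _ hc))
    (QuotientGroup.mk' (Subgroup.center G) g)
  rw [← QuotientGroup.eq, eq_comm]
  change QuotientGroup.mk' (Subgroup.center G) (g * c * g⁻¹) = QuotientGroup.mk' _ c
  rw [map_mul, map_mul, map_inv, h1, mul_inv_cancel_right]

/-- The commutator is central, so the `n`-th power of `g * c * g⁻¹` is that of `c` times that of the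
commutator; the first two are `1`. -/
theorem commutator_pow_eq_one {c g : G} (h : c⁻¹ * (g * c * g⁻¹) ∈ Subgroup.center G) {n : ℕ}
    (hc : c ^ n = 1) : (c⁻¹ * (g * c * g⁻¹)) ^ n = 1 := by
  have h1 : Commute c (c⁻¹ * (g * c * g⁻¹)) := Subgroup.mem_center_iff.1 h c
  have h2 := h1.mul_pow n
  rwa [← conj_eq_mul_commutator, conj_pow, hc, mul_one, mul_inv_cancel, one_mul, eq_comm] at h2

/-- If `N` is powerfully embedded modulo `p`-th powers of `M = N ^ p`, then `M` is central. -/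
theorem powSpan_le_center_of_odd {p : ℕ} [hp : Fact p.Prime] (hp2 : p ≠ 2) (H : Type u) [Group H]
    [Group.IsNilpotent H] : ∀ N M : Subgroup H, M ≤ N.powSpan p →
      (∀ x ∈ N, ∀ g, x⁻¹ * (g * x * g⁻¹) ∈ M) → (∀ c ∈ M, c ^ p = 1) → M ≤ Subgroup.center H := by
  refine Group.nilpotent_center_quotient_ind (P := fun H _ _ => ∀ N M : Subgroup H,
    M ≤ N.powSpan p → (∀ x ∈ N, ∀ g, x⁻¹ * (g * x * g⁻¹) ∈ M) → (∀ c ∈ M, c ^ p = 1) →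
      M ≤ Subgroup.center H) H ?_ ?_
  · intro H _ _ N M _ _ _ x _
    rw [Subsingleton.elim x 1]
    exact one_mem _
  · intro H _ _ ih N M hM hN hc
    -- Modulo the center `Z`, the image of `M` is central by induction, so commutators of `M` with
    -- `H` lie in `Z`.
    have h1 := ih (N.map (QuotientGroup.mk' _)) (M.map (QuotientGroup.mk' _))
      ((Subgroup.map_mono hM).trans (Subgroup.map_powSpan _ _ _))
      (map_mk_commutator _ (QuotientGroup.mk'_surjective _) hN) (map_pow_eq_one _ hc)
    refine hM.trans (Subgroup.powSpan_le.2 fun x hx => pow_mem_center_of_forall_conj fun g => ?_)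
    have hcM := hN x hx g
    generalize x⁻¹ * (g * x * g⁻¹) = c at hcM ⊢
    have hz := commutator_mem_center_of_map_le h1 hcM x⁻¹
    have hz1 := commutator_pow_eq_one hz (hc c hcM)
    rw [inv_inv] at hz hz1
    have hzc := fun y => (Subgroup.mem_center_iff.1 hz y).symm
    -- With `c ∈ M` the commutator of `x` and `g`, and `z` that of `c` and `x⁻¹`, `(x c) ^ p = x ^ p
    -- c ^ p z ^ (p.choose 2)`. Both `c ^ p` and `z ^ p` are `1`, and `p` divides the binomial
    -- coefficient because `p` is odd.
    obtain ⟨k, hk⟩ : p ∣ p.choose 2 := hp.out.dvd_choose_self two_ne_zero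
      (lt_of_le_of_ne hp.out.two_le (Ne.symm hp2))
    rw [mul_pow_of_class_two (z := c⁻¹ * (x⁻¹ * c * x)) (by group) (hzc x) (hzc c), hc c hcM, hk,
      pow_mul, hz1, one_pow, mul_one, mul_one]

/-- For `p = 2` the binomial coefficient is `1` and gives nothing, so commutators are required to
lie one level deeper, in `K`. By induction commutators of `M` are central; they square to `1`, so
squares of elements of `M` are central and `K` is central. The same computation one level up then
shows that `M` is central. -/
theorem powSpan_le_center_of_two (H : Type u) [Group H] [Group.IsNilpotent H] :
    ∀ N M K : Subgroup H, M ≤ N.powSpan 2 → M ≤ N → K ≤ M.powSpan 2 →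
      (∀ x ∈ N, ∀ g, x⁻¹ * (g * x * g⁻¹) ∈ K) → (∀ c ∈ K, c ^ 2 = 1) →
      M ≤ Subgroup.center H := by
  refine Group.nilpotent_center_quotient_ind (P := fun H _ _ => ∀ N M K : Subgroup H,
      M ≤ N.powSpan 2 → M ≤ N → K ≤ M.powSpan 2 →
      (∀ x ∈ N, ∀ g, x⁻¹ * (g * x * g⁻¹) ∈ K) → (∀ c ∈ K, c ^ 2 = 1) →
      M ≤ Subgroup.center H) H ?_ ?_
  · intro H _ _ N M K _ _ _ _ _ x _
    rw [Subsingleton.elim x 1]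
    exact one_mem _
  · intro H _ _ ih N M K hM hMN hK hN hc
    have h1 := ih (N.map (QuotientGroup.mk' _)) (M.map (QuotientGroup.mk' _))
      (K.map (QuotientGroup.mk' _))
      ((Subgroup.map_mono hM).trans (Subgroup.map_powSpan _ _ _)) (Subgroup.map_mono hMN)
      ((Subgroup.map_mono hK).trans (Subgroup.map_powSpan _ _ _))
      (map_mk_commutator _ (QuotientGroup.mk'_surjective _) hN) (map_pow_eq_one _ hc)
    have hKc : K ≤ Subgroup.center H := by
      refine hK.trans (Subgroup.powSpan_le.2 fun y hy => pow_mem_center_of_forall_conj fun g => ?_)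
      have hz := commutator_mem_center_of_map_le h1 hy g
      have hz1 := hc _ (hN y (hMN hy) g)
      rw [(show Commute y _ from Subgroup.mem_center_iff.1 hz y).mul_pow, hz1, mul_one]
    refine hM.trans (Subgroup.powSpan_le.2 fun x hx => pow_mem_center_of_forall_conj fun g => ?_)
    have hcK := hN x hx g
    rw [(show Commute x _ from Subgroup.mem_center_iff.1 (hKc hcK) x).mul_pow, hc _ hcK, mul_one]

end ClassTwo

/-! ### The iterated power series of a pro-`p` group and its centrality -/

section LowerPSeries

/-- Every open normal subgroup has index a power of `p`. -/
def HasPrimePowIndex (p : ℕ) (G : Type u) [Group G] [TopologicalSpace G] : Prop :=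
  ∀ N : Subgroup G, N.Normal → IsOpen (N : Set G) → ∃ k : ℕ, N.index = p ^ k

variable {p : ℕ} [hp : Fact p.Prime] {G : Type u} [Group G] [TopologicalSpace G]
  [IsTopologicalGroup G]

/-- The closed series `G, G ^ p, (G ^ p) ^ p, …` of iterated subgroups generated by `p`-th
powers. -/
def powSeries (p : ℕ) (G : Type u) [Group G] [TopologicalSpace G] [IsTopologicalGroup G] :
    ℕ → Subgroup G
  | 0 => ⊤
  | n + 1 => ((powSeries p G n).powSpan p).topologicalClosure

theorem isClosed_powSeries (n : ℕ) : IsClosed (powSeries p G n : Set G) := by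
  cases n with
  | zero => exact isClosed_univ
  | succ n => exact Subgroup.isClosed_topologicalClosure _

instance powSeries_normal (n : ℕ) : (powSeries p G n).Normal := by
  induction n with
  | zero => exact Subgroup.normal_of_characteristic ⊤
  | succ n ih => exact Subgroup.is_normal_topologicalClosure _

theorem powSeries_succ_le_iff {n : ℕ} {K : Subgroup G} (hK : IsClosed (K : Set G)) :
    powSeries p G (n + 1) ≤ K ↔ ∀ y ∈ powSeries p G n, y ^ p ∈ K := by
  rw [← Subgroup.powSpan_le]
  exact ⟨fun h => (Subgroup.le_topologicalClosure _).trans h,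
    fun h => Subgroup.topologicalClosure_minimal _ h hK⟩

theorem pow_mem_powSeries_succ {n : ℕ} {y : G} (hy : y ∈ powSeries p G n) :
    y ^ p ∈ powSeries p G (n + 1) :=
  (powSeries_succ_le_iff (isClosed_powSeries _)).1 le_rfl y hy

theorem powSeries_succ_le (n : ℕ) : powSeries p G (n + 1) ≤ powSeries p G n :=
  (powSeries_succ_le_iff (isClosed_powSeries _)).2 fun _ hy => pow_mem hy p

theorem powSeries_antitone : Antitone (powSeries p G) := antitone_nat_of_succ_le powSeries_succ_le

theorem pow_prime_pow_mem_powSeries (g : G) (k : ℕ) : g ^ p ^ k ∈ powSeries p G k := by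
  induction k with
  | zero => exact Subgroup.mem_top _
  | succ k ih =>
    rw [pow_succ, pow_mul]
    exact pow_mem_powSeries_succ ih

/-- Preimages of subgroups under a map with open kernel are open, hence closed, so the topological
closure in the series disappears in the image. -/
theorem map_powSeries_succ_le {n : ℕ} {H : Type*} [Group H] (f : G →* H)
    (hf : IsOpen (f.ker : Set G)) :
    (powSeries p G (n + 1)).map f ≤ ((powSeries p G n).map f).powSpan p := by
  rw [Subgroup.map_le_iff_le_comap, powSeries_succ_le_iff]
  · intro y hy
    rw [Subgroup.mem_comap, map_pow]
    exact Subgroup.pow_mem_powSpan p (Subgroup.mem_map_of_mem f hy)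
  · exact Subgroup.isClosed_of_isOpen _ (Subgroup.isOpen_mono (MonoidHom.ker_le_comap f _) hf)

/-- A closed normal subgroup of a profinite group is an intersection of open normal subgroups. -/
theorem mem_of_forall_open_normal [CompactSpace G] [TotallyDisconnectedSpace G] {A : Subgroup G}
    [A.Normal] (hA : IsClosed (A : Set G)) {z : G}
    (h : ∀ K : Subgroup G, K.Normal → IsOpen (K : Set G) → A ≤ K → z ∈ K) : z ∈ A := by
  by_contra hz
  -- The coset `z A` is closed and misses `1`, so an open normal `N` avoids it. Then `N A` is open,
  -- normal and contains `A`, but `z ∈ N A` would put an element of `N` in `z A`.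
  have hU : IsOpen {u : G | u⁻¹ * z ∈ A}ᶜ :=
    (hA.preimage (continuous_inv.mul continuous_const)).isOpen_compl
  obtain ⟨N, hN⟩ := ProfiniteGrp.exist_openNormalSubgroup_sub_open_nhds_of_one hU
    (by simpa using hz)
  have hNn : (N : Subgroup G).Normal := N.isNormal'
  have h1 := h ((N : Subgroup G) ⊔ A) inferInstance
    (Subgroup.isOpen_mono le_sup_left N.isOpen') le_sup_right
  obtain ⟨y, hy, a, ha, e⟩ := Subgroup.mem_sup_of_normal_left.1 h1
  refine hN hy ?_
  change y⁻¹ * z ∈ A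
  rwa [← e, inv_mul_cancel_left]

variable [CompactSpace G] [TotallyDisconnectedSpace G]

/-- In a finite `p`-quotient the `n`-th term maps into `D_{n+1}`, because `(n + 1) * p ≥ n + 2`. The
augmentation ideal there is nilpotent, so `z` dies in every finite quotient. -/
theorem eq_one_of_forall_mem_powSeries
    (hG : HasPrimePowIndex p G)
    {z : G} (hz : ∀ n, z ∈ powSeries p G n) : z = 1 := by
  have hbot : IsClosed ((⊥ : Subgroup G) : Set G) := isClosed_singleton
  refine Subgroup.mem_bot.1 (mem_of_forall_open_normal hbot fun K hK hKo _ => ?_)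
  obtain ⟨k, hk⟩ := hG K hK hKo
  have hfin : Finite (G ⧸ K) := by
    refine Nat.finite_of_card_ne_zero ?_
    rw [← Subgroup.index, hk]
    exact pow_ne_zero k hp.out.ne_zero
  have hQ : IsPGroup p (G ⧸ K) := IsPGroup.of_card hk
  have hle : ∀ n, powSeries p G n ≤
      (dimensionSubgroup (ZMod p) (G ⧸ K) (n + 1)).comap (QuotientGroup.mk' K) := by
    intro n
    induction n with
    | zero =>
      intro x _
      rw [Subgroup.mem_comap, mem_dimensionSubgroup]
      exact grp_sub_one_mem_pow_one _
    | succ n ih =>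
      rw [powSeries_succ_le_iff]
      · intro y hy
        have h1 := mem_dimensionSubgroup.1 (Subgroup.mem_comap.1 (ih hy))
        rw [Subgroup.mem_comap, mem_dimensionSubgroup, map_pow, grp_pow_sub_one]
        refine aug_of_le ?_ (aug_pow_mem h1 p)
        have := Nat.mul_le_mul_left (n + 1) hp.out.two_le
        omega
      · refine Subgroup.isClosed_of_isOpen _ (Subgroup.isOpen_mono ?_ hKo)
        conv_lhs => rw [← QuotientGroup.ker_mk' K]
        exact MonoidHom.ker_le_comap _ _
  obtain ⟨N, hN⟩ := exists_augmentationIdeal_pow_eq_bot hQ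
  have h1 := mem_dimensionSubgroup.1 (Subgroup.mem_comap.1 (hle N (hz N)))
  have h2 := aug_of_le (Nat.le_succ N) h1
  rw [hN, Submodule.mem_bot, sub_eq_zero, ← grp_one] at h2
  exact (QuotientGroup.eq_one_iff z).1 (MonoidAlgebra.of_injective h2)

/-- The drop `1`, respectively `2` if `p = 2`, in the series caused by commutators. -/
def commDrop (p : ℕ) : ℕ := if p = 2 then 2 else 1

/-- Commutators with a term of the series lie in the next term, respectively, if `p = 2`, in the
next but one. -/
def IsPowSeriesCentral (p : ℕ) (G : Type u) [Group G] [TopologicalSpace G] [IsTopologicalGroup G] :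
    Prop :=
  ∀ n, ∀ x ∈ powSeries p G n, ∀ g, x⁻¹ * (g * x * g⁻¹) ∈ powSeries p G (n + commDrop p)

/-- Inductive step: modulo an open normal `K` containing the target term, the group is a finite
`p`-group, and commutators with the image of `P_n` are killed by `p`. The nilpotent centrality
lemmas make the image of `P_{n+1}` central, so its commutators lie in `K`. The target is closed and
normal, hence the intersection of such `K`. -/
theorem isPowSeriesCentral
    (hG : HasPrimePowIndex p G)
    (h0 : ∀ x g : G, x⁻¹ * (g * x * g⁻¹) ∈ powSeries p G (commDrop p)) :
    IsPowSeriesCentral p G := by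
  intro n
  induction n with
  | zero => intro x _ g; rw [zero_add]; exact h0 x g
  | succ n ih =>
    intro x hx g
    refine mem_of_forall_open_normal (isClosed_powSeries _) fun K hK hKo hAK => ?_
    obtain ⟨k, hk⟩ := hG K hK hKo
    have hfin : Finite (G ⧸ K) := by
      refine Nat.finite_of_card_ne_zero ?_
      rw [← Subgroup.index, hk]
      exact pow_ne_zero k hp.out.ne_zero
    have hnil : Group.IsNilpotent (G ⧸ K) := (IsPGroup.of_card hk : IsPGroup p (G ⧸ K)).isNilpotent
    let f := QuotientGroup.mk' K
    have hker : IsOpen (f.ker : Set G) := by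
      rw [QuotientGroup.ker_mk']; exact hKo
    have hmap := map_mk_commutator f (QuotientGroup.mk'_surjective K) ih
    have hcenter : (powSeries p G (n + 1)).map f ≤ Subgroup.center (G ⧸ K) := by
      have hpow : ∀ c ∈ (powSeries p G (n + commDrop p)).map f, c ^ p = 1 := by
        rintro _ ⟨c, hc, rfl⟩
        rw [← map_pow]
        refine (QuotientGroup.eq_one_iff _).2 (hAK ?_)
        rw [add_right_comm]
        exact pow_mem_powSeries_succ hc
      by_cases h2 : p = 2
      · subst h2
        exact powSpan_le_center_of_two (G ⧸ K) ((powSeries 2 G n).map f) _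
          ((powSeries 2 G (n + 2)).map f) (map_powSeries_succ_le f hker)
          (Subgroup.map_mono (powSeries_succ_le n)) (map_powSeries_succ_le f hker) hmap hpow
      · have e : commDrop p = 1 := if_neg h2
        rw [e] at hmap hpow
        exact powSpan_le_center_of_odd h2 (G ⧸ K) ((powSeries p G n).map f) _
          (map_powSeries_succ_le f hker) hmap hpow
    have h1 := Subgroup.mem_center_iff.1 (hcenter (Subgroup.mem_map_of_mem f hx)) (f g)
    rw [← QuotientGroup.eq_one_iff]
    change f (x⁻¹ * (g * x * g⁻¹)) = 1
    rw [map_mul, map_mul, map_mul, map_inv, map_inv, h1, mul_inv_cancel_right, inv_mul_cancel]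

end LowerPSeries

/-! ### The power maps between successive layers -/

section Powerful

variable {p : ℕ} [hp : Fact p.Prime] {G : Type u} [Group G] [TopologicalSpace G]
  [IsTopologicalGroup G]

/-- The commutator `z` of `y` and `x⁻¹` is central modulo `P_{j+2}`, so the class-two formula
applies. Its factor `z ^ (p.choose 2)` vanishes: for odd `p` since `p` divides the exponent, and for
`p = 2` since `z` already lies in `P_{j+2}`. -/
theorem mk_mul_pow (hcomm : IsPowSeriesCentral p G) {j : ℕ} (x : G) {y : G} (hy : y ∈ powSeries p G j) :
    (QuotientGroup.mk' (powSeries p G (j + 2)) (x * y)) ^ p =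
      QuotientGroup.mk' (powSeries p G (j + 2)) x ^ p *
        QuotientGroup.mk' (powSeries p G (j + 2)) y ^ p := by
  let f := QuotientGroup.mk' (powSeries p G (j + 2))
  have hf : ∀ g, f g = 1 ↔ g ∈ powSeries p G (j + 2) := fun g => QuotientGroup.eq_one_iff g
  have hz := hcomm j y hy x⁻¹
  rw [inv_inv] at hz
  have hz1 : y⁻¹ * (x⁻¹ * y * x) ∈ powSeries p G (j + 1) := by
    refine powSeries_antitone ?_ hz
    rw [commDrop]; split_ifs <;> omega
  have hzc : ∀ g, Commute (f (y⁻¹ * (x⁻¹ * y * x))) (f g) := by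
    intro g
    have h1 := powSeries_antitone (show j + 2 ≤ j + 1 + commDrop p by
      rw [commDrop]; split_ifs <;> omega) (hcomm _ _ hz1 g)
    rw [← hf, map_mul, map_inv, inv_mul_eq_one, map_mul f (g * _), map_mul f g, map_inv,
      eq_mul_inv_iff_mul_eq] at h1
    exact h1
  have hp0 : f (y⁻¹ * (x⁻¹ * y * x)) ^ p.choose 2 = 1 := by
    by_cases h2 : p = 2
    · subst h2
      rw [(hf _).2 hz, one_pow]
    · obtain ⟨k, hk⟩ : p ∣ p.choose 2 := hp.out.dvd_choose_self two_ne_zero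
        (lt_of_le_of_ne hp.out.two_le (Ne.symm h2))
      rw [hk, pow_mul, ← map_pow, (hf _).2 (pow_mem_powSeries_succ hz1), one_pow]
  change f (x * y) ^ p = f x ^ p * f y ^ p
  rw [map_mul, mul_pow_of_class_two (z := f (y⁻¹ * (x⁻¹ * y * x))) ?_ (hzc x) (hzc y), hp0, mul_one]
  rw [← map_mul, ← map_mul, ← map_mul]
  congr 1
  group

/-- The `p`-th power homomorphism on a term of the series. -/
def powHom (hcomm : IsPowSeriesCentral p G) (j : ℕ) : powSeries p G j →* G ⧸ powSeries p G (j + 2) :=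
  MonoidHom.mk' (fun y => QuotientGroup.mk' (powSeries p G (j + 2)) (y : G) ^ p) fun x y => by
    rw [Subgroup.coe_mul]
    exact mk_mul_pow hcomm x y.2

theorem powHom_apply (hcomm : IsPowSeriesCentral p G) (j : ℕ) (y : powSeries p G j) :
    powHom hcomm j y = QuotientGroup.mk' (powSeries p G (j + 2)) ((y : G) ^ p) :=
  (map_pow _ _ _).symm

variable [CompactSpace G] [TotallyDisconnectedSpace G]

/-- `P_{j+1}` is only the closure of what the powers generate. It suffices that the preimage of the
range is closed, and this preimage is the image of the compact set `P_j × P_{j+2}` under `(y, u) ↦ y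
^ p * u`. -/
theorem powHom_range (hcomm : IsPowSeriesCentral p G) (j : ℕ) : (powHom hcomm j).range =
    (powSeries p G (j + 1)).map (QuotientGroup.mk' (powSeries p G (j + 2))) := by
  refine le_antisymm ?_ ?_
  · rintro _ ⟨y, rfl⟩
    rw [powHom_apply]
    exact Subgroup.mem_map_of_mem _ (pow_mem_powSeries_succ y.2)
  · rw [Subgroup.map_le_iff_le_comap, powSeries_succ_le_iff]
    · intro y hy
      exact ⟨⟨y, hy⟩, powHom_apply hcomm j _⟩
    · have hc : IsCompact ((fun q : G × G => q.1 ^ p * q.2) ''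
          ((powSeries p G j : Set G) ×ˢ (powSeries p G (j + 2) : Set G))) :=
        (((isClosed_powSeries j).isCompact).prod (isClosed_powSeries (j + 2)).isCompact).image
          (by fun_prop)
      convert hc.isClosed using 1
      ext z
      constructor
      · rintro ⟨y, hy⟩
        rw [powHom_apply] at hy
        refine ⟨((y : G), ((y : G) ^ p)⁻¹ * z), ⟨y.2, QuotientGroup.eq.1 hy⟩, ?_⟩
        exact mul_inv_cancel_left _ _
      · rintro ⟨⟨y, u⟩, ⟨hy, hu⟩, rfl⟩
        refine ⟨⟨y, hy⟩, ?_⟩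
        rw [powHom_apply]
        refine QuotientGroup.eq.2 ?_
        dsimp only
        rwa [inv_mul_cancel_left]

/-- Every element of a term of the series is a `p`-th power of an element of the previous term. -/
theorem exists_pow_eq_of_mem_powSeries_succ (hcomm : IsPowSeriesCentral p G)
    (hG : HasPrimePowIndex p G) {n : ℕ} {z : G} (hz : z ∈ powSeries p G (n + 1)) :
    ∃ x ∈ powSeries p G n, x ^ p = z := by
  -- Successive approximation: the approximate roots modulo deeper and deeper terms form nested
  -- compact sets, and a common point is an exact root.
  have hne : (⋂ k,
      {x : G | x ∈ powSeries p G n ∧ (x ^ p)⁻¹ * z ∈ powSeries p G (n + 1 + k)}).Nonempty := by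
    refine IsCompact.nonempty_iInter_of_sequence_nonempty_isCompact_isClosed _
      (fun k x hx => ⟨hx.1, powSeries_succ_le _ hx.2⟩) ?_ ?_ ?_
    · intro k
      induction k with
      | zero => exact ⟨1, one_mem _, by rwa [one_pow, inv_one, one_mul]⟩
      | succ k ih =>
        obtain ⟨x, hx, hxz⟩ := ih
        -- The error lies in `P_{n+k+1}`, so it is a `p`-th power `y ^ p` modulo `P_{n+k+2}` with `y
        -- ∈ P_{n+k}`; by `mk_mul_pow`, `x * y` has a smaller error.
        have h1 : QuotientGroup.mk' (powSeries p G (n + k + 2)) ((x ^ p)⁻¹ * z) ∈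
            (powHom hcomm (n + k)).range := by
          rw [powHom_range]
          exact Subgroup.mem_map_of_mem _ (by rwa [add_right_comm] at hxz)
        obtain ⟨⟨y, hy⟩, e⟩ := h1
        rw [powHom_apply] at e
        refine ⟨x * y, mul_mem hx (powSeries_antitone (Nat.le_add_right n k) hy), ?_⟩
        rw [show n + 1 + (k + 1) = n + k + 2 by omega]
        refine QuotientGroup.eq.1 ?_
        change QuotientGroup.mk' (powSeries p G (n + k + 2)) ((x * y) ^ p) =
          QuotientGroup.mk' (powSeries p G (n + k + 2)) z
        rw [map_pow, mk_mul_pow hcomm x hy, ← map_pow, ← map_pow, e, ← map_mul, mul_inv_cancel_left]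
    · exact IsClosed.isCompact (((isClosed_powSeries n).preimage continuous_id).inter
        ((isClosed_powSeries _).preimage (by fun_prop)))
    · exact fun k => ((isClosed_powSeries n).preimage continuous_id).inter
        ((isClosed_powSeries _).preimage (by fun_prop))
  obtain ⟨x, hx⟩ := hne
  rw [Set.mem_iInter] at hx
  refine ⟨x, (hx 0).1, inv_mul_eq_one.1 (eq_one_of_forall_mem_powSeries hG fun k => ?_)⟩
  exact powSeries_antitone (by omega) (hx k).2

/-- Within the coset `x P_{n+1}`, dividing by a root of the current `p`-th power pushes that power
ever deeper. By compactness some `y` of the coset has `y ^ p = 1`, so `y = 1` by torsion-freeness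
and the coset is trivial. -/
theorem mem_powSeries_succ_of_pow_mem (hcomm : IsPowSeriesCentral p G) (hG : HasPrimePowIndex p G)
    (htf : ∀ g : G, IsOfFinOrder g → g = 1) {n : ℕ} {x : G}
    (hx : x ^ p ∈ powSeries p G (n + 2)) : x ∈ powSeries p G (n + 1) := by
  have hne : (⋂ k,
      {y : G | x⁻¹ * y ∈ powSeries p G (n + 1) ∧ y ^ p ∈ powSeries p G (n + 2 + k)}).Nonempty := by
    refine IsCompact.nonempty_iInter_of_sequence_nonempty_isCompact_isClosed _
      (fun k y hy => ⟨hy.1, powSeries_succ_le _ hy.2⟩) ?_ ?_ ?_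
    · intro k
      induction k with
      | zero => exact ⟨x, by rw [inv_mul_cancel]; exact one_mem _, hx⟩
      | succ k ih =>
        obtain ⟨y, hxy, hy⟩ := ih
        rw [show n + 2 + k = n + 1 + k + 1 by omega] at hy
        obtain ⟨u, hu, e⟩ := exists_pow_eq_of_mem_powSeries_succ hcomm hG hy
        refine ⟨y * u⁻¹, ?_, ?_⟩
        · rw [← mul_assoc]
          exact mul_mem hxy (inv_mem (powSeries_antitone (Nat.le_add_right _ k) hu))
        · rw [show n + 2 + (k + 1) = n + 1 + k + 2 by omega, ← QuotientGroup.eq_one_iff]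
          change QuotientGroup.mk' (powSeries p G (n + 1 + k + 2)) ((y * u⁻¹) ^ p) = 1
          rw [map_pow, mk_mul_pow hcomm y (inv_mem hu), map_inv, inv_pow, ← map_pow, ← map_pow, e,
            mul_inv_cancel]
    · exact IsClosed.isCompact (((isClosed_powSeries _).preimage (by fun_prop)).inter
        ((isClosed_powSeries _).preimage (by fun_prop)))
    · exact fun k => ((isClosed_powSeries _).preimage (by fun_prop)).inter
        ((isClosed_powSeries _).preimage (by fun_prop))
  obtain ⟨y, hy⟩ := hne
  rw [Set.mem_iInter] at hy
  have h1 : y ^ p = 1 := eq_one_of_forall_mem_powSeries hG fun k =>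
    powSeries_antitone (by omega) (hy k).2
  have h2 := htf y (isOfFinOrder_iff_pow_eq_one.2 ⟨p, hp.out.pos, h1⟩)
  have h3 := (hy 0).1
  rwa [h2, mul_one, inv_mem_iff] at h3

/-- The power map induces an isomorphism from `P_n / P_{n+1}` onto `P_{n+1} / P_{n+2}`, so all
layers have the same order. -/
theorem relIndex_powSeries (hcomm : IsPowSeriesCentral p G) (hG : HasPrimePowIndex p G)
    (htf : ∀ g : G, IsOfFinOrder g → g = 1) (n : ℕ) :
    (powSeries p G (n + 1)).relIndex (powSeries p G n) = (powSeries p G 1).index := by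
  induction n with
  | zero => exact Subgroup.relIndex_top_right _
  | succ n ih =>
    rw [← ih]
    have h1 : (powHom hcomm n).ker = (powSeries p G (n + 1)).subgroupOf (powSeries p G n) := by
      ext y
      rw [MonoidHom.mem_ker, powHom_apply, Subgroup.mem_subgroupOf]
      refine (QuotientGroup.eq_one_iff _).trans ⟨fun h => ?_, pow_mem_powSeries_succ⟩
      exact mem_powSeries_succ_of_pow_mem hcomm hG htf h
    have h2 := Subgroup.index_ker (powHom hcomm n)
    rw [h1, powHom_range, ← Subgroup.relIndex_ker, QuotientGroup.ker_mk'] at h2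
    exact h2.symm

theorem index_powSeries (hcomm : IsPowSeriesCentral p G) (hG : HasPrimePowIndex p G)
    (htf : ∀ g : G, IsOfFinOrder g → g = 1) (n : ℕ) :
    (powSeries p G n).index = (powSeries p G 1).index ^ n := by
  induction n with
  | zero => exact Subgroup.index_top
  | succ n ih =>
    rw [← Subgroup.relIndex_mul_index (powSeries_succ_le n), ih,
      relIndex_powSeries hcomm hG htf, pow_succ']

end Powerful

/-! ### Coordinates on the elementary abelian quotient `G / P_1` -/

section Coordinates

variable {p : ℕ} [hp : Fact p.Prime] {G : Type u} [Group G] [TopologicalSpace G]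
  [IsTopologicalGroup G]

theorem finite_closure_of_pow_eq_one {Q : Type*} [Group Q] (hab : ∀ a b : Q, a * b = b * a)
    {n : ℕ} (hn : 0 < n) (hpow : ∀ a : Q, a ^ n = 1) (T : Finset Q) :
    Finite (Subgroup.closure (T : Set Q)) := by
  let _ : CommGroup Q := { (inferInstance : Group Q) with mul_comm := hab }
  have hfg : Group.FG (Subgroup.closure (T : Set Q)) :=
    (Group.fg_iff_subgroup_fg _).2 ⟨T, rfl⟩
  refine CommGroup.finite_of_fg_isMulTorsion _ fun a => isOfFinOrder_iff_pow_eq_one.2 ⟨n, hn, ?_⟩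
  exact Subtype.ext (hpow a)

theorem exists_mulEquiv_of_pow_prime_eq_one {Q : Type u} [Group Q] [Finite Q]
    (hab : ∀ a b : Q, a * b = b * a) (hpow : ∀ a : Q, a ^ p = 1) :
    ∃ d, Nonempty (Q ≃* Multiplicative (Fin d → ZMod p)) := by
  have key : ∀ (V : Type u) [AddCommGroup V] [Module (ZMod p) V] [Finite V],
      ∃ d, Nonempty (V ≃+ (Fin d → ZMod p)) := by
    intro V _ _ _
    have : Module.Finite (ZMod p) V := Module.Finite.of_finite
    exact ⟨_, ⟨(Module.finBasis (ZMod p) V).equivFun.toAddEquiv⟩⟩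
  let _ : CommGroup Q := { (inferInstance : Group Q) with mul_comm := hab }
  let _ : Module (ZMod p) (Additive Q) :=
    AddCommGroup.zmodModule (G := Additive Q) fun a => hpow a.toMul
  obtain ⟨d, ⟨e⟩⟩ := key (Additive Q)
  exact ⟨d, ⟨AddEquiv.toMultiplicativeRight e⟩⟩

/-- A topologically finitely generated group `G` with `⁅G, G⁆` in the closure of `G ^ p` has finite
elementary abelian quotient by the closure of `G ^ p`. -/
theorem exists_coordinates (hcomm : IsPowSeriesCentral p G)
    (hfg : ∃ S : Finset G, closure (Subgroup.closure (S : Set G) : Set G) = Set.univ) :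
    ∃ (d : ℕ) (c : G →* Multiplicative (Fin d → ZMod p)),
      Function.Surjective c ∧ c.ker = powSeries p G 1 := by
  let N := powSeries p G 1
  let f := QuotientGroup.mk' N
  have hf : Function.Surjective f := QuotientGroup.mk'_surjective N
  have hab : ∀ a b : G ⧸ N, a * b = b * a := by
    intro a b
    obtain ⟨x, rfl⟩ := hf a
    obtain ⟨y, rfl⟩ := hf b
    rw [← map_mul, ← map_mul]
    refine QuotientGroup.eq.2 ?_
    have h := powSeries_antitone (show 1 ≤ 0 + commDrop p by
      rw [commDrop]; split_ifs <;> omega) (hcomm 0 y (Subgroup.mem_top _) x⁻¹)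
    rwa [inv_inv, mul_assoc x⁻¹, ← mul_assoc, ← mul_inv_rev] at h
  have hpow : ∀ a : G ⧸ N, a ^ p = 1 := by
    intro a
    obtain ⟨x, rfl⟩ := hf a
    rw [← map_pow]
    exact (QuotientGroup.eq_one_iff _).2 (pow_mem_powSeries_succ (Subgroup.mem_top x))
  have hfin : Finite (G ⧸ N) := by
    classical
    obtain ⟨S, hS⟩ := hfg
    let W := Subgroup.closure (S.image f : Set (G ⧸ N))
    have hW : Finite W := finite_closure_of_pow_eq_one hab hp.out.pos hpow _
    have hSK : Subgroup.closure (S : Set G) ≤ W.comap f := by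
      rw [Subgroup.closure_le]
      intro g hg
      exact Subgroup.subset_closure (Finset.mem_coe.2 (Finset.mem_image_of_mem f hg))
    -- Openness of `N` is not available yet. The preimage of the finite group `W` is a finite union
    -- of closed cosets of `N`; it is closed and contains a dense subgroup, so it is all of `G`.
    have hclosed : IsClosed (W.comap f : Set G) := by
      have e : (W.comap f : Set G) = ⋃ w : W, {g | f g = w} := by
        ext g
        rw [Set.mem_iUnion]
        exact ⟨fun h => ⟨⟨_, h⟩, rfl⟩, fun ⟨w, hw⟩ => Subgroup.mem_comap.2 (hw ▸ w.2)⟩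
      rw [e]
      refine isClosed_iUnion_of_finite fun w => ?_
      obtain ⟨x, hx⟩ := hf w
      have e2 : {g | f g = w} = {g | x⁻¹ * g ∈ N} := by
        ext g
        refine Iff.trans ?_ (QuotientGroup.eq (s := N))
        rw [Set.mem_ofPred_eq, ← hx]
        exact eq_comm
      rw [e2]
      exact (isClosed_powSeries 1).preimage (by fun_prop)
    have h1 : closure (Subgroup.closure (S : Set G) : Set G) ⊆ W.comap f :=
      closure_minimal hSK hclosed
    rw [hS] at h1
    refine Finite.of_surjective (fun w : W => (w : G ⧸ N)) fun v => ?_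
    obtain ⟨x, rfl⟩ := hf v
    exact ⟨⟨_, h1 (Set.mem_univ x)⟩, rfl⟩
  obtain ⟨d, ⟨e⟩⟩ := exists_mulEquiv_of_pow_prime_eq_one hab hpow
  refine ⟨d, (e : G ⧸ N →* _).comp f, e.surjective.comp hf, ?_⟩
  rw [MonoidHom.ker_mulEquiv_comp, QuotientGroup.ker_mk']

end Coordinates

/-! ### Functoriality of dimension subgroups, and degree-one classes in coordinates -/

section DimensionMap

variable {p : ℕ} [hp : Fact p.Prime] {G : Type u} [Group G] {H : Type v} [Group H]

theorem map_mem_augmentationIdeal_pow {R : Type w} [CommRing R] (f : G →* H) (n : ℕ)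
    {x : MonoidAlgebra R G} (hx : x ∈ augmentationIdeal R G ^ n) :
    MonoidAlgebra.mapDomainRingHom R f x ∈ augmentationIdeal R H ^ n := by
  have h1 : ∀ x ∈ augmentationIdeal R G,
      MonoidAlgebra.mapDomainRingHom R f x ∈ augmentationIdeal R H := by
    intro x hx
    have e : (augmentation R H).toRingHom.comp (MonoidAlgebra.mapDomainRingHom R f) =
        (augmentation R G).toRingHom := by
      refine MonoidAlgebra.ringHom_ext ?_ ?_ <;> intro a <;> simp [augmentation]
    exact (congrArg (fun g : MonoidAlgebra R G →+* R => g x) e).trans hx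
  induction n generalizing x with
  | zero => exact mem_aug_pow_zero _
  | succ n ih =>
    rw [Submodule.pow_succ] at hx
    refine Submodule.mul_induction_on hx ?_ ?_
    · intro a ha b hb
      rw [map_mul]
      refine aug_mul_mem (ih ha) ?_
      rw [Submodule.pow_one]
      exact h1 b hb
    · intro a b ha hb
      rw [map_add]
      exact add_mem ha hb

theorem map_mem_dimensionSubgroup {R : Type w} [CommRing R] (f : G →* H) {n : ℕ} {g : G}
    (hg : g ∈ dimensionSubgroup R G n) : f g ∈ dimensionSubgroup R H n := by
  rw [mem_dimensionSubgroup] at hg ⊢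
  have := map_mem_augmentationIdeal_pow f n hg
  rwa [map_sub, map_one, grp, MonoidAlgebra.of_apply, MonoidAlgebra.mapDomainRingHom_apply,
    MonoidAlgebra.mapDomain_single] at this

theorem pow_mem_dimensionSubgroup {n : ℕ} {g : G} (hg : g ∈ dimensionSubgroup (ZMod p) G n) :
    g ^ p ∈ dimensionSubgroup (ZMod p) G (n * p) := by
  rw [mem_dimensionSubgroup] at hg ⊢
  rw [grp_pow_sub_one]
  exact aug_pow_mem hg p

theorem mem_dimensionSubgroup_one (g : G) : g ∈ dimensionSubgroup (ZMod p) G 1 :=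
  mem_dimensionSubgroup.2 (grp_sub_one_mem_pow_one g)

theorem dimensionSubgroup_antitone {m n : ℕ} (h : m ≤ n) {g : G}
    (hg : g ∈ dimensionSubgroup (ZMod p) G n) : g ∈ dimensionSubgroup (ZMod p) G m :=
  mem_dimensionSubgroup.2 (aug_of_le h (mem_dimensionSubgroup.1 hg))

theorem grp_pow_prime_pow_sub_one (g : G) (k : ℕ) :
    grp (ZMod p) G (g ^ p ^ k) - 1 = (grp (ZMod p) G g - 1) ^ p ^ k := by
  induction k with
  | zero => simp only [pow_zero, pow_one]
  | succ k ih => rw [pow_succ, pow_mul, grp_pow_sub_one, ih, pow_mul]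

/-- In characteristic `p`, `(g - 1) ^ p ^ k = g ^ p ^ k - 1`, and this represents the power of the
class in degree `p ^ k`. -/
theorem symbOne_pow_prime_pow_eq_zero {g : G} {k : ℕ}
    (hg : g ^ p ^ k ∈ dimensionSubgroup (ZMod p) G (p ^ k + 1)) :
    symbOne (ZMod p) g ^ p ^ k = 0 := by
  obtain ⟨h, e⟩ := symbOne_pow (R := ZMod p) g (p ^ k)
  rw [e, symb_eq_zero_iff, ← grp_pow_prime_pow_sub_one]
  exact mem_dimensionSubgroup.1 hg

/-- The homomorphism from a group to the part of degree `1` of the associated graded algebra. -/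
noncomputable def symbOneHom (p : ℕ) (G : Type u) [Group G] :
    G →* Multiplicative (AssocGr (ZMod p) G) :=
  MonoidHom.mk' (fun g => Multiplicative.ofAdd (symbOne (ZMod p) g)) fun g h =>
    congrArg Multiplicative.ofAdd (symb_one_mul g h)

/-- The class is additive in `g` and trivial on the kernel of `c`, so it factors through a linear
map on the coordinate space, which is determined by its values at the unit vectors `c (a i)`. -/
theorem symbOne_eq_sum {d : ℕ} (f : G →* H) (c : G →* Multiplicative (Fin d → ZMod p))
    (hc : Function.Surjective c) (hker : ∀ g ∈ c.ker, symbOne (ZMod p) (f g) = 0)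
    (a : Fin d → G) (ha : ∀ i, c (a i) = Multiplicative.ofAdd (Pi.single i 1)) (g : G) :
    symbOne (ZMod p) (f g) =
      ∑ i, (Multiplicative.toAdd (c g)) i • symbOne (ZMod p) (f (a i)) := by
  let θ := MonoidHom.liftOfSurjective c hc ⟨(symbOneHom p H).comp f, fun g hg => hker g hg⟩
  have hθ : ∀ g, θ (c g) = Multiplicative.ofAdd (symbOne (ZMod p) (f g)) := fun g =>
    MonoidHom.liftOfRightInverse_comp_apply c _ (Function.rightInverse_surjInv hc)
      ⟨(symbOneHom p H).comp f, fun g hg => hker g hg⟩ g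
  let L : (Fin d → ZMod p) →ₗ[ZMod p] AssocGr (ZMod p) H :=
    AddMonoidHom.toZModLinearMap p (MonoidHom.toAdditive θ)
  have hL : ∀ g, L (Multiplicative.toAdd (c g)) = symbOne (ZMod p) (f g) := fun g =>
    congrArg Multiplicative.toAdd (hθ g)
  rw [← hL, LinearMap.pi_apply_eq_sum_univ L]
  refine Finset.sum_congr rfl fun i _ => ?_
  rw [← hL, ha]
  congr 2
  ext j
  simp [Pi.single_apply, eq_comm]

end DimensionMap

/-! ### Assembly for uniform pro-`p` groups -/

section Uniform

variable {p : ℕ} [hp : Fact p.Prime] {G : Type u} [Group G] [TopologicalSpace G]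

/-- For odd `p` a commutator is a `p`-th power, hence in `D_p ≤ D_3`. Squares only reach `D_2`, but
for `p = 2` commutators lie in `P_2` and are fourth powers, hence in `D_4`. -/
theorem commutator_mem_dimensionSubgroup_three [IsTopologicalGroup G] [CompactSpace G]
    [TotallyDisconnectedSpace G] (hcomm : IsPowSeriesCentral p G) (hG : HasPrimePowIndex p G)
    (x y : G) : x * y * x⁻¹ * y⁻¹ ∈ dimensionSubgroup (ZMod p) G 3 := by
  have h := hcomm 0 y⁻¹ (Subgroup.mem_top _) x
  have e : x * y * x⁻¹ * y⁻¹ = (y⁻¹⁻¹ * (x * y⁻¹ * x⁻¹))⁻¹ := by group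
  rw [e]
  refine inv_mem ?_
  generalize y⁻¹⁻¹ * (x * y⁻¹ * x⁻¹) = z at h
  by_cases h2 : p = 2
  · subst h2
    obtain ⟨w, hw, rfl⟩ := exists_pow_eq_of_mem_powSeries_succ (n := 1) hcomm hG h
    obtain ⟨v, _, rfl⟩ := exists_pow_eq_of_mem_powSeries_succ (n := 0) hcomm hG hw
    exact dimensionSubgroup_antitone (by norm_num)
      (pow_mem_dimensionSubgroup (pow_mem_dimensionSubgroup (mem_dimensionSubgroup_one v)))
  · rw [commDrop, if_neg h2] at h
    obtain ⟨w, _, rfl⟩ := exists_pow_eq_of_mem_powSeries_succ (n := 0) hcomm hG h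
    have := hp.out.two_le
    exact dimensionSubgroup_antitone (by omega)
      (pow_mem_dimensionSubgroup (mem_dimensionSubgroup_one w))

/-- The power `g ^ p ^ k` lies in the dimension subgroup of index `p ^ k + 1` only if `g` is a
`p`-th power. -/
theorem exists_pow_eq_of_pow_mem_dimensionSubgroup [IsTopologicalGroup G] [CompactSpace G]
    [TotallyDisconnectedSpace G] (hcomm : IsPowSeriesCentral p G) (hG : HasPrimePowIndex p G)
    (htf : ∀ g : G, IsOfFinOrder g → g = 1)
    (hfg : ∃ S : Finset G, closure (Subgroup.closure (S : Set G) : Set G) = Set.univ)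
    (k : ℕ) (g : G) (hg : g ^ p ^ k ∈ dimensionSubgroup (ZMod p) G (p ^ k + 1)) :
    ∃ x, x ^ p = g := by
  obtain ⟨d, c, hc, hker⟩ := exists_coordinates hcomm hfg
  -- The level `k + 1` makes the truncation exponent `p ^ (k + 1)`, so that `X_i ^ p ^ k` is still
  -- an admissible monomial.
  let f := QuotientGroup.mk' (powSeries p G (k + 1))
  have hf : Function.Surjective f := QuotientGroup.mk'_surjective _
  have hindex : (powSeries p G 1).index = p ^ d := by
    rw [← hker, Subgroup.index_ker, MonoidHom.range_eq_top.2 hc, Subgroup.card_top]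
    change Nat.card (Fin d → ZMod p) = _
    rw [Nat.card_fun, Nat.card_fin, Nat.card_zmod]
  have hcard : Nat.card (G ⧸ powSeries p G (k + 1)) = (p ^ (k + 1)) ^ d := by
    rw [← Subgroup.index, index_powSeries hcomm hG htf, hindex, ← pow_mul, ← pow_mul, mul_comm]
  have hfin : Finite (G ⧸ powSeries p G (k + 1)) := by
    refine Nat.finite_of_card_ne_zero ?_
    rw [hcard]
    exact pow_ne_zero _ (pow_ne_zero _ hp.out.ne_zero)
  have hQ : IsPGroup p (G ⧸ powSeries p G (k + 1)) := by
    rw [← pow_mul] at hcard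
    exact IsPGroup.of_card hcard
  have hQc : ∀ x y : G ⧸ powSeries p G (k + 1),
      x * y * x⁻¹ * y⁻¹ ∈ dimensionSubgroup (ZMod p) _ 3 := by
    intro x y
    obtain ⟨x, rfl⟩ := hf x
    obtain ⟨y, rfl⟩ := hf y
    rw [← map_inv, ← map_inv, ← map_mul, ← map_mul, ← map_mul]
    exact map_mem_dimensionSubgroup f (commutator_mem_dimensionSubgroup_three hcomm hG x y)
  choose a ha using fun i => hc (Multiplicative.ofAdd (Pi.single i 1))
  -- The kernel `P_1` consists of `p`-th powers, which lie in `D_p ≤ D_2` and vanish in degree one.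
  have hker0 : ∀ g ∈ c.ker, symbOne (ZMod p) (f g) = 0 := by
    intro g hg
    rw [hker] at hg
    obtain ⟨x, _, rfl⟩ := exists_pow_eq_of_mem_powSeries_succ (n := 0) hcomm hG hg
    rw [symbOne, symb_eq_zero_iff, map_pow, ← mem_dimensionSubgroup]
    refine dimensionSubgroup_antitone ?_ (pow_mem_dimensionSubgroup (mem_dimensionSubgroup_one (f x)))
    have := hp.out.two_le
    omega
  have hsum := symbOne_eq_sum f c hc hker0 a ha
  choose s hs using hf
  have hcg : ∀ q, symbOne (ZMod p) q =
      ∑ i, (Multiplicative.toAdd (c (s q))) i • symbOne (ZMod p) (f (a i)) := by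
    intro q
    rw [← hsum, hs]
  have haq : ∀ i, symbOne (ZMod p) (f (a i)) ^ p ^ (k + 1) = 0 := by
    intro i
    refine symbOne_pow_prime_pow_eq_zero ?_
    have h1 : f (a i) ^ p ^ (k + 1) = 1 := by
      rw [← map_pow]
      exact (QuotientGroup.eq_one_iff _).2 (pow_prime_pow_mem_powSeries (a i) (k + 1))
    rw [h1]
    exact one_mem _
  have hz : ∑ i, (Multiplicative.toAdd (c g)) i • symbOne (ZMod p) (f (a i)) ^ p ^ k = 0 := by
    have h1 : symbOne (ZMod p) (f g) ^ p ^ k = 0 := by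
      refine symbOne_pow_prime_pow_eq_zero ?_
      rw [← map_pow]
      exact map_mem_dimensionSubgroup f hg
    let _ := assocGrCommRing hQc
    -- Nontriviality is needed for characteristic `p`. Then the `p ^ k`-th power is additive on the
    -- commutative graded algebra and fixes scalars of `𝔽_p`.
    rcases subsingleton_or_nontrivial (AssocGr (ZMod p) (G ⧸ powSeries p G (k + 1))) with hs | hs
    · exact Subsingleton.elim _ _
    have hchar : CharP (AssocGr (ZMod p) (G ⧸ powSeries p G (k + 1))) p :=
      charP_of_injective_algebraMap' (ZMod p) p
    have hexp : ExpChar (AssocGr (ZMod p) (G ⧸ powSeries p G (k + 1))) p := ExpChar.prime hp.out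
    rw [hsum, sum_pow_char_pow p k] at h1
    rw [← h1]
    refine Finset.sum_congr rfl fun i _ => ?_
    rw [smul_pow, ZMod.pow_card_pow]
  have h0 := coeff_eq_zero_of_sum_symbOne_pow_eq_zero hQ hQc (fun i => f (a i))
    (fun q => Multiplicative.toAdd (c (s q))) hcg haq (by rw [hcard, Fintype.card_fin])
    (pow_pos hp.out.pos k) (Nat.pow_lt_pow_right hp.out.one_lt (Nat.lt_succ_self k)) _ hz
  -- All coordinates of `g` vanish, so `g` lies in the kernel `P_1` of `c`, and elements of `P_1`
  -- are `p`-th powers.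
  have hgk : g ∈ powSeries p G 1 := by
    rw [← hker, MonoidHom.mem_ker, ← ofAdd_toAdd (c g), h0]
    rfl
  obtain ⟨x, _, hx⟩ := exists_pow_eq_of_mem_powSeries_succ (n := 0) hcomm hG hgk
  exact ⟨x, hx⟩

/-- Powerfulness starts the induction: `p`-th powers lie in `P_1` and, if `p = 2`, fourth powers lie
in `P_2`; these terms are closed, so they contain the closure. -/
theorem IsUniformProP.isPowSeriesCentral [IsTopologicalGroup G] [CompactSpace G]
    [TotallyDisconnectedSpace G] (hG : IsUniformProP p G) : IsPowSeriesCentral p G := by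
  refine _root_.isPowSeriesCentral hG.index_eq fun x g => ?_
  have h1 : x⁻¹ * (g * x * g⁻¹) ∈ commutator G := by
    have := Subgroup.commutator_mem_commutator (Subgroup.mem_top x⁻¹) (Subgroup.mem_top g)
    rwa [commutatorElement_def, inv_inv, mul_assoc, mul_assoc, ← mul_assoc g] at this
  have h2 := hG.powerful h1
  have hle : powSubgroup G (if p = 2 then 4 else p) ≤ powSeries p G (commDrop p) := by
    rw [powSubgroup, Subgroup.closure_le]
    rintro _ ⟨y, rfl⟩
    by_cases hp2 : p = 2
    · subst hp2
      exact pow_prime_pow_mem_powSeries (p := 2) y 2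
    · rw [commDrop, if_neg hp2, if_neg hp2]
      exact pow_mem_powSeries_succ (n := 0) (Subgroup.mem_top y)
  exact closure_minimal hle (isClosed_powSeries _) h2

end Uniform

theorem corollary2 (p : ℕ) [Fact p.Prime] (G : Type*) [Group G] [TopologicalSpace G]
    (hG : IsUniformProP p G) :
    IsLieAbelian (ZassenhausLie p G) ∧
      (thetaHat p G).ker = restrictedIdealSpan p (ZMod p)
        (Restrictification.of p (ZMod p) (MagnusLieMod p G) '' (magnusModGeTwo p G)) := by
  have _ := hG.isTopologicalGroup
  have _ := hG.compactSpace
  have _ := hG.totallyDisconnectedSpace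
  have hcomm := hG.isPowSeriesCentral
  have h3 := commutator_mem_dimensionSubgroup_three hcomm hG.index_eq
  exact ⟨zassenhausLie_isLieAbelian h3, ker_thetaHat_eq h3
    (exists_pow_eq_of_pow_mem_dimensionSubgroup hcomm hG.index_eq hG.torsionFree
      hG.finitelyGenerated)⟩
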